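/- Let $n,m,n_1,n_2,m_1,m_2$ be nonnegative integers, and let $f:\mathbb R^n\times\mathbb R^m\to\mathbb R$, $h:\mathbb R^n\times\mathbb R^m\to\mathbb R^{m_1}$, $g:\mathbb R^n\times\mathbb R^m\to\mathbb R^{m_2}$, $H:\mathbb R^n\to\mathbb R^{n_1}$, $G:\mathbb R^n\to\mathbb R^{n_2}$. Consider the problem $$\min_{x\in\Phi}\ \max_{y\in Y(x)} f(x,y),\qquad \Phi=\{x: H(x)=0,\ G(x)\le 0\},\quad Y(x)=\{y: h(x,y)=0,\ g(x,y)\le 0\},$$ and put $\mathcal L(x,y,\mu,\lambda)=f(x,y)+\mu^Th(x,y)-\lambda^Tg(x,y)$. Write $\mathcal J$ for Jacobians. The KKT conditions at $(x,u,v,y,\mu,\lambda)$ are $$(1)\quad \nabla_x\mathcal L(x,y,\mu,\lambda)+\mathcal JH(x)^Tu+\mathcal JG(x)^Tv=0,\quad H(x)=0,\quad 0\le v\perp G(x)\le 0,$$ $$(2)\quad \nabla_y\mathcal L(x,y,\mu,\lambda)=0,\quad h(x,y)=0,\quad 0\le\lambda\perp g(x,y)\le 0.$$ Let $f,h,g$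 be twice continuously differentiable around $(x^*,y^*)$, let $H,G$ be twice continuously differentiable around $x^*$, and let $(x^*,u^*,v^*,y^*,\mu^*,\lambda^*)$ satisfy the KKT conditions (1) and (2). Set $w^*=v^*+G(x^*)$ and $\xi^*=\lambda^*+g(x^*,y^*)$. *Kojima mapping.* With $a^+=\max\{0,a\}$ and $a^-=\min\{0,a\}$ componentwise, $$F(x,u,w,y,\mu,\xi)=\big(\nabla_x\mathcal L(x,y,\mu,\xi^+)+\mathcal JH(x)^Tu+\mathcal JG(x)^Tw^+,\ H(x),\ G(x)-w^-,\ \nabla_y\mathcal L(x,y,\mu,\xi^+),\ h(x,y),\ -g(x,y)+\xi^-\big).$$ The Clarke generalized Jacobian $\partial F(p)$ is the convex hull of the set of all limits $\lim_k \mathcal JF(p^k)$ with $p^k\to p$ and $F$ differentiable at each $p^k$. *Generalized equation.* Let $\mathcal K=\mathbb R^n\times\mathbb R^{n_1}\times\mathbb R^{n_2}_+\times\mathbb R^m\times\mathbb R^{m_1}\times\mathbb R^{m_2}_+$, let $N_{\mathcal K}$ be its normal cone, let $z=(x,u,v,y,\mu,\lambda)$, and $$\mathcal H(z)=\big(\nabla_x\mathcal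 L(x,y,\mu,\lambda)+\mathcal JH(x)^Tu+\mathcal JG(x)^Tv,\ H(x),\ -G(x),\ \nabla_y\mathcal L(x,y,\mu,\lambda),\ h(x,y),\ -g(x,y)\big).$$ A solution $z^*$ of $0\in\mathcal H(z)+N_{\mathcal K}(z)$ is *strongly regular* if there are $\delta,\varepsilon>0$ such that for every $\eta$ in the closed ball $\mathbf B(0,\delta)$ the linearized generalized equation $\eta\in\mathcal H(z^*)+\mathcal J\mathcal H(z^*)(z-z^*)+N_{\mathcal K}(z)$ has a unique solution $\hat z(\eta)$ in $\mathbf B(z^*,\varepsilon)$, and $\hat z$ is Lipschitz continuous on $\mathbf B(0,\delta)$. *Property A.* Let $I=\{i:G_i(x^*)=0\}$ and $\alpha=\{i:g_i(x^*,y^*)=0\}$. Evaluating $\mathcal L$ and its derivatives at $(x^*,y^*,\mu^*,\lambda^*)$ and those of $h,g$ at $(x^*,y^*)$, put $$K_\alpha=\begin{bmatrix}\nabla^2_{yy}\mathcal L&\mathcal J_yh^T&-\mathcal J_yg_\alpha^T\\ \mathcal J_yh&0&0\\ -\mathcal J_yg_\alpha&0&0\end{bmatrix},\qquad N_\alpha=\begin{bmatrix}\mathcal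 J_x(\nabla_y\mathcal L)\\ \mathcal J_xh\\ -\mathcal J_xg_\alpha\end{bmatrix}.$$ Let $\Lambda$ be the set of all $(u,v)$ for which (1) holds at $(x^*,u,v,y^*,\mu^*,\lambda^*)$, and let $$\mathcal C=\{d\in\mathbb R^n:\ \mathcal JH(x^*)d=0,\ \nabla G_i(x^*)^Td\le0\ (i\in I),\ \nabla_x\mathcal L^Td\le0\},$$ $$\mathcal C_y=\{d\in\mathbb R^m:\ \mathcal J_yh\,d=0,\ \nabla_yg_i^Td\le 0\ (i\in\alpha),\ \nabla_yf(x^*,y^*)^Td\ge0\}.$$ Property A at $(x^*,u^*,v^*,y^*,\mu^*,\lambda^*)$ means: (i) $x^*\in\Phi$ and (1) holds; (ii) the vectors $\nabla H_j(x^*)$, $j=1,\dots,n_1$, and $\nabla G_i(x^*)$, $i\in I$, are linearly independent; (iii) $y^*\in Y(x^*)$ and the Jacobian uniqueness conditions hold for the inner problem: (2) holds; the vectors $\nabla_yh_j(x^*,y^*)$, $j=1,\dots,m_1$, and $\nabla_yg_i(x^*,y^*)$, $i\in\alpha$, are linearly independent; $\lambda^*_i-g_i(x^*,y^*)>0$ for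 all $i$; and $\langle\nabla^2_{yy}\mathcal L\,d,d\rangle<0$ for all $d\in\mathcal C_y\setminus\{0\}$; (iv) for every $d\in\operatorname{Aff}\mathcal C\setminus\{0\}$ (the affine hull), $$\sup_{(u,v)\in\Lambda}\Big\langle\Big[\sum_{j}u_j\nabla^2H_j(x^*)+\sum_i v_i\nabla^2G_i(x^*)\Big]d,d\Big\rangle+\big\langle\big[\nabla^2_{xx}\mathcal L-N_\alpha^TK_\alpha^{-1}N_\alpha\big]d,d\big\rangle>0.$$ Consider the statements: (a) Property A holds at $(x^*,u^*,v^*,y^*,\mu^*,\lambda^*)$. (b) Every element of $\partial F(x^*,u^*,w^*,y^*,\mu^*,\xi^*)$ is nonsingular. (c) $F$ is a locally Lipschitz homeomorphism near $p^*=(x^*,u^*,w^*,y^*,\mu^*,\xi^*)$: it maps an open neighbourhood of $p^*$ bijectively onto an open neighbourhood of $F(p^*)$, and both this restriction and its inverse are Lipschitz continuous. (d) $(x^*,u^*,v^*,y^*,\mu^*,\lambda^*)$ is a strongly regular solution of $0\in\mathcal H(z)+N_{\mathcal K}(z)$. Then (a) $\Rightarrow$ (b) $\Rightarrow$ (c)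 $\Leftrightarrow$ (d). -/

import Mathlib

open Filter Topology
open scoped NNReal Matrix

noncomputable section

/-- The Euclidean space of dimension `k`. -/
abbrev Vec (k : ℕ) : Type := EuclideanSpace ℝ (Fin k)

/-- The space of the tuples `(x, u, v, y, μ, λ)`, also of the tuples `(x, u, w, y, μ, ξ)` and of the
perturbations `(η_x, η_H, η_G, η_y, η_h, η_g)`. It carries the maximum of the Euclidean norms of the
blocks, a norm that is equivalent to the Euclidean one; the Euclidean inner product is `blockInner`. -/
abbrev PDSpace (n m n₁ n₂ m₁ m₂ : ℕ) : Type :=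
  Vec n × Vec n₁ × Vec n₂ × Vec m × Vec m₁ × Vec m₂

/-- The Euclidean inner product of two tuples. -/
def blockInner {n m n₁ n₂ m₁ m₂ : ℕ} (a b : PDSpace n m n₁ n₂ m₁ m₂) : ℝ :=
  inner ℝ a.1 b.1 + inner ℝ a.2.1 b.2.1 + inner ℝ a.2.2.1 b.2.2.1 + inner ℝ a.2.2.2.1 b.2.2.2.1 +
    inner ℝ a.2.2.2.2.1 b.2.2.2.2.1 + inner ℝ a.2.2.2.2.2 b.2.2.2.2.2

/-- The componentwise positive part `a⁺ = max {0, a}`. -/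
def vecPos {k : ℕ} (a : Vec k) : Vec k := WithLp.toLp 2 fun i => max 0 (a i)

/-- The componentwise negative part `a⁻ = min {0, a}` (a nonpositive vector). -/
def vecNeg {k : ℕ} (a : Vec k) : Vec k := WithLp.toLp 2 fun i => min 0 (a i)

/-- The Jacobian matrix of `φ` at `x`. -/
def jacMat {a b : ℕ} (φ : Vec a → Vec b) (x : Vec a) : Matrix (Fin b) (Fin a) ℝ :=
  Matrix.of fun i j => fderiv ℝ φ x (EuclideanSpace.single j 1) i

/-- The Hessian matrix of `φ` at `x`. -/
def hessMat {a : ℕ} (φ : Vec a → ℝ) (x : Vec a) : Matrix (Fin a) (Fin a) ℝ :=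
  jacMat (fun x' => gradient φ x') x

/-- The quadratic form `⟨M d, d⟩`. -/
def quadForm {a : ℕ} (M : Matrix (Fin a) (Fin a) ℝ) (d : Vec a) : ℝ :=
  (M *ᵥ d.ofLp) ⬝ᵥ d.ofLp

/-- The relation `0 ≤ a ⊥ b ≤ 0`. -/
def Complementary {k : ℕ} (a b : Vec k) : Prop :=
  (∀ i, 0 ≤ a i) ∧ inner ℝ a b = 0 ∧ ∀ i, b i ≤ 0

section Nonsmooth

variable {E E' : Type*} [NormedAddCommGroup E] [NormedSpace ℝ E]
  [NormedAddCommGroup E'] [NormedSpace ℝ E']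

/-- The B-subdifferential: limits of derivatives at points of differentiability tending to `x`. -/
def bSubdifferential (Φ : E → E') (x : E) : Set (E →L[ℝ] E') :=
  {V | ∃ s : ℕ → E, (∀ k, DifferentiableAt ℝ Φ (s k)) ∧ Tendsto s atTop (𝓝 x) ∧
    Tendsto (fun k => fderiv ℝ Φ (s k)) atTop (𝓝 V)}

/-- The Clarke generalized Jacobian. -/
def clarkeJacobian (Φ : E → E') (x : E) : Set (E →L[ℝ] E') :=
  convexHull ℝ (bSubdifferential Φ x)

/-- `Φ` is a locally Lipschitz homeomorphism near `x`: it maps some open neighbourhood of `x`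
bijectively onto an open neighbourhood of `Φ x`, and both the restriction and its inverse are
Lipschitz continuous. -/
def LocallyLipschitzHomeomorphNear (Φ : E → E') (x : E) : Prop :=
  ∃ (U : Set E) (W : Set E') (Ψ : E' → E), IsOpen U ∧ IsOpen W ∧ x ∈ U ∧ Φ x ∈ W ∧
    Set.MapsTo Φ U W ∧ Set.MapsTo Ψ W U ∧ Set.InvOn Ψ Φ U W ∧
    (∃ C : ℝ≥0, LipschitzOnWith C Φ U) ∧ ∃ C : ℝ≥0, LipschitzOnWith C Ψ W

end Nonsmooth

/-- The data of the problem `min_{x ∈ Φ} max_{y ∈ Y(x)} f(x, y)`, where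
`Φ = {x | H(x) = 0, G(x) ≤ 0}` and `Y(x) = {y | h(x, y) = 0, g(x, y) ≤ 0}`. -/
structure MinimaxProblem (n m n₁ n₂ m₁ m₂ : ℕ) where
  f : Vec n → Vec m → ℝ
  h : Vec n → Vec m → Vec m₁
  g : Vec n → Vec m → Vec m₂
  H : Vec n → Vec n₁
  G : Vec n → Vec n₂

namespace MinimaxProblem

variable {n m n₁ n₂ m₁ m₂ : ℕ} (P : MinimaxProblem n m n₁ n₂ m₁ m₂)

/-- The feasible set `Φ`. -/
def feasX : Set (Vec n) := {x | P.H x = 0 ∧ ∀ i, P.G x i ≤ 0}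

/-- The feasible set `Y(x)`. -/
def feasY (x : Vec n) : Set (Vec m) := {y | P.h x y = 0 ∧ ∀ i, P.g x y i ≤ 0}

/-- The Lagrangian `L(x, y, μ, λ) = f(x, y) + ⟨μ, h(x, y)⟩ - ⟨λ, g(x, y)⟩` of the inner problem. -/
def lagr (x : Vec n) (y : Vec m) (mu : Vec m₁) (lam : Vec m₂) : ℝ :=
  P.f x y + inner ℝ mu (P.h x y) - inner ℝ lam (P.g x y)

/-- The partial gradient `∇_x L`. -/
def gradX (x : Vec n) (y : Vec m) (mu : Vec m₁) (lam : Vec m₂) : Vec n :=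
  gradient (fun x' => P.lagr x' y mu lam) x

/-- The partial gradient `∇_y L`. -/
def gradY (x : Vec n) (y : Vec m) (mu : Vec m₁) (lam : Vec m₂) : Vec m :=
  gradient (fun y' => P.lagr x y' mu lam) y

/-- `∇_x L(x, y, μ, λ) + JH(x)ᵀ u + JG(x)ᵀ v`. -/
def stationX (x : Vec n) (u : Vec n₁) (v : Vec n₂) (y : Vec m) (mu : Vec m₁) (lam : Vec m₂) :
    Vec n :=
  P.gradX x y mu lam + ContinuousLinearMap.adjoint (fderiv ℝ P.H x) u +
    ContinuousLinearMap.adjoint (fderiv ℝ P.G x) v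

/-- The KKT conditions of the outer problem. -/
def OuterKKT (x : Vec n) (u : Vec n₁) (v : Vec n₂) (y : Vec m) (mu : Vec m₁) (lam : Vec m₂) :
    Prop :=
  P.stationX x u v y mu lam = 0 ∧ P.H x = 0 ∧ Complementary v (P.G x)

/-- The KKT conditions of the inner problem `(P_x)`: maximize `f(x, ·)` over `Y(x)`. -/
def InnerKKT (x : Vec n) (y : Vec m) (mu : Vec m₁) (lam : Vec m₂) : Prop :=
  P.gradY x y mu lam = 0 ∧ P.h x y = 0 ∧ Complementary lam (P.g x y)

/-- The KKT conditions of the minimax problem. -/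
def IsKKT (x : Vec n) (u : Vec n₁) (v : Vec n₂) (y : Vec m) (mu : Vec m₁) (lam : Vec m₂) : Prop :=
  P.OuterKKT x u v y mu lam ∧ P.InnerKKT x y mu lam

/-- The critical cone of the (maximization) problem `(P_x)` at `y`. -/
def innerCriticalCone (x : Vec n) (y : Vec m) : Set (Vec m) :=
  {d | fderiv ℝ (fun y' => P.h x y') y d = 0 ∧
    (∀ i, P.g x y i = 0 → inner ℝ (gradient (fun y' => P.g x y' i) y) d ≤ 0) ∧
    0 ≤ inner ℝ (gradient (fun y' => P.f x y') y) d}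

/-- The Jacobian uniqueness conditions of the inner problem `(P_x)` at `(y, μ, λ)`. -/
structure JacobianUniqueness (x : Vec n) (y : Vec m) (mu : Vec m₁) (lam : Vec m₂) : Prop where
  kkt : P.InnerKKT x y mu lam
  licq : LinearIndependent ℝ
    (Sum.elim (fun j : Fin m₁ => gradient (fun y' => P.h x y' j) y)
      (fun i : {i : Fin m₂ // P.g x y i = 0} => gradient (fun y' => P.g x y' i) y))
  strictCompl : ∀ i, 0 < lam i - P.g x y i
  sosc : ∀ d ∈ P.innerCriticalCone x y, d ≠ 0 →
    quadForm (hessMat (fun y' => P.lagr x y' mu lam) y) d < 0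

/-- The indices of the active inner inequality constraints. -/
abbrev ActiveY (x : Vec n) (y : Vec m) : Type := {i : Fin m₂ // P.g x y i = 0}

/-- The Jacobian matrix of `g_α(x, ·)` at `y`. -/
def jacYgAct (x : Vec n) (y : Vec m) : Matrix (P.ActiveY x y) (Fin m) ℝ :=
  (jacMat (fun y' => P.g x y') y).submatrix Subtype.val id

/-- The Jacobian matrix of `g_α(·, y)` at `x`. -/
def jacXgAct (x : Vec n) (y : Vec m) : Matrix (P.ActiveY x y) (Fin n) ℝ :=
  (jacMat (fun x' => P.g x' y) x).submatrix Subtype.val id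

/-- The matrix `K_α`, with rows `(∇²_yy L, J_y hᵀ, -J_y g_αᵀ)`, `(J_y h, 0, 0)`,
`(-J_y g_α, 0, 0)`. -/
def matK (x : Vec n) (y : Vec m) (mu : Vec m₁) (lam : Vec m₂) :
    Matrix (Fin m ⊕ (Fin m₁ ⊕ P.ActiveY x y)) (Fin m ⊕ (Fin m₁ ⊕ P.ActiveY x y)) ℝ :=
  Matrix.fromBlocks
    (hessMat (fun y' => P.lagr x y' mu lam) y)
    (Matrix.fromCols (jacMat (fun y' => P.h x y') y)ᵀ (-(P.jacYgAct x y)ᵀ))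
    (Matrix.fromRows (jacMat (fun y' => P.h x y') y) (-(P.jacYgAct x y)))
    0

/-- The matrix `N_α`, with block rows `∇²_xy L` (as the Jacobian in `x` of `∇_y L`), `J_x h`,
`-J_x g_α`. -/
def matN (x : Vec n) (y : Vec m) (mu : Vec m₁) (lam : Vec m₂) :
    Matrix (Fin m ⊕ (Fin m₁ ⊕ P.ActiveY x y)) (Fin n) ℝ :=
  Matrix.fromRows (jacMat (fun x' => P.gradY x' y mu lam) x)
    (Matrix.fromRows (jacMat (fun x' => P.h x' y) x) (-(P.jacXgAct x y)))

/-- The matrix `∇²_xx L - N_αᵀ K_α⁻¹ N_α`. -/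
def matReduced (x : Vec n) (y : Vec m) (mu : Vec m₁) (lam : Vec m₂) : Matrix (Fin n) (Fin n) ℝ :=
  hessMat (fun x' => P.lagr x' y mu lam) x -
    (P.matN x y mu lam)ᵀ * (P.matK x y mu lam)⁻¹ * P.matN x y mu lam

/-- The matrix `∑ j, u_j ∇²H_j(x) + ∑ i, v_i ∇²G_i(x)`. -/
def matConstr (x : Vec n) (u : Vec n₁) (v : Vec n₂) : Matrix (Fin n) (Fin n) ℝ :=
  ∑ j, u j • hessMat (fun x' => P.H x' j) x + ∑ i, v i • hessMat (fun x' => P.G x' i) x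

/-- The set of the multipliers `(u, v)` of the outer problem at `(x, y, μ, λ)`. -/
def outerMultipliers (x : Vec n) (y : Vec m) (mu : Vec m₁) (lam : Vec m₂) :
    Set (Vec n₁ × Vec n₂) :=
  {p | P.OuterKKT x p.1 p.2 y mu lam}

/-- The critical cone of the outer problem. -/
def outerCriticalCone (x : Vec n) (y : Vec m) (mu : Vec m₁) (lam : Vec m₂) : Set (Vec n) :=
  {d | fderiv ℝ P.H x d = 0 ∧
    (∀ i, P.G x i = 0 → inner ℝ (gradient (fun x' => P.G x' i) x) d ≤ 0) ∧
    inner ℝ (P.gradX x y mu lam) d ≤ 0}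

/-- Property A. The supremum is taken in the extended reals. -/
structure PropertyA (x : Vec n) (u : Vec n₁) (v : Vec n₂) (y : Vec m) (mu : Vec m₁)
    (lam : Vec m₂) : Prop where
  memX : x ∈ P.feasX
  outerKKT : P.OuterKKT x u v y mu lam
  licq : LinearIndependent ℝ
    (Sum.elim (fun j : Fin n₁ => gradient (fun x' => P.H x' j) x)
      (fun i : {i : Fin n₂ // P.G x i = 0} => gradient (fun x' => P.G x' i) x))
  memY : y ∈ P.feasY x
  innerJU : P.JacobianUniqueness x y mu lam
  strongSOSC : ∀ d ∈ affineSpan ℝ (P.outerCriticalCone x y mu lam), d ≠ 0 →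
    (0 : EReal) <
      (⨆ p ∈ P.outerMultipliers x y mu lam, ((quadForm (P.matConstr x p.1 p.2) d : ℝ) : EReal)) +
        ((quadForm (P.matReduced x y mu lam) d : ℝ) : EReal)

/-- The Kojima mapping, at `(x, u, w, y, μ, ξ)`. -/
def kojima (p : PDSpace n m n₁ n₂ m₁ m₂) : PDSpace n m n₁ n₂ m₁ m₂ :=
  match p with
  | (x, u, w, y, mu, xi) =>
    (P.stationX x u (vecPos w) y mu (vecPos xi), P.H x, P.G x - vecNeg w,
      P.gradY x y mu (vecPos xi), P.h x y, -P.g x y + vecNeg xi)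

/-- The single-valued part of the KKT generalized equation, at `(x, u, v, y, μ, λ)`. -/
def geMap (z : PDSpace n m n₁ n₂ m₁ m₂) : PDSpace n m n₁ n₂ m₁ m₂ :=
  match z with
  | (x, u, v, y, mu, lam) =>
    (P.stationX x u v y mu lam, P.H x, -P.G x, P.gradY x y mu lam, P.h x y, -P.g x y)

end MinimaxProblem

section GeneralizedEquation

variable {n m n₁ n₂ m₁ m₂ : ℕ}

/-- The cone of the tuples `(x, u, v, y, μ, λ)` with `v ≥ 0` and `λ ≥ 0`. -/
def coneK (n m n₁ n₂ m₁ m₂ : ℕ) : Set (PDSpace n m n₁ n₂ m₁ m₂) :=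
  {z | (∀ i, 0 ≤ z.2.2.1 i) ∧ ∀ i, 0 ≤ z.2.2.2.2.2 i}

/-- The normal cone of convex analysis to `S` at `z`, empty if `z ∉ S`. -/
def normalConeAt (S : Set (PDSpace n m n₁ n₂ m₁ m₂)) (z : PDSpace n m n₁ n₂ m₁ m₂) :
    Set (PDSpace n m n₁ n₂ m₁ m₂) :=
  {ν | z ∈ S ∧ ∀ z' ∈ S, blockInner ν (z' - z) ≤ 0}

/-- `η ∈ T(z) + N_K(z)`. -/
def SolvesGE (T : PDSpace n m n₁ n₂ m₁ m₂ → PDSpace n m n₁ n₂ m₁ m₂)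
    (η z : PDSpace n m n₁ n₂ m₁ m₂) : Prop :=
  ∃ ν ∈ normalConeAt (coneK n m n₁ n₂ m₁ m₂) z, η = T z + ν

/-- The linearization of `T` at `z₀`. -/
def linearizationAt (T : PDSpace n m n₁ n₂ m₁ m₂ → PDSpace n m n₁ n₂ m₁ m₂)
    (z₀ z : PDSpace n m n₁ n₂ m₁ m₂) : PDSpace n m n₁ n₂ m₁ m₂ :=
  T z₀ + fderiv ℝ T z₀ (z - z₀)

/-- `z₀` is a strongly regular solution (in the sense of Robinson) of `0 ∈ T(z) + N_K(z)`: for all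
small `η` the linearized generalized equation has exactly one solution near `z₀`, and this solution
is a Lipschitz continuous function of `η`. -/
def StronglyRegularSolution (T : PDSpace n m n₁ n₂ m₁ m₂ → PDSpace n m n₁ n₂ m₁ m₂)
    (z₀ : PDSpace n m n₁ n₂ m₁ m₂) : Prop :=
  SolvesGE T 0 z₀ ∧
  ∃ δ > (0 : ℝ), ∃ ε > (0 : ℝ), ∃ zhat : PDSpace n m n₁ n₂ m₁ m₂ → PDSpace n m n₁ n₂ m₁ m₂,
    (∀ η ∈ Metric.closedBall 0 δ,
      zhat η ∈ Metric.closedBall z₀ ε ∧ SolvesGE (linearizationAt T z₀) η (zhat η) ∧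
      ∀ z ∈ Metric.closedBall z₀ ε, SolvesGE (linearizationAt T z₀) η z → z = zhat η) ∧
    ∃ C : ℝ≥0, LipschitzOnWith C zhat (Metric.closedBall 0 δ)

end GeneralizedEquation

end

set_option linter.unusedSectionVars false

/-! ### Locally Lipschitz homeomorphisms: perturbation and continuation. -/

section LipschitzHomeomorphisms

variable {E E' E'' : Type*} [NormedAddCommGroup E] [NormedSpace ℝ E]
  [NormedAddCommGroup E'] [NormedSpace ℝ E'] [NormedAddCommGroup E''] [NormedSpace ℝ E'']

/-! Up to a sign change in the third block (`flipG`), the Kojima mapping is the normal map p ↦ 𝓗(p₊)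
+ p₋ of the generalized equation. Here p₋ is the negative part of p in the inequality multiplier
blocks and p₊ = p - p₋ is the projection on 𝒦. All nonsmoothness sits in p₋, which is piecewise
linear: near any point it equals its first-order expansion exactly, and each increment of the
expansion is a diagonal operator D_t applied to the increment of the argument, with t in a box of
slopes. Write A for the Jacobian of 𝓗 at z*. The Clarke Jacobian of the normal map at p* is then
exactly {A + (I - A) D_t : t in the box} (`clarkeJacobian_normalMap`).

For (b) ⇒ (c), the normal map is compared with its piecewise linear approximation at p*. The
difference is the linearization error of 𝓗 composed with a Lipschitz projection, so it has
arbitrarily small local Lipschitz constants and does not affect the property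
(`LocallyLipschitzHomeomorphNear.perturb`). The approximation expands distances uniformly, by
compactness of the box, and it is onto because it is joined to one invertible A + (I - A) D_t by a
homotopy that stays uniformly expanding (`surjective_of_homotopy`).

For (c) ⇔ (d), the same perturbation principle lets 𝓗 be replaced by its linearization. A point p is
recovered from z = p₊ and the value η of the normal map as p = z + η - T(z), so local inverses of
the normal map and Lipschitz localizations of the solution mapping determine each other
(`locallyLipschitzHomeomorphNear_iff_localization`).

For (a) ⇒ (b), take a kernel vector of A + (I - A) D_t. Strict complementarity fixes every inner
slope at 0 or 1, so the inner blocks solve a linear system with matrix K_α, which the Jacobian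
uniqueness conditions make invertible; eliminating them leaves the reduced Hessian. Pairing the
outer equation with dx gives a quadratic form plus Σ t_i (1 - t_i) dw_i² = 0. Linear independence
makes the outer multiplier unique and places dx in Aff 𝒞, so the second-order condition yields dx =
0; the other blocks then vanish by invertibility of K_α and linear independence. -/

theorem lipschitzOnWith_toNNReal_of_norm_sub_le {X Y : Type*} [SeminormedAddCommGroup X]
    [SeminormedAddCommGroup Y] {Φ : X → Y} {s : Set X} {C : ℝ}
    (h : ∀ p ∈ s, ∀ q ∈ s, ‖Φ p - Φ q‖ ≤ C * ‖p - q‖) : LipschitzOnWith C.toNNReal Φ s := by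
  refine LipschitzOnWith.of_dist_le_mul fun p hp q hq => ?_
  rw [dist_eq_norm, dist_eq_norm]
  exact (h p hp q hq).trans (by gcongr; exact Real.le_coe_toNNReal C)

/-- A map which differs from a locally Lipschitz homeomorphism by a map with arbitrarily small local
Lipschitz constants is a locally Lipschitz homeomorphism. -/
theorem LocallyLipschitzHomeomorphNear.perturb [CompleteSpace E'] {Φ Θ : E → E'} {x : E}
    (hΦ : LocallyLipschitzHomeomorphNear Φ x)
    (hd : ∀ ε > (0 : ℝ), ∃ s ∈ 𝓝 x, ∀ p ∈ s, ∀ q ∈ s,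
      ‖(Θ p - Φ p) - (Θ q - Φ q)‖ ≤ ε * ‖p - q‖) :
    LocallyLipschitzHomeomorphNear Θ x := by
  obtain ⟨U, W, Ψ, hU, hW, hxU, hxW, hΦU, hΨW, hinv, ⟨C, hC⟩, ⟨D, hD⟩⟩ := hΦ
  have hDpos : (0 : ℝ) < 2 * (D + 1) := by positivity
  -- Since `Ψ` is `D`-Lipschitz, this tolerance makes `Θ ∘ Ψ` minus the identity Lipschitz with
  -- constant at most 1/2. Using `D + 1` covers `D = 0`.
  obtain ⟨s, hs, hsε⟩ := hd (1 / (2 * (D + 1))) (by positivity)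
  set W₁ : Set E' := W ∩ Ψ ⁻¹' interior s with hW₁
  have hW₁o : IsOpen W₁ := hD.continuousOn.isOpen_inter_preimage hW isOpen_interior
  have hmem : ∀ a ∈ W₁, Ψ a ∈ s := fun a ha => interior_subset ha.2
  have hid : ∀ a ∈ W₁, Φ (Ψ a) = a := fun a ha => hinv.2 ha.1
  have happ : ApproximatesLinearOn (Θ ∘ Ψ) ((ContinuousLinearEquiv.refl ℝ E') : E' →L[ℝ] E') W₁
      (1 / 2 : ℝ≥0) := by
    intro a ha b hb
    have h1 := hsε _ (hmem a ha) _ (hmem b hb)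
    rw [hid a ha, hid b hb] at h1
    have h2 : ‖Ψ a - Ψ b‖ ≤ D * ‖a - b‖ := by
      simpa [dist_eq_norm] using hD.dist_le_mul a ha.1 b hb.1
    have h3 : (Θ ∘ Ψ) a - (Θ ∘ Ψ) b -
        ((ContinuousLinearEquiv.refl ℝ E') : E' →L[ℝ] E') (a - b) =
        Θ (Ψ a) - a - (Θ (Ψ b) - b) := by
      simp only [Function.comp_apply, ContinuousLinearEquiv.coe_coe,
        ContinuousLinearEquiv.coe_refl', id]
      abel
    rw [h3]
    refine h1.trans ?_
    calc 1 / (2 * ((D : ℝ) + 1)) * ‖Ψ a - Ψ b‖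
        ≤ 1 / (2 * ((D : ℝ) + 1)) * ((D + 1) * ‖a - b‖) := by
          gcongr
          exact h2.trans (by gcongr; linarith)
      _ = ((1 / 2 : ℝ≥0) : ℝ) * ‖a - b‖ := by
          have : (D : ℝ) + 1 ≠ 0 := by positivity
          push_cast
          field_simp
  -- The quantitative inverse function theorem needs 1/2 to lie below the reciprocal norm of the
  -- identity; that norm is 1 except on the trivial space.
  have hN : Subsingleton E' ∨ (1 / 2 : ℝ≥0) <
      ‖((ContinuousLinearEquiv.refl ℝ E').symm : E' →L[ℝ] E')‖₊⁻¹ := by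
    rcases subsingleton_or_nontrivial E' with h | h
    · exact Or.inl h
    · right
      have : ‖((ContinuousLinearEquiv.refl ℝ E').symm : E' →L[ℝ] E')‖₊ = 1 := by
        have : ((ContinuousLinearEquiv.refl ℝ E').symm : E' →L[ℝ] E') =
          ContinuousLinearMap.id ℝ E' := rfl
        rw [this]
        exact ContinuousLinearMap.nnnorm_id
      rw [this, inv_one]
      norm_num
  set e := happ.toOpenPartialHomeomorph (Θ ∘ Ψ) W₁ hN hW₁o with he
  have hesource : e.source = W₁ := rfl
  have hecoe : ∀ a, e a = Θ (Ψ a) := fun a => rfl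
  have hxW₁ : Φ x ∈ W₁ := by
    refine ⟨hxW, ?_⟩
    rw [Set.mem_preimage, hinv.1 hxU]
    exact mem_interior_iff_mem_nhds.2 hs
  have hsymm : ∀ b ∈ e.target, e.symm b ∈ W₁ := fun b hb => e.map_target hb
  have hU' : ∀ p ∈ U ∩ Φ ⁻¹' W₁, p ∈ s := fun p hp => by
    have := hmem _ hp.2
    rwa [hinv.1 hp.1] at this
  have hΘ : ∀ p ∈ U, Θ p = e (Φ p) := fun p hp => by rw [hecoe, hinv.1 hp]
  refine ⟨U ∩ Φ ⁻¹' W₁, e.target, Ψ ∘ e.symm, hC.continuousOn.isOpen_inter_preimage hU hW₁o,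
    e.open_target, ⟨hxU, hxW₁⟩, ?_, ?_, ?_, ⟨?_, ?_⟩, ?_, ?_⟩
  · rw [hΘ x hxU]
    exact e.map_source hxW₁
  · intro p hp
    rw [hΘ p hp.1]
    exact e.map_source hp.2
  · intro b hb
    refine ⟨hΨW (hsymm b hb).1, ?_⟩
    simp only [Set.mem_preimage, Function.comp_apply]
    rw [hid _ (hsymm b hb)]
    exact hsymm b hb
  · intro p hp
    simp only [Function.comp_apply]
    rw [hΘ p hp.1, e.left_inv hp.2, hinv.1 hp.1]
  · intro b hb
    simp only [Function.comp_apply]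
    rw [← hecoe, e.right_inv hb]
  · refine ⟨_, lipschitzOnWith_toNNReal_of_norm_sub_le
      (C := (C : ℝ) + 1 / (2 * ((D : ℝ) + 1))) fun p hp q hq => ?_⟩
    have h1 := hsε p (hU' p hp) q (hU' q hq)
    have h2 : ‖Φ p - Φ q‖ ≤ C * ‖p - q‖ := by
      simpa [dist_eq_norm] using hC.dist_le_mul p hp.1 q hq.1
    calc ‖Θ p - Θ q‖ = ‖(Φ p - Φ q) + ((Θ p - Φ p) - (Θ q - Φ q))‖ := by congr 1; abel
      _ ≤ _ := norm_add_le _ _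
      _ ≤ C * ‖p - q‖ + 1 / (2 * (D + 1)) * ‖p - q‖ := add_le_add h2 h1
      _ = _ := by ring
  -- A map within 1/2 of the identity shrinks distances by at most a factor 2, which gives the
  -- constant 2 for `e.symm`.
  · refine ⟨_, lipschitzOnWith_toNNReal_of_norm_sub_le
      (C := (D : ℝ) * 2) fun a ha b hb => ?_⟩
    have h1 := happ _ (hsymm a ha) _ (hsymm b hb)
    have h2 : ‖Ψ (e.symm a) - Ψ (e.symm b)‖ ≤ D * ‖e.symm a - e.symm b‖ := by
      simpa [dist_eq_norm] using hD.dist_le_mul _ (hsymm a ha).1 _ (hsymm b hb).1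
    simp only [Function.comp_apply, ContinuousLinearEquiv.coe_coe,
        ContinuousLinearEquiv.coe_refl', id] at h1
    rw [← hecoe, ← hecoe, e.right_inv ha, e.right_inv hb] at h1
    have h3 : ‖e.symm a - e.symm b‖ ≤ 2 * ‖a - b‖ := by
      have h4 := norm_sub_norm_le (e.symm a - e.symm b) (a - b)
      rw [norm_sub_rev (e.symm a - e.symm b) (a - b)] at h4
      push_cast at h1
      linarith
    calc _ ≤ _ := h2
      _ ≤ D * (2 * ‖a - b‖) := by gcongr
      _ = _ := by ring

theorem LocallyLipschitzHomeomorphNear.equiv_comp {Φ : E → E'} {x : E} (σ : E' ≃L[ℝ] E'')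
    (hΦ : LocallyLipschitzHomeomorphNear Φ x) :
    LocallyLipschitzHomeomorphNear (fun p => σ (Φ p)) x := by
  obtain ⟨U, W, Ψ, hU, hW, hxU, hxW, hΦU, hΨW, hinv, ⟨C, hC⟩, ⟨D, hD⟩⟩ := hΦ
  refine ⟨U, σ.symm ⁻¹' W, Ψ ∘ σ.symm, hU, hW.preimage σ.symm.continuous, hxU, by simpa using hxW,
    fun p hp => by simpa using hΦU hp, fun b hb => hΨW hb,
    ⟨fun p hp => by simpa using hinv.1 hp, fun b hb => ?_⟩, ⟨_, σ.lipschitz.comp_lipschitzOnWith hC⟩,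
    ⟨_, hD.comp (σ.symm.lipschitz.lipschitzOnWith (s := σ.symm ⁻¹' W)) fun b hb => hb⟩⟩
  simp only [Function.comp_apply]
  rw [hinv.2 hb]
  simp

theorem locallyLipschitzHomeomorphNear_equiv_comp_iff {Φ : E → E'} {x : E} (σ : E' ≃L[ℝ] E'') :
    LocallyLipschitzHomeomorphNear (fun p => σ (Φ p)) x ↔ LocallyLipschitzHomeomorphNear Φ x := by
  refine ⟨fun h => ?_, fun h => h.equiv_comp σ⟩
  simpa using h.equiv_comp σ.symm

/-- A globally bijective Lipschitz map with Lipschitz inverse. -/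
theorem locallyLipschitzHomeomorphNear_of_surjective {Φ : E → E'} (x : E) {C κ : ℝ} (hκ : 0 < κ)
    (hC : ∀ p q, ‖Φ p - Φ q‖ ≤ C * ‖p - q‖) (hκΦ : ∀ p q, κ * ‖p - q‖ ≤ ‖Φ p - Φ q‖)
    (hs : Function.Surjective Φ) : LocallyLipschitzHomeomorphNear Φ x := by
  have hi : Function.Injective Φ := fun p q h => by
    have h1 := hκΦ p q
    rw [h, sub_self, norm_zero] at h1
    have h2 : ‖p - q‖ ≤ 0 := by
      by_contra h3
      have := mul_pos hκ (not_le.1 h3)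
      linarith
    exact sub_eq_zero.1 (norm_le_zero_iff.1 h2)
  obtain ⟨Ψ, hΨl, hΨr⟩ := Function.bijective_iff_has_inverse.1 ⟨hi, hs⟩
  refine ⟨Set.univ, Set.univ, Ψ, isOpen_univ, isOpen_univ, trivial, trivial, Set.mapsTo_univ _ _,
    Set.mapsTo_univ _ _, ⟨fun p _ => hΨl p, fun b _ => hΨr b⟩,
    ⟨_, lipschitzOnWith_toNNReal_of_norm_sub_le (C := C) fun p _ q _ => hC p q⟩,
    ⟨_, lipschitzOnWith_toNNReal_of_norm_sub_le (C := κ⁻¹) fun a _ b _ => ?_⟩⟩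
  have h1 := hκΦ (Ψ a) (Ψ b)
  rw [hΨr, hΨr] at h1
  rwa [inv_mul_eq_div, le_div_iff₀' hκ]

/-- A right inverse `Ψ` of `M` is Lipschitz with constant 1/κ. Solving M p + R p = b amounts to
finding a fixed point of p ↦ Ψ(b - R p), a contraction because ρ/κ < 1. -/
theorem surjective_add_of_lipschitz [CompleteSpace E] {M R : E → E'} {κ ρ : ℝ} (hκ : 0 < κ)
    (hρκ : ρ < κ) (hρ : 0 ≤ ρ) (hM : ∀ p q, κ * ‖p - q‖ ≤ ‖M p - M q‖)
    (hs : Function.Surjective M) (hR : ∀ p q, ‖R p - R q‖ ≤ ρ * ‖p - q‖) :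
    Function.Surjective fun p => M p + R p := by
  intro b
  obtain ⟨Ψ, hΨ⟩ := hs.hasRightInverse
  have hct : ContractingWith (ρ / κ).toNNReal fun p => Ψ (b - R p) := by
    refine ⟨?_, LipschitzWith.of_dist_le_mul fun p q => ?_⟩
    · rw [Real.toNNReal_lt_one]
      exact (div_lt_one hκ).2 hρκ
    · rw [dist_eq_norm, dist_eq_norm, Real.coe_toNNReal _ (by positivity)]
      have h1 := hM (Ψ (b - R p)) (Ψ (b - R q))
      rw [hΨ, hΨ] at h1
      have h2 := hR q p
      have h3 : b - R p - (b - R q) = R q - R p := by abel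
      rw [h3] at h1
      rw [norm_sub_rev q p] at h2
      rw [div_mul_eq_mul_div, le_div_iff₀' hκ]
      exact h1.trans h2
  refine ⟨hct.fixedPoint, ?_⟩
  have h1 : Ψ (b - R hct.fixedPoint) = hct.fixedPoint := hct.fixedPoint_isFixedPt
  have h2 := hΨ (b - R hct.fixedPoint)
  rw [h1] at h2
  simp only [h2, sub_add_cancel]

/-- Continuation along a homotopy of uniformly expanding maps. -/
theorem surjective_of_homotopy [CompleteSpace E] {M R : E → E'} {κ ρ : ℝ} (hκ : 0 < κ)
    (hM : ∀ r ∈ Set.Icc (0 : ℝ) 1, ∀ p q,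
      κ * ‖p - q‖ ≤ ‖(M p + r • R p) - (M q + r • R q)‖)
    (hs : Function.Surjective M) (hR : ∀ p q, ‖R p - R q‖ ≤ ρ * ‖p - q‖) :
    Function.Surjective fun p => M p + R p := by
  wlog hρ : 0 ≤ ρ generalizing ρ
  · exact this (ρ := 0) (fun p q => (hR p q).trans (by gcongr; linarith)) le_rfl
  -- The expansion constant κ is the same along the whole homotopy, so steps of length 1/N with ρ/N
  -- < κ suffice: each adds a perturbation small enough for the contraction argument.
  obtain ⟨N, hN⟩ := exists_nat_gt (ρ / κ)
  have hNpos : (0 : ℝ) < N := lt_of_le_of_lt (by positivity) hN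
  have key : ∀ k : ℕ, k ≤ N → Function.Surjective fun p => M p + ((k : ℝ) / N) • R p := by
    intro k
    induction k with
    | zero => intro _; simpa using hs
    | succ k ih =>
      intro hk
      have hkN : (k : ℝ) ≤ N := by exact_mod_cast (Nat.le_succ k).trans hk
      have h1 := surjective_add_of_lipschitz (R := fun p => ((1 : ℝ) / N) • R p) (ρ := ρ / N) hκ
        (by rw [div_lt_iff₀ hNpos]; rw [div_lt_iff₀ hκ] at hN; linarith) (by positivity)
        (hM (k / N) ⟨by positivity, (div_le_one hNpos).2 hkN⟩) (ih (by omega)) (fun p q => by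
          rw [← smul_sub, norm_smul, Real.norm_of_nonneg (by positivity)]
          calc 1 / (N : ℝ) * ‖R p - R q‖ ≤ 1 / N * (ρ * ‖p - q‖) := by gcongr; exact hR p q
            _ = _ := by ring)
      convert h1 using 2 with p
      rw [add_assoc, ← add_smul]
      congr 2
      push_cast
      ring
  have := key N le_rfl
  rw [div_self hNpos.ne'] at this
  simpa using this

end LipschitzHomeomorphisms

/-! ### Orthant coordinates and the slopes of `min 0`. -/

/-- Coordinates `coord i` on a space, dual to the vectors `vec i`; the constraint set of a
generalized equation consists of the points with nonnegative coordinates. -/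
structure OrthantCoords (ι E : Type*) [Fintype ι] [DecidableEq ι] [NormedAddCommGroup E]
    [NormedSpace ℝ E] where
  coord : ι → E →L[ℝ] ℝ
  vec : ι → E
  coord_vec : ∀ i j, coord i (vec j) = if i = j then 1 else 0

/-- The slopes of `min 0` near `a`. -/
def slopeSet (a : ℝ) : Set ℝ := if a < 0 then {1} else if 0 < a then {0} else Set.Icc 0 1

/-- The slopes of `min 0` at the points of differentiability near `a`. -/
def slopeVertices (a : ℝ) : Set ℝ := if a < 0 then {1} else if 0 < a then {0} else {0, 1}

/-- The directional derivative of `min 0` at `a`. -/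
noncomputable def kink (a s : ℝ) : ℝ := if a < 0 then s else if 0 < a then 0 else min 0 s

theorem convexHull_slopeVertices (a : ℝ) : convexHull ℝ (slopeVertices a) = slopeSet a := by
  unfold slopeVertices slopeSet
  split_ifs
  · exact convexHull_singleton _
  · exact convexHull_singleton _
  · rw [convexHull_pair, segment_eq_Icc zero_le_one]

theorem convex_slopeSet (a : ℝ) : Convex ℝ (slopeSet a) := by
  rw [← convexHull_slopeVertices]
  exact convex_convexHull ℝ _

theorem isCompact_slopeSet (a : ℝ) : IsCompact (slopeSet a) := by
  unfold slopeSet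
  split_ifs
  · exact isCompact_singleton
  · exact isCompact_singleton
  · exact isCompact_Icc

theorem slopeSet_subset (a : ℝ) : slopeSet a ⊆ Set.Icc 0 1 := by
  unfold slopeSet
  split_ifs <;> simp

theorem slopeVertices_nonempty (a : ℝ) : (slopeVertices a).Nonempty := by
  unfold slopeVertices
  split_ifs <;> simp

theorem slopeVertices_subset_slopeSet (a : ℝ) : slopeVertices a ⊆ slopeSet a := by
  rw [← convexHull_slopeVertices]
  exact subset_convexHull ℝ _

/-- The difference quotients of a nondecreasing 1-Lipschitz function lie in [0, 1]. When the two
points agree, any slope serves. -/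
theorem exists_min_sub_min (s s' : ℝ) :
    ∃ τ ∈ Set.Icc (0 : ℝ) 1, min 0 s - min 0 s' = τ * (s - s') := by
  by_cases h : s = s'
  · exact ⟨0, by simp, by simp [h]⟩
  · have h1 : s - s' ≠ 0 := sub_ne_zero.2 h
    refine ⟨(min 0 s - min 0 s') / (s - s'), ?_, by field_simp⟩
    rcases lt_or_gt_of_ne h1 with h2 | h2
    · refine ⟨div_nonneg_of_nonpos ?_ h2.le, (div_le_one_of_neg h2).2 ?_⟩
      · have : min 0 s ≤ min 0 s' := min_le_min le_rfl (by linarith)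
        linarith
      · rcases min_cases 0 s with ⟨h3, h4⟩ | ⟨h3, h4⟩ <;>
        rcases min_cases 0 s' with ⟨h5, h6⟩ | ⟨h5, h6⟩ <;> rw [h3, h5] <;> linarith
    · refine ⟨div_nonneg ?_ h2.le, (div_le_one h2).2 ?_⟩
      · have : min 0 s' ≤ min 0 s := min_le_min le_rfl (by linarith)
        linarith
      · rcases min_cases 0 s with ⟨h3, h4⟩ | ⟨h3, h4⟩ <;>
        rcases min_cases 0 s' with ⟨h5, h6⟩ | ⟨h5, h6⟩ <;> rw [h3, h5] <;> linarith

theorem exists_kink_sub_kink (a s s' : ℝ) :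
    ∃ τ ∈ slopeSet a, kink a s - kink a s' = τ * (s - s') := by
  unfold slopeSet kink
  split_ifs
  · exact ⟨1, rfl, by ring⟩
  · exact ⟨0, rfl, by ring⟩
  · exact exists_min_sub_min s s'

/-- Piecewise linearity makes the first-order expansion exact near the base point, with no remainder
to estimate. -/
theorem eventually_min_add_eq (a : ℝ) : ∀ᶠ s in 𝓝 (0 : ℝ), min 0 (a + s) = min 0 a + kink a s := by
  have hc : Tendsto (fun s : ℝ => a + s) (𝓝 0) (𝓝 a) := by
    have : Continuous fun s : ℝ => a + s := by fun_prop
    simpa using this.tendsto 0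
  rcases lt_trichotomy a 0 with h | h | h
  · filter_upwards [hc.eventually (gt_mem_nhds h)] with s hs
    rw [min_eq_right hs.le, min_eq_right h.le, kink, if_pos h]
  · subst h
    exact Eventually.of_forall fun s => by simp [kink]
  · filter_upwards [hc.eventually (lt_mem_nhds h)] with s hs
    rw [min_eq_left hs.le, min_eq_left h.le, kink, if_neg h.not_gt, if_pos h, add_zero]

/-! ### Projections on the orthant and the normal map. -/

namespace OrthantCoords

variable {ι E E' : Type*} [Fintype ι] [DecidableEq ι] [NormedAddCommGroup E] [NormedSpace ℝ E]
  [NormedAddCommGroup E'] [NormedSpace ℝ E']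
  (K : OrthantCoords ι E)

/-- The part of `p` in the negative orthant. -/
noncomputable def negProj (p : E) : E := ∑ i, min 0 (K.coord i p) • K.vec i

/-- The projection on the constraint set. -/
noncomputable def posProj (p : E) : E := p - K.negProj p

/-- The normal map of the generalized equation `0 ∈ T(z) + N(z)`. -/
noncomputable def normalMap (T : E → E) (p : E) : E := T (K.posProj p) + K.negProj p

/-- The linear map with the eigenvalues `t i` in the directions of the coordinates, and zero in the
other directions. -/
noncomputable def diagOp (t : ι → ℝ) : E →L[ℝ] E := ∑ i, t i • (K.coord i).smulRight (K.vec i)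

/-- The elements of the Clarke Jacobian of a normal map. -/
noncomputable def normalJac (A : E →L[ℝ] E) (t : ι → ℝ) : E →L[ℝ] E :=
  A + (ContinuousLinearMap.id ℝ E - A) ∘L K.diagOp t

/-- The slopes of the negative part near `p`. -/
def slopeBox (p : E) : Set (ι → ℝ) := Set.univ.pi fun i => slopeSet (K.coord i p)

/-- The directional derivative of the negative part at `p`. -/
noncomputable def negProjDir (p d : E) : E := ∑ i, kink (K.coord i p) (K.coord i d) • K.vec i

theorem diagOp_apply (t : ι → ℝ) (d : E) : K.diagOp t d = ∑ i, (t i * K.coord i d) • K.vec i := by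
  simp [diagOp, smul_smul]

theorem normalJac_apply (A : E →L[ℝ] E) (t : ι → ℝ) (d : E) :
    K.normalJac A t d = A (d - K.diagOp t d) + K.diagOp t d := by
  simp only [normalJac, add_apply, ContinuousLinearMap.comp_apply,
    sub_apply, ContinuousLinearMap.id_apply, map_sub]
  abel

theorem coord_sum_smul_vec (a : ι → ℝ) (i : ι) : K.coord i (∑ j, a j • K.vec j) = a i := by
  simp [K.coord_vec]

theorem coord_negProj (p : E) (i : ι) : K.coord i (K.negProj p) = min 0 (K.coord i p) :=
  K.coord_sum_smul_vec _ i

theorem coord_posProj (p : E) (i : ι) : K.coord i (K.posProj p) = max 0 (K.coord i p) := by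
  rw [posProj, map_sub, coord_negProj]
  rcases le_total 0 (K.coord i p) with h | h
  · rw [min_eq_left h, max_eq_right h, sub_zero]
  · rw [min_eq_right h, max_eq_left h, sub_self]

theorem posProj_add_negProj (p : E) : K.posProj p + K.negProj p = p := sub_add_cancel _ _

theorem exists_negProj_sub (p q : E) :
    ∃ t ∈ Set.univ.pi fun _ : ι => Set.Icc (0 : ℝ) 1,
      K.negProj p - K.negProj q = K.diagOp t (p - q) := by
  choose t ht h using fun i => exists_min_sub_min (K.coord i p) (K.coord i q)
  refine ⟨t, fun i _ => ht i, ?_⟩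
  simp only [negProj, diagOp_apply, ← Finset.sum_sub_distrib, ← sub_smul, h, map_sub, mul_sub]

/-- An exact mean value formula, obtained one coordinate at a time. It lets increments of the
piecewise linear model be read as elements of the Clarke Jacobian applied to a vector. -/
theorem exists_negProjDir_sub (p d d' : E) :
    ∃ t ∈ K.slopeBox p, K.negProjDir p d - K.negProjDir p d' = K.diagOp t (d - d') := by
  choose t ht h using fun i => exists_kink_sub_kink (K.coord i p) (K.coord i d) (K.coord i d')
  refine ⟨t, fun i _ => ht i, ?_⟩
  simp only [negProjDir, diagOp_apply, ← Finset.sum_sub_distrib, ← sub_smul, h, map_sub, mul_sub]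

theorem continuous_diagOp : Continuous K.diagOp := by
  unfold diagOp
  fun_prop

theorem continuous_normalJac (A : E →L[ℝ] E) : Continuous (K.normalJac A) := by
  unfold normalJac
  exact continuous_const.add (continuous_const.clm_comp K.continuous_diagOp)

theorem isCompact_slopeBox (p : E) : IsCompact (K.slopeBox p) :=
  isCompact_univ_pi fun _ => isCompact_slopeSet _

theorem convex_slopeBox (p : E) : Convex ℝ (K.slopeBox p) :=
  convex_pi fun _ _ => convex_slopeSet _

theorem slopeBox_nonempty (p : E) : (K.slopeBox p).Nonempty :=
  Set.univ_pi_nonempty_iff.2 fun _ =>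
    (slopeVertices_nonempty _).mono (slopeVertices_subset_slopeSet _)

/-- The operators depend continuously on slopes in a compact cube, so their norms are bounded. The
later Lipschitz bounds for the projections rest on this. -/
theorem exists_lipschitz_of_diagOp :
    ∃ C > (0 : ℝ), ∀ t ∈ Set.univ.pi fun _ : ι => Set.Icc (0 : ℝ) 1,
    ∀ d, ‖K.diagOp t d‖ ≤ C * ‖d‖ := by
  have h : IsCompact (Set.univ.pi fun _ : ι => Set.Icc (0 : ℝ) 1) :=
    isCompact_univ_pi fun _ => isCompact_Icc
  obtain ⟨C, hC⟩ := (h.image K.continuous_diagOp).isBounded.exists_norm_le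
  refine ⟨max C 1, by positivity, fun t ht d => ?_⟩
  refine (K.diagOp t).le_of_opNorm_le ((hC _ ⟨t, ht, rfl⟩).trans (le_max_left _ _)) d

theorem exists_lipschitz_negProj :
    ∃ C > (0 : ℝ), ∀ p q, ‖K.negProj p - K.negProj q‖ ≤ C * ‖p - q‖ := by
  obtain ⟨C, hC0, hC⟩ := K.exists_lipschitz_of_diagOp
  refine ⟨C, hC0, fun p q => ?_⟩
  obtain ⟨t, ht, h⟩ := K.exists_negProj_sub p q
  rw [h]
  exact hC t ht _

theorem exists_lipschitz_posProj :
    ∃ C > (0 : ℝ), ∀ p q, ‖K.posProj p - K.posProj q‖ ≤ C * ‖p - q‖ := by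
  obtain ⟨C, hC0, hC⟩ := K.exists_lipschitz_negProj
  refine ⟨1 + C, by positivity, fun p q => ?_⟩
  have : K.posProj p - K.posProj q = (p - q) - (K.negProj p - K.negProj q) := by
    simp only [posProj]; abel
  rw [this, add_mul, one_mul]
  exact (norm_sub_le _ _).trans (add_le_add le_rfl (hC p q))

theorem exists_lipschitz_negProjDir (p : E) :
    ∃ C > (0 : ℝ), ∀ d d', ‖K.negProjDir p d - K.negProjDir p d'‖ ≤ C * ‖d - d'‖ := by
  obtain ⟨C, hC0, hC⟩ := K.exists_lipschitz_of_diagOp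
  refine ⟨C, hC0, fun d d' => ?_⟩
  obtain ⟨t, ht, h⟩ := K.exists_negProjDir_sub p d d'
  rw [h]
  exact hC t (fun i hi => slopeSet_subset _ (ht i hi)) _

theorem continuous_negProj : Continuous K.negProj := by
  unfold negProj
  fun_prop

theorem continuous_posProj : Continuous K.posProj := continuous_id.sub K.continuous_negProj

theorem eventually_negProj_eq (p : E) :
    ∀ᶠ q in 𝓝 p, K.negProj q = K.negProj p + K.negProjDir p (q - p) := by
  have h : ∀ i, ∀ᶠ q in 𝓝 p, min 0 (K.coord i q) =
      min 0 (K.coord i p) + kink (K.coord i p) (K.coord i (q - p)) := by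
    intro i
    have hc : Tendsto (fun q => K.coord i (q - p)) (𝓝 p) (𝓝 0) := by
      have : Continuous fun q => K.coord i (q - p) := by fun_prop
      simpa using this.tendsto p
    filter_upwards [hc.eventually (eventually_min_add_eq (K.coord i p))] with q hq
    rw [← hq, map_sub, add_sub_cancel]
  filter_upwards [eventually_all.2 h] with q hq
  simp only [negProj, negProjDir, hq, add_smul, Finset.sum_add_distrib]

end OrthantCoords

/-! ### The Clarke Jacobian of a normal map. -/

theorem bSubdifferential_equiv_comp {E E' E'' : Type*} [NormedAddCommGroup E] [NormedSpace ℝ E]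
    [NormedAddCommGroup E'] [NormedSpace ℝ E'] [NormedAddCommGroup E''] [NormedSpace ℝ E'']
    (σ : E' ≃L[ℝ] E'') (Φ : E → E') (x : E) :
    bSubdifferential (fun p => σ (Φ p)) x =
      ContinuousLinearMap.compL ℝ E E' E'' (σ : E' →L[ℝ] E'') '' bSubdifferential Φ x := by
  have hd : ∀ s, DifferentiableAt ℝ (fun p => σ (Φ p)) s ↔ DifferentiableAt ℝ Φ s := fun s =>
    σ.comp_differentiableAt_iff
  have hf : ∀ s, fderiv ℝ (fun p => σ (Φ p)) s = (σ : E' →L[ℝ] E'').comp (fderiv ℝ Φ s) := fun s =>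
    σ.comp_fderiv
  ext V
  constructor
  · rintro ⟨s, hs, hsx, hsV⟩
    refine ⟨(σ.symm : E'' →L[ℝ] E').comp V, ⟨s, fun k => (hd _).1 (hs k), hsx, ?_⟩, ?_⟩
    · have h1 := ((ContinuousLinearMap.compL ℝ E E'' E' (σ.symm : E'' →L[ℝ] E')).continuous.tendsto
        V).comp hsV
      refine h1.congr fun k => ?_
      simp only [Function.comp_apply, ContinuousLinearMap.compL_apply, hf]
      ext d
      simp
    · ext d
      simp
  · rintro ⟨V, ⟨s, hs, hsx, hsV⟩, rfl⟩
    refine ⟨s, fun k => (hd _).2 (hs k), hsx, ?_⟩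
    simp only [hf]
    exact ((ContinuousLinearMap.compL ℝ E E' E'' (σ : E' →L[ℝ] E'')).continuous.tendsto V).comp hsV

theorem clarkeJacobian_equiv_comp {E E' E'' : Type*} [NormedAddCommGroup E] [NormedSpace ℝ E]
    [NormedAddCommGroup E'] [NormedSpace ℝ E'] [NormedAddCommGroup E''] [NormedSpace ℝ E'']
    (σ : E' ≃L[ℝ] E'') (Φ : E → E') (x : E) :
    clarkeJacobian (fun p => σ (Φ p)) x =
      ContinuousLinearMap.compL ℝ E E' E'' (σ : E' →L[ℝ] E'') '' clarkeJacobian Φ x := by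
  rw [clarkeJacobian, bSubdifferential_equiv_comp]
  exact ((ContinuousLinearMap.compL ℝ E E' E'' (σ : E' →L[ℝ] E'')).toLinearMap.image_convexHull
    _).symm

namespace OrthantCoords

variable {ι E : Type*} [Fintype ι] [DecidableEq ι] [NormedAddCommGroup E] [NormedSpace ℝ E]
  (K : OrthantCoords ι E)

theorem continuous_normalJac_uncurry :
    Continuous fun x : (E →L[ℝ] E) × (ι → ℝ) => K.normalJac x.1 x.2 := by
  unfold normalJac
  exact continuous_fst.add
    ((continuous_const.sub continuous_fst).clm_comp (K.continuous_diagOp.comp continuous_snd))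

theorem diagOp_eq_sum (t : ι → ℝ) :
    K.diagOp t = Fintype.linearCombination ℝ (fun i => (K.coord i).smulRight (K.vec i)) t := rfl

/-- Affine dependence on the slopes makes the image of the box convex and lets convex hulls be
computed on the slopes themselves. -/
theorem exists_affine_normalJac (A : E →L[ℝ] E) :
    ∃ L : (ι → ℝ) →ᵃ[ℝ] (E →L[ℝ] E), ⇑L = K.normalJac A := by
  refine ⟨AffineMap.const ℝ _ A + ((ContinuousLinearMap.compL ℝ E E E
    (ContinuousLinearMap.id ℝ E - A)).toLinearMap ∘ₗ
      Fintype.linearCombination ℝ (fun i => (K.coord i).smulRight (K.vec i))).toAffineMap, ?_⟩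
  funext t
  rw [normalJac, diagOp_eq_sum]
  rfl

theorem convex_image_normalJac (A : E →L[ℝ] E) (p : E) :
    Convex ℝ (K.normalJac A '' K.slopeBox p) := by
  obtain ⟨L, hL⟩ := K.exists_affine_normalJac A
  rw [← hL]
  exact (K.convex_slopeBox p).affine_image L

/-- The slopes of the negative part at a point, taking the right slope at a kink. -/
noncomputable def rightSlope (s : E) (i : ι) : ℝ := if K.coord i s < 0 then 1 else 0

theorem eventually_rightSlope_mem (p : E) : ∀ᶠ s in 𝓝 p, K.rightSlope s ∈ K.slopeBox p := by
  have h : ∀ i, ∀ᶠ s in 𝓝 p, K.rightSlope s i ∈ slopeSet (K.coord i p) := by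
    intro i
    have hc : Tendsto (K.coord i) (𝓝 p) (𝓝 (K.coord i p)) := (K.coord i).continuous.tendsto p
    unfold slopeSet rightSlope
    split_ifs with h1 h2
    · filter_upwards [hc.eventually (gt_mem_nhds h1)] with s hs
      simp [hs]
    · filter_upwards [hc.eventually (lt_mem_nhds h2)] with s hs
      simp [hs.not_gt]
    · refine Eventually.of_forall fun s => ?_
      split_ifs <;> simp
  filter_upwards [eventually_all.2 h] with s hs
  exact fun i _ => hs i

/-- Along a direction with nonnegative coordinates, the negative part moves linearly for small
positive times, with the right slopes, even when it starts at a kink. The one-sided derivative is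
therefore explicit, and differentiability of the normal map forces its derivative to agree with it.
The negative part itself need not be differentiable at `s`. -/
theorem fderiv_normalMap_of_coord_nonneg {T : E → E} {s d : E}
    (hT : DifferentiableAt ℝ T (K.posProj s)) (h : DifferentiableAt ℝ (K.normalMap T) s)
    (hd : ∀ i, 0 ≤ K.coord i d) :
    fderiv ℝ (K.normalMap T) s d = K.normalJac (fderiv ℝ T (K.posProj s)) (K.rightSlope s) d := by
  set N := K.diagOp (K.rightSlope s) d with hN
  have hline : HasDerivAt (fun τ : ℝ => s + τ • d) d 0 := by
    simpa using ((hasDerivAt_id (0 : ℝ)).smul_const d).const_add s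
  have hline' : HasDerivAt (fun τ : ℝ => K.posProj s + τ • (d - N)) (d - N) 0 := by
    simpa using ((hasDerivAt_id (0 : ℝ)).smul_const (d - N)).const_add (K.posProj s)
  have h1 : HasDerivAt (fun τ : ℝ => K.normalMap T (s + τ • d)) (fderiv ℝ (K.normalMap T) s d) 0 := by
    have h2 : HasFDerivAt (K.normalMap T) (fderiv ℝ (K.normalMap T) s) (s + (0 : ℝ) • d) := by
      simpa using h.hasFDerivAt
    exact h2.comp_hasDerivAt (0 : ℝ) hline
  have h2 : HasDerivAt (fun τ : ℝ => T (K.posProj s + τ • (d - N)) + (K.negProj s + τ • N))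
      (fderiv ℝ T (K.posProj s) (d - N) + N) 0 := by
    have h3 : HasFDerivAt T (fderiv ℝ T (K.posProj s)) (K.posProj s + (0 : ℝ) • (d - N)) := by
      simpa using hT.hasFDerivAt
    refine (h3.comp_hasDerivAt (0 : ℝ) hline').add ?_
    simpa using ((hasDerivAt_id (0 : ℝ)).smul_const N).const_add (K.negProj s)
  have hneg : ∀ᶠ τ in 𝓝[≥] (0 : ℝ), K.negProj (s + τ • d) = K.negProj s + τ • N := by
    have ht : Tendsto (fun τ : ℝ => s + τ • d) (𝓝 0) (𝓝 s) := by
      simpa using hline.continuousAt.tendsto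
    filter_upwards [(ht.mono_left nhdsWithin_le_nhds).eventually (K.eventually_negProj_eq s),
      self_mem_nhdsWithin] with τ hτ hτ0
    rw [hτ, hN, diagOp_apply, Finset.smul_sum, negProjDir]
    congr 1
    refine Finset.sum_congr rfl fun i _ => ?_
    rw [smul_smul, add_sub_cancel_left, map_smul, smul_eq_mul]
    congr 1
    have h5 : 0 ≤ τ * K.coord i d := mul_nonneg hτ0 (hd i)
    unfold kink rightSlope
    split_ifs
    · ring
    · ring
    · rw [min_eq_left h5]; ring
  have heq : (fun τ : ℝ => T (K.posProj s + τ • (d - N)) + (K.negProj s + τ • N)) =ᶠ[𝓝[≥] 0]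
      fun τ : ℝ => K.normalMap T (s + τ • d) := by
    filter_upwards [hneg] with τ hτ
    simp only [normalMap, posProj, hτ]
    congr 2
    rw [smul_sub]
    abel
  have h3 := h2.hasDerivWithinAt (s := Set.Ici 0)
  have h4 := (h1.hasDerivWithinAt (s := Set.Ici 0)).congr_of_eventuallyEq heq
    (heq.eq_of_nhdsWithin (Set.mem_Ici.2 le_rfl))
  rw [(uniqueDiffWithinAt_Ici (0 : ℝ)).eq_deriv _ h4 h3, normalJac_apply]

/-- Every direction is a difference of two directions with nonnegative coordinates, so the one-sided
computation determines the derivative. Points of differentiability lying on kinks need no separate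
treatment. -/
theorem fderiv_normalMap {T : E → E} {s : E}
    (hT : DifferentiableAt ℝ T (K.posProj s)) (h : DifferentiableAt ℝ (K.normalMap T) s) :
    fderiv ℝ (K.normalMap T) s = K.normalJac (fderiv ℝ T (K.posProj s)) (K.rightSlope s) := by
  ext d
  have h1 := K.fderiv_normalMap_of_coord_nonneg (d := K.posProj d) hT h fun i => by
    rw [coord_posProj]; exact le_max_left _ _
  have h2 := K.fderiv_normalMap_of_coord_nonneg (d := -K.negProj d) hT h fun i => by
    rw [map_neg, coord_negProj, neg_nonneg]; exact min_le_left _ _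
  have h3 : d = K.posProj d - -K.negProj d := by rw [sub_neg_eq_add, posProj_add_negProj]
  rw [h3, map_sub, map_sub, h1, h2]

/-- Along the sequence the derivatives are given by right slopes, which eventually lie in the
compact box at `p`. A subsequence of slopes converges, and continuity of the formula identifies the
limit. -/
theorem bSubdifferential_normalMap_subset {T : E → E} {p : E}
    (hT : ContDiffAt ℝ 1 T (K.posProj p)) :
    bSubdifferential (K.normalMap T) p ⊆
      K.normalJac (fderiv ℝ T (K.posProj p)) '' K.slopeBox p := by
  rintro V ⟨s, hs, hsp, hsV⟩
  have hπ : Tendsto (fun k => K.posProj (s k)) atTop (𝓝 (K.posProj p)) :=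
    (K.continuous_posProj.tendsto p).comp hsp
  have hTd : ∀ᶠ z in 𝓝 (K.posProj p), DifferentiableAt ℝ T z := by
    filter_upwards [hT.eventually (by simp)] with z hz
    exact hz.differentiableAt (by simp)
  have hA : Tendsto (fun k => fderiv ℝ T (K.posProj (s k))) atTop
      (𝓝 (fderiv ℝ T (K.posProj p))) :=
    (hT.continuousAt_fderiv (by simp)).tendsto.comp hπ
  obtain ⟨t, ht, φ, hφ, hφt⟩ := (K.isCompact_slopeBox p).tendsto_subseq'
    (hsp.eventually (K.eventually_rightSlope_mem p)).frequently
  refine ⟨t, ht, ?_⟩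
  have h1 : Tendsto (fun k => K.normalJac (fderiv ℝ T (K.posProj (s (φ k)))) (K.rightSlope (s (φ k))))
      atTop (𝓝 (K.normalJac (fderiv ℝ T (K.posProj p)) t)) :=
    (K.continuous_normalJac_uncurry.tendsto (fderiv ℝ T (K.posProj p), t)).comp
      ((hA.comp hφ.tendsto_atTop).prodMk_nhds hφt)
  refine tendsto_nhds_unique (h1.congr' ?_) (hsV.comp hφ.tendsto_atTop)
  filter_upwards [hφ.tendsto_atTop.eventually (hπ.eventually hTd)] with k hk
  exact (K.fderiv_normalMap hk (hs _)).symm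

theorem hasFDerivAt_negProj {s : E} {t : ι → ℝ}
    (ht : ∀ i, (K.coord i s < 0 ∧ t i = 1) ∨ (0 < K.coord i s ∧ t i = 0)) :
    HasFDerivAt K.negProj (K.diagOp t) s := by
  have h1 : HasFDerivAt (fun q => K.negProj s + K.diagOp t (q - s)) (K.diagOp t) s := by
    simp only [map_sub]
    exact ((K.diagOp t).hasFDerivAt.sub_const _).const_add _
  refine h1.congr_of_eventuallyEq ?_
  filter_upwards [K.eventually_negProj_eq s] with q hq
  rw [hq, negProjDir, diagOp_apply]
  congr 1
  refine Finset.sum_congr rfl fun i _ => ?_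
  congr 1
  rcases ht i with ⟨h2, h3⟩ | ⟨h2, h3⟩
  · rw [kink, if_pos h2, h3, one_mul]
  · rw [kink, if_neg h2.not_gt, if_pos h2, h3, zero_mul]

theorem hasFDerivAt_normalMap {T : E → E} {s : E} {t : ι → ℝ}
    (hT : DifferentiableAt ℝ T (K.posProj s))
    (ht : ∀ i, (K.coord i s < 0 ∧ t i = 1) ∨ (0 < K.coord i s ∧ t i = 0)) :
    HasFDerivAt (K.normalMap T) (K.normalJac (fderiv ℝ T (K.posProj s)) t) s := by
  have h1 := K.hasFDerivAt_negProj ht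
  have h2 : HasFDerivAt K.posProj (ContinuousLinearMap.id ℝ E - K.diagOp t) s :=
    (hasFDerivAt_id s).sub h1
  have h3 : K.normalJac (fderiv ℝ T (K.posProj s)) t = (fderiv ℝ T (K.posProj s)) ∘L
      (ContinuousLinearMap.id ℝ E - K.diagOp t) + K.diagOp t := by
    ext d
    simp [normalJac_apply]
  rw [h3]
  exact (hT.hasFDerivAt.comp s h2).add h1

/-- Each vertex of the box is realized by approaching `p` along a ray that leaves every kink on the
side selected by the vertex. -/
theorem normalJac_mem_bSubdifferential {T : E → E} {p : E}
    (hT : ContDiffAt ℝ 1 T (K.posProj p)) {t : ι → ℝ}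
    (ht : ∀ i, t i ∈ slopeVertices (K.coord i p)) :
    K.normalJac (fderiv ℝ T (K.posProj p)) t ∈ bSubdifferential (K.normalMap T) p := by
  -- At a kink, slope 0 gives coordinate 1 (entering the positive side) and slope 1 gives coordinate
  -- -1. Away from kinks the sign is stable whatever the direction.
  set d : E := ∑ i, (1 - 2 * t i) • K.vec i with hd
  have hcd : ∀ i, K.coord i d = 1 - 2 * t i := fun i => K.coord_sum_smul_vec _ i
  have hTd : ∀ᶠ z in 𝓝 (K.posProj p), DifferentiableAt ℝ T z := by
    filter_upwards [hT.eventually (by simp)] with z hz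
    exact hz.differentiableAt (by simp)
  have hline : Tendsto (fun τ : ℝ => p + τ • d) (𝓝 0) (𝓝 p) := by
    have : Continuous fun τ : ℝ => p + τ • d := by fun_prop
    simpa using this.tendsto 0
  have hsign : ∀ i, ∀ᶠ τ in 𝓝[>] (0 : ℝ), (K.coord i (p + τ • d) < 0 ∧ t i = 1) ∨
      (0 < K.coord i (p + τ • d) ∧ t i = 0) := by
    intro i
    have hc : Tendsto (fun τ : ℝ => K.coord i (p + τ • d)) (𝓝[>] 0) (𝓝 (K.coord i p)) :=
      (((K.coord i).continuous.tendsto p).comp hline).mono_left nhdsWithin_le_nhds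
    have hti := ht i
    unfold slopeVertices at hti
    split_ifs at hti with h1 h2
    · filter_upwards [hc.eventually (gt_mem_nhds h1)] with τ hτ
      exact Or.inl ⟨hτ, hti⟩
    · filter_upwards [hc.eventually (lt_mem_nhds h2)] with τ hτ
      exact Or.inr ⟨hτ, hti⟩
    · filter_upwards [self_mem_nhdsWithin] with τ hτ
      have h3 : K.coord i p = 0 := le_antisymm (not_lt.1 h2) (not_lt.1 h1)
      have h4 : (0 : ℝ) < τ := hτ
      rw [map_add, map_smul, h3, hcd, zero_add, smul_eq_mul]
      rcases hti with h5 | h5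
      · right
        rw [h5]
        simpa using h4
      · left
        rw [Set.mem_singleton_iff] at h5
        rw [h5]
        exact ⟨by linarith, rfl⟩
  have hev : ∀ᶠ τ in 𝓝[>] (0 : ℝ), HasFDerivAt (K.normalMap T)
      (K.normalJac (fderiv ℝ T (K.posProj (p + τ • d))) t) (p + τ • d) := by
    filter_upwards [eventually_all.2 hsign,
      (((K.continuous_posProj.tendsto p).comp hline).mono_left nhdsWithin_le_nhds).eventually hTd]
      with τ h1 h2
    exact K.hasFDerivAt_normalMap h2 h1
  obtain ⟨τ, hτ0, hτ⟩ := exists_seq_forall_of_frequently hev.frequently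
  have hs : Tendsto (fun k => p + τ k • d) atTop (𝓝 p) :=
    hline.comp (hτ0.mono_right nhdsWithin_le_nhds)
  refine ⟨fun k => p + τ k • d, fun k => (hτ k).differentiableAt, hs, ?_⟩
  simp only [fun k => (hτ k).fderiv]
  have h1 : Tendsto (fun k => fderiv ℝ T (K.posProj (p + τ k • d))) atTop
      (𝓝 (fderiv ℝ T (K.posProj p))) :=
    (hT.continuousAt_fderiv (by simp)).tendsto.comp ((K.continuous_posProj.tendsto p).comp hs)
  exact (K.continuous_normalJac_uncurry.tendsto (fderiv ℝ T (K.posProj p), t)).comp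
    (h1.prodMk_nhds tendsto_const_nhds)

/-- One inclusion holds because the image of the box is convex and contains all limits of
derivatives. For the other, the box is the convex hull of its vertices, an affine map preserves
hulls, and every vertex is attained. -/
theorem clarkeJacobian_normalMap {T : E → E} {p : E} (hT : ContDiffAt ℝ 1 T (K.posProj p)) :
    clarkeJacobian (K.normalMap T) p =
      K.normalJac (fderiv ℝ T (K.posProj p)) '' K.slopeBox p := by
  refine Set.Subset.antisymm (convexHull_min (K.bSubdifferential_normalMap_subset hT)
    (K.convex_image_normalJac _ p)) ?_
  obtain ⟨L, hL⟩ := K.exists_affine_normalJac (fderiv ℝ T (K.posProj p))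
  have h1 : K.slopeBox p = convexHull ℝ (Set.univ.pi fun i => slopeVertices (K.coord i p)) := by
    rw [convexHull_pi]
    simp only [slopeBox, convexHull_slopeVertices]
  rw [h1, ← hL, AffineMap.image_convexHull, hL]
  refine convexHull_mono ?_
  rintro _ ⟨t, ht, rfl⟩
  exact K.normalJac_mem_bSubdifferential hT fun i => ht i trivial

end OrthantCoords

/-! ### Inverse function theorem and solution localizations for normal maps. -/

namespace OrthantCoords

variable {ι E : Type*} [Fintype ι] [DecidableEq ι] [NormedAddCommGroup E] [NormedSpace ℝ E]
  (K : OrthantCoords ι E)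

theorem exists_nhds_norm_sub_le_of_hasStrictFDerivAt {T : E → E} {A : E →L[ℝ] E} {p : E}
    (hT : HasStrictFDerivAt T A (K.posProj p)) {ε : ℝ} (hε : 0 < ε) :
    ∃ s ∈ 𝓝 p, ∀ q ∈ s, ∀ q' ∈ s,
      ‖(T (K.posProj q) - A (K.posProj q)) - (T (K.posProj q') - A (K.posProj q'))‖ ≤
        ε * ‖q - q'‖ := by
  obtain ⟨C, hC0, hC⟩ := K.exists_lipschitz_posProj
  obtain ⟨s, hs, happ⟩ := hT.approximates_deriv_on_nhds (c := (ε / C).toNNReal)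
    (Or.inr (Real.toNNReal_pos.2 (by positivity)))
  refine ⟨K.posProj ⁻¹' s, K.continuous_posProj.continuousAt hs, fun q hq q' hq' => ?_⟩
  have h1 := happ _ hq _ hq'
  rw [Real.coe_toNNReal _ (by positivity), map_sub] at h1
  calc _ = ‖T (K.posProj q) - T (K.posProj q') - (A (K.posProj q) - A (K.posProj q'))‖ := by
        congr 1; abel
    _ ≤ ε / C * (C * ‖q - q'‖) := h1.trans (by gcongr; exact hC q q')
    _ = _ := by field_simp

/-- The norm of the image is continuous and positive on the compact product of the slope box and the
unit sphere, hence bounded below; homogeneity extends the bound to all vectors. -/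
theorem exists_antilipschitz_normalJac [FiniteDimensional ℝ E] {A : E →L[ℝ] E} {p : E}
    (hinj : ∀ t ∈ K.slopeBox p, Function.Injective (K.normalJac A t)) :
    ∃ κ > (0 : ℝ), ∀ t ∈ K.slopeBox p, ∀ d, κ * ‖d‖ ≤ ‖K.normalJac A t d‖ := by
  have : ProperSpace E := FiniteDimensional.proper_real E
  have hc : Continuous fun x : (ι → ℝ) × E => ‖K.normalJac A x.1 x.2‖ :=
    (((K.continuous_normalJac A).comp continuous_fst).clm_apply continuous_snd).norm
  obtain ⟨κ, hκ0, hκ⟩ := ((K.isCompact_slopeBox p).prod (isCompact_sphere (0 : E) 1)).exists_forall_le'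
    hc.continuousOn (a := 0) (by
      rintro ⟨t, d⟩ ⟨ht, hd⟩
      refine norm_pos_iff.2 fun h => ?_
      have h1 : d = 0 := hinj t ht (by simpa using h)
      simp [h1] at hd)
  refine ⟨κ, hκ0, fun t ht d => ?_⟩
  rcases eq_or_ne d 0 with rfl | hd
  · simp
  · have h1 := hκ (t, ‖d‖⁻¹ • d) ⟨ht, by simp [norm_smul, hd]⟩
    simp only [map_smul, norm_smul, norm_inv, norm_norm] at h1
    rwa [le_inv_mul_iff₀ (norm_pos_iff.2 hd), mul_comm] at h1

/-- The inverse function theorem of Clarke for normal maps. -/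
theorem locallyLipschitzHomeomorphNear_of_injective [FiniteDimensional ℝ E] {T : E → E}
    {A : E →L[ℝ] E} {p : E} (hT : HasStrictFDerivAt T A (K.posProj p))
    (hinj : ∀ t ∈ K.slopeBox p, Function.Injective (K.normalJac A t)) :
    LocallyLipschitzHomeomorphNear (K.normalMap T) p := by
  have : CompleteSpace E := FiniteDimensional.complete ℝ E
  obtain ⟨κ, hκ0, hκ⟩ := K.exists_antilipschitz_normalJac hinj
  obtain ⟨t₀, ht₀⟩ := K.slopeBox_nonempty p
  obtain ⟨C, hC0, hC⟩ := K.exists_lipschitz_negProjDir p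
  set B : E →L[ℝ] E := ContinuousLinearMap.id ℝ E - A with hB
  have hjac : ∀ t d, K.normalJac A t d = A d + B (K.diagOp t d) := fun t d => rfl
  -- `R` is the difference between the piecewise linear model d ↦ A d + B (`negProjDir` p d) and the
  -- single linear map with slopes `t₀`; the homotopy moves from the latter to the former.
  set R : E → E := fun d => B (K.negProjDir p d - K.diagOp t₀ d) with hR
  have hRL : ∀ d d', ‖R d - R d'‖ ≤ ‖B‖ * (C + ‖K.diagOp t₀‖) * ‖d - d'‖ := by
    intro d d'
    rw [hR]
    simp only
    rw [← map_sub, mul_assoc]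
    refine (B.le_opNorm _).trans ?_
    gcongr
    have h1 : K.negProjDir p d - K.diagOp t₀ d - (K.negProjDir p d' - K.diagOp t₀ d') =
        (K.negProjDir p d - K.negProjDir p d') - K.diagOp t₀ (d - d') := by
      rw [map_sub]; abel
    rw [h1, add_mul]
    exact (norm_sub_le _ _).trans (add_le_add (hC d d') ((K.diagOp t₀).le_opNorm _))
  -- An increment at parameter r is the linear map with slopes (1 - r) t₀ + r t applied to d - d'.
  -- Convexity keeps these slopes in the box, so the uniform lower bound applies.
  have hM : ∀ r ∈ Set.Icc (0 : ℝ) 1, ∀ d d', κ * ‖d - d'‖ ≤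
      ‖(K.normalJac A t₀ d + r • R d) - (K.normalJac A t₀ d' + r • R d')‖ := by
    intro r hr d d'
    obtain ⟨t, ht, h⟩ := K.exists_negProjDir_sub p d d'
    have hmem : (1 - r) • t₀ + r • t ∈ K.slopeBox p :=
      K.convex_slopeBox p ht₀ ht (by linarith [hr.2]) hr.1 (by ring)
    have hlin : K.diagOp ((1 - r) • t₀ + r • t) = (1 - r) • K.diagOp t₀ + r • K.diagOp t := by
      simp only [diagOp_eq_sum, map_add, map_smul]
    have h1 : (K.normalJac A t₀ d + r • R d) - (K.normalJac A t₀ d' + r • R d') =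
        K.normalJac A ((1 - r) • t₀ + r • t) (d - d') := by
      have h2 : R d - R d' = B (K.diagOp t (d - d') - K.diagOp t₀ (d - d')) := by
        rw [hR]
        simp only
        rw [← map_sub, ← h, map_sub (K.diagOp t₀)]
        congr 1
        abel
      have h3 : (K.normalJac A t₀ d + r • R d) - (K.normalJac A t₀ d' + r • R d') =
          K.normalJac A t₀ (d - d') + r • (R d - R d') := by
        rw [map_sub, smul_sub]; abel
      rw [h3, h2, hjac, hjac, hlin]
      simp only [add_apply, FunLike.coe_smul, Pi.smul_apply, map_add, map_sub, map_smul]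
      module
    rw [h1]
    exact hκ _ hmem _
  have hsurj₀ : Function.Surjective (K.normalJac A t₀) :=
    (LinearMap.injective_iff_surjective (f := (K.normalJac A t₀).toLinearMap)).1 (hinj t₀ ht₀)
  have hsurj := surjective_of_homotopy hκ0 hM hsurj₀ hRL
  have hend : ∀ d, K.normalJac A t₀ d + R d = A d + B (K.negProjDir p d) := by
    intro d
    rw [hjac, hR]
    simp only [map_sub]
    abel
  simp only [hend] at hsurj
  have hanti : ∀ d d', κ * ‖d - d'‖ ≤
      ‖(A d + B (K.negProjDir p d)) - (A d' + B (K.negProjDir p d'))‖ := fun d d' => by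
    simpa only [one_smul, hend] using hM 1 (by simp) d d'
  set G : E → E := fun q => K.normalMap T p + (A (q - p) + B (K.negProjDir p (q - p))) with hG
  have hGllh : LocallyLipschitzHomeomorphNear G p := by
    refine locallyLipschitzHomeomorphNear_of_surjective p (C := ‖A‖ + ‖B‖ * C) hκ0
      (fun q q' => ?_) (fun q q' => ?_) fun b => ?_
    · have h1 : G q - G q' = A (q - q') + B (K.negProjDir p (q - p) - K.negProjDir p (q' - p)) := by
        simp only [hG, map_sub]
        abel
      rw [h1, add_mul]
      refine (norm_add_le _ _).trans (add_le_add (A.le_opNorm _) ((B.le_opNorm _).trans ?_))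
      rw [mul_assoc]
      gcongr
      simpa using hC (q - p) (q' - p)
    · simpa [hG] using hanti (q - p) (q' - p)
    · obtain ⟨d, hd⟩ := hsurj (b - K.normalMap T p)
      refine ⟨p + d, ?_⟩
      simp only [hG, add_sub_cancel_left]
      simp only at hd
      rw [hd, add_sub_cancel]
  -- The expansion of the negative part is exact, so the normal map and its model differ only by the
  -- linearization error of `T` composed with the projection.
  refine hGllh.perturb fun ε hε => ?_
  obtain ⟨s, hs, hsε⟩ := K.exists_nhds_norm_sub_le_of_hasStrictFDerivAt hT hε
  refine ⟨s ∩ {q | K.negProj q = K.negProj p + K.negProjDir p (q - p)},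
    inter_mem hs (K.eventually_negProj_eq p), fun q hq q' hq' => ?_⟩
  have key : ∀ q, K.negProj q = K.negProj p + K.negProjDir p (q - p) →
      K.normalMap T q - G q = (T (K.posProj q) - A (K.posProj q)) -
        (T (K.posProj p) - A (K.posProj p)) := by
    intro q h
    have h1 : K.negProjDir p (q - p) = K.negProj q - K.negProj p := by rw [h]; abel
    simp only [hG, h1, hB, normalMap, posProj, sub_apply, ContinuousLinearMap.id_apply, map_sub]
    abel
  rw [key q hq.2, key q' hq'.2, sub_sub_sub_cancel_right]
  exact hsε q hq.1 q' hq'.1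

/-- A normal map is a locally Lipschitz homeomorphism if and only if its linearization is. -/
theorem locallyLipschitzHomeomorphNear_linearization_iff [CompleteSpace E] {T : E → E}
    {A : E →L[ℝ] E} {p : E} (hT : HasStrictFDerivAt T A (K.posProj p)) :
    LocallyLipschitzHomeomorphNear (K.normalMap T) p ↔ LocallyLipschitzHomeomorphNear
      (K.normalMap fun z => T (K.posProj p) + A (z - K.posProj p)) p := by
  -- Both normal maps contain the same negative part, which cancels; only the linearization error of
  -- `T` remains.
  have key : ∀ q, K.normalMap T q - K.normalMap (fun z => T (K.posProj p) + A (z - K.posProj p)) q =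
      (T (K.posProj q) - A (K.posProj q)) - (T (K.posProj p) - A (K.posProj p)) := by
    intro q
    simp only [normalMap, map_sub]
    abel
  constructor
  · intro h
    refine h.perturb fun ε hε => ?_
    obtain ⟨s, hs, hsε⟩ := K.exists_nhds_norm_sub_le_of_hasStrictFDerivAt hT hε
    refine ⟨s, hs, fun q hq q' hq' => ?_⟩
    rw [← neg_sub (K.normalMap T q), ← neg_sub (K.normalMap T q'), key q, key q', ← neg_sub', norm_neg,
      sub_sub_sub_cancel_right]
    exact hsε q hq q' hq'
  · intro h
    refine h.perturb fun ε hε => ?_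
    obtain ⟨s, hs, hsε⟩ := K.exists_nhds_norm_sub_le_of_hasStrictFDerivAt hT hε
    refine ⟨s, hs, fun q hq q' hq' => ?_⟩
    rw [key q, key q', sub_sub_sub_cancel_right]
    exact hsε q hq q' hq'

/-- `z` solves the generalized equation `η ∈ T(z) + N(z)`, in terms of the normal map. -/
def Solves (T : E → E) (η z : E) : Prop := ∃ p, K.posProj p = z ∧ K.normalMap T p = η

/-- The argument of a normal map is determined by its projection and its value. This turns solutions
of the generalized equation into preimages under the normal map, and back. -/
theorem posProj_add_normalMap_sub (T : E → E) (p : E) :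
    K.posProj p + K.normalMap T p - T (K.posProj p) = p := by
  rw [normalMap, add_sub_assoc, add_sub_cancel_left, posProj_add_negProj]

theorem normalMap_of_posProj_eq {T : E → E} {η z : E} (h : K.posProj (z + η - T z) = z) :
    K.normalMap T (z + η - T z) = η := by
  have h1 := K.posProj_add_negProj (z + η - T z)
  rw [h] at h1
  have : K.negProj (z + η - T z) = η - T z := by
    rw [add_sub_assoc] at h1 ⊢
    exact add_left_cancel h1
  rw [normalMap, h, this, add_sub_cancel]

theorem solves_iff {T : E → E} {η z : E} : K.Solves T η z ↔ K.posProj (z + η - T z) = z := by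
  constructor
  · rintro ⟨p, rfl, rfl⟩
    rw [posProj_add_normalMap_sub]
  · exact fun h => ⟨_, h, K.normalMap_of_posProj_eq h⟩

/-- The normal map of a Lipschitz map is a locally Lipschitz homeomorphism near a zero if and only if
the generalized equation has a Lipschitz single-valued localization of its solution mapping. -/
theorem locallyLipschitzHomeomorphNear_iff_localization {T : E → E} {C : ℝ} (hC0 : 0 ≤ C)
    (hTL : ∀ z z', ‖T z - T z'‖ ≤ C * ‖z - z'‖) {p : E} (hp : K.normalMap T p = 0) :
    LocallyLipschitzHomeomorphNear (K.normalMap T) p ↔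
      ∃ δ > (0 : ℝ), ∃ ε > (0 : ℝ), ∃ zhat : E → E,
        (∀ η ∈ Metric.closedBall 0 δ,
          zhat η ∈ Metric.closedBall (K.posProj p) ε ∧ K.Solves T η (zhat η) ∧
          ∀ z ∈ Metric.closedBall (K.posProj p) ε, K.Solves T η z → z = zhat η) ∧
        ∃ C : ℝ≥0, LipschitzOnWith C zhat (Metric.closedBall 0 δ) := by
  have hTc : Continuous T :=
    continuous_iff_continuousAt.2 fun z => by
      refine tendsto_iff_norm_sub_tendsto_zero.2 (squeeze_zero (fun _ => norm_nonneg _)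
        (fun z' => hTL z' z) ?_)
      have : Continuous fun z' => C * ‖z' - z‖ := by fun_prop
      simpa using this.tendsto z
  obtain ⟨L, hL0, hL⟩ := K.exists_lipschitz_posProj
  obtain ⟨L', hL'0, hL'⟩ := K.exists_lipschitz_negProj
  have hp' : K.posProj p + 0 - T (K.posProj p) = p := by
    rw [← hp, posProj_add_normalMap_sub]
  have hNc : Continuous (K.normalMap T) :=
    (hTc.comp K.continuous_posProj).add K.continuous_negProj
  constructor
  · rintro ⟨U, W, Ψ, hU, hW, hxU, hxW, hΦU, hΨW, hinv, -, ⟨D, hD⟩⟩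
    rw [hp] at hxW
    have hΨ0 : Ψ 0 = p := by rw [← hp]; exact hinv.1 hxU
    have hcont : Tendsto (fun x : E × E => x.2 + x.1 - T x.2) (𝓝 (0, K.posProj p)) (𝓝 p) := by
      have : Continuous fun x : E × E => x.2 + x.1 - T x.2 := by fun_prop
      have h1 := this.tendsto (0, K.posProj p)
      simp only [hp'] at h1
      exact h1
    have h1 := hcont.eventually (hU.mem_nhds hxU)
    rw [nhds_prod_eq, Filter.eventually_prod_iff] at h1
    -- Separate neighbourhoods of η = 0 and of the solution are chosen so that z + η - T z lies in
    -- `U`. Injectivity on `U` then gives uniqueness of the solution in the ball.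
    obtain ⟨pa, hpa, pb, hpb, hab⟩ := h1
    obtain ⟨ε, hε0, hε⟩ := Metric.nhds_basis_closedBall.eventually_iff.1 hpb
    have h2 : ∀ᶠ η in 𝓝 (0 : E), η ∈ W ∧ pa η ∧ K.posProj (Ψ η) ∈ Metric.closedBall (K.posProj p) ε := by
      refine Filter.Eventually.and (show ∀ᶠ η in 𝓝 0, η ∈ W from hW.mem_nhds hxW) (hpa.and ?_)
      have h3 : Tendsto (fun η => K.posProj (Ψ η)) (𝓝 0) (𝓝 (K.posProj p)) := by
        have h4 := (hD.continuousOn.continuousAt (hW.mem_nhds hxW)).tendsto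
        rw [hΨ0] at h4
        exact (K.continuous_posProj.tendsto p).comp h4
      exact h3 (Metric.closedBall_mem_nhds _ hε0)
    obtain ⟨δ, hδ0, hδ⟩ := Metric.nhds_basis_closedBall.eventually_iff.1 h2
    refine ⟨δ, hδ0, ε, hε0, fun η => K.posProj (Ψ η), fun η hη => ?_, _,
      lipschitzOnWith_toNNReal_of_norm_sub_le (C := L * D) fun a ha b hb => ?_⟩
    · obtain ⟨hηW, hηa, hηε⟩ := hδ hη
      refine ⟨hηε, ⟨Ψ η, rfl, hinv.2 hηW⟩, fun z hz hS => ?_⟩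
      have h3 : z + η - T z ∈ U := hab hηa (hε hz)
      rw [solves_iff] at hS
      have h6 := hinv.1 h3
      rw [K.normalMap_of_posProj_eq hS] at h6
      simp only [h6, hS]
    · refine (hL _ _).trans ?_
      rw [mul_assoc]
      gcongr
      simpa [dist_eq_norm] using hD.dist_le_mul a (hδ ha).1 b (hδ hb).1
  · rintro ⟨δ, hδ0, ε, hε0, zhat, hz, ⟨D, hD⟩⟩
    have h0 : zhat 0 = K.posProj p := ((hz 0 (Metric.mem_closedBall_self hδ0.le)).2.2 _
      (Metric.mem_closedBall_self hε0.le) ⟨p, rfl, hp⟩).symm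
    have hzc : Tendsto zhat (𝓝 0) (𝓝 (K.posProj p)) := by
      have := (hD.continuousOn.continuousAt (Metric.closedBall_mem_nhds 0 hδ0)).tendsto
      rwa [h0] at this
    -- The radius is reduced so that the localized solutions stay in the open ball of radius ε,
    -- which makes the neighbourhood constructed below open.
    obtain ⟨δ', hδ'0, hδ'⟩ := Metric.nhds_basis_ball.eventually_iff.1
      ((hzc.eventually (Metric.ball_mem_nhds _ hε0)).and (Metric.closedBall_mem_nhds 0 hδ0))
    have hΨ : ∀ η ∈ Metric.ball (0 : E) δ', K.posProj (zhat η + η - T (zhat η)) = zhat η ∧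
        K.normalMap T (zhat η + η - T (zhat η)) = η := by
      intro η hη
      obtain ⟨q, hq1, hq2⟩ := (hz η (hδ' hη).2).2.1
      have : zhat η + η - T (zhat η) = q := by
        rw [← hq1, ← hq2, posProj_add_normalMap_sub]
      rw [this]
      exact ⟨hq1, hq2⟩
    refine ⟨K.posProj ⁻¹' Metric.ball (K.posProj p) ε ∩ K.normalMap T ⁻¹' Metric.ball 0 δ',
      Metric.ball 0 δ', fun η => zhat η + η - T (zhat η),
      (Metric.isOpen_ball.preimage K.continuous_posProj).inter (Metric.isOpen_ball.preimage hNc),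
      Metric.isOpen_ball, ⟨Metric.mem_ball_self hε0, ?_⟩, ?_, fun q hq => hq.2, fun η hη => ?_,
      ⟨fun q hq => ?_, fun η hη => (hΨ η hη).2⟩,
      ⟨_, lipschitzOnWith_toNNReal_of_norm_sub_le (C := C * L + L') fun a _ b _ => ?_⟩,
      ⟨_, lipschitzOnWith_toNNReal_of_norm_sub_le (C := D + 1 + C * D) fun a ha b hb => ?_⟩⟩
    · rw [Set.mem_preimage, hp]
      exact Metric.mem_ball_self hδ'0
    · rw [hp]
      exact Metric.mem_ball_self hδ'0
    · refine ⟨?_, ?_⟩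
      · rw [Set.mem_preimage, (hΨ η hη).1]
        exact (hδ' hη).1
      · rw [Set.mem_preimage, (hΨ η hη).2]
        exact hη
    · have h1 := (hz _ (hδ' hq.2).2).2.2 (K.posProj q) (Metric.ball_subset_closedBall hq.1)
        ⟨q, rfl, rfl⟩
      simp only
      rw [← h1, posProj_add_normalMap_sub]
    · have h1 : K.normalMap T a - K.normalMap T b = (T (K.posProj a) - T (K.posProj b)) +
          (K.negProj a - K.negProj b) := by
        simp only [normalMap]; abel
      rw [h1, add_mul, mul_assoc]
      refine (norm_add_le _ _).trans (add_le_add ((hTL _ _).trans ?_) (hL' a b))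
      gcongr
      exact hL a b
    · have h1 : zhat a + a - T (zhat a) - (zhat b + b - T (zhat b)) =
          (zhat a - zhat b) + (a - b) - (T (zhat a) - T (zhat b)) := by abel
      have h2 : ‖zhat a - zhat b‖ ≤ D * ‖a - b‖ := by
        simpa [dist_eq_norm] using hD.dist_le_mul a (hδ' ha).2 b (hδ' hb).2
      rw [h1, add_mul, add_mul, one_mul, mul_assoc]
      refine (norm_sub_le _ _).trans (add_le_add ((norm_add_le _ _).trans (add_le_add h2 le_rfl))
        ((hTL _ _).trans ?_))
      gcongr

end OrthantCoords

/-! ### The KKT generalized equation as an orthant normal map. -/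

section KKTCoordinates

variable {n m n₁ n₂ m₁ m₂ : ℕ}

/-- The coordinates of the multipliers of the inequality constraints. -/
noncomputable def kktCoords (n m n₁ n₂ m₁ m₂ : ℕ) :
    OrthantCoords (Fin n₂ ⊕ Fin m₂) (PDSpace n m n₁ n₂ m₁ m₂) where
  coord := Sum.elim
    (fun i => EuclideanSpace.proj i ∘L ContinuousLinearMap.fst ℝ _ _ ∘L
      ContinuousLinearMap.snd ℝ _ _ ∘L ContinuousLinearMap.snd ℝ _ _)
    (fun i => EuclideanSpace.proj i ∘L ContinuousLinearMap.snd ℝ _ _ ∘L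
      ContinuousLinearMap.snd ℝ _ _ ∘L ContinuousLinearMap.snd ℝ _ _ ∘L
      ContinuousLinearMap.snd ℝ _ _ ∘L ContinuousLinearMap.snd ℝ _ _)
  vec := Sum.elim (fun i => (0, 0, EuclideanSpace.single i 1, 0, 0, 0))
    (fun i => (0, 0, 0, 0, 0, EuclideanSpace.single i 1))
  coord_vec := by
    rintro (i | i) (j | j) <;> simp

theorem sum_smul_kktCoords_vec (a : Fin n₂ ⊕ Fin m₂ → ℝ) :
    ∑ i, a i • (kktCoords n m n₁ n₂ m₁ m₂).vec i =
      (0, 0, WithLp.toLp 2 fun i => a (Sum.inl i), 0, 0, WithLp.toLp 2 fun i => a (Sum.inr i)) := by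
  have h (k : ℕ) (b : Fin k → ℝ) : ∑ i, b i • EuclideanSpace.single i (1 : ℝ) = WithLp.toLp 2 b := by
    ext j
    simp [Finset.sum_apply, Pi.single_apply]
  simp only [Fintype.sum_sum_type, kktCoords, Sum.elim_inl, Sum.elim_inr, Prod.smul_mk, smul_zero]
  refine Prod.ext ?_ (Prod.ext ?_ (Prod.ext ?_ (Prod.ext ?_ (Prod.ext ?_ ?_)))) <;>
    simp [Prod.fst_sum, Prod.snd_sum, h]

theorem kktCoords_negProj (p : PDSpace n m n₁ n₂ m₁ m₂) :
    (kktCoords n m n₁ n₂ m₁ m₂).negProj p =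
      (0, 0, vecNeg p.2.2.1, 0, 0, vecNeg p.2.2.2.2.2) :=
  sum_smul_kktCoords_vec _

theorem sub_vecNeg {k : ℕ} (a : Vec k) : a - vecNeg a = vecPos a := by
  ext i
  simp only [vecNeg, vecPos, PiLp.sub_apply]
  rcases le_total 0 (a i) with h | h
  · rw [min_eq_left h, max_eq_right h, sub_zero]
  · rw [min_eq_right h, max_eq_left h, sub_self]

theorem kktCoords_posProj (p : PDSpace n m n₁ n₂ m₁ m₂) :
    (kktCoords n m n₁ n₂ m₁ m₂).posProj p =
      (p.1, p.2.1, vecPos p.2.2.1, p.2.2.2.1, p.2.2.2.2.1, vecPos p.2.2.2.2.2) := by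
  rw [OrthantCoords.posProj, kktCoords_negProj]
  obtain ⟨x, u, w, y, mu, xi⟩ := p
  simp [sub_vecNeg]

theorem kktCoords_diagOp_apply (t : Fin n₂ ⊕ Fin m₂ → ℝ) (d : PDSpace n m n₁ n₂ m₁ m₂) :
    (kktCoords n m n₁ n₂ m₁ m₂).diagOp t d =
      (0, 0, WithLp.toLp 2 fun i => t (Sum.inl i) * d.2.2.1 i, 0, 0,
        WithLp.toLp 2 fun i => t (Sum.inr i) * d.2.2.2.2.2 i) := by
  rw [OrthantCoords.diagOp_apply]
  exact sum_smul_kktCoords_vec _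

/-- The reflection in the third block, which turns the normal map into the Kojima mapping. -/
noncomputable def flipG (n m n₁ n₂ m₁ m₂ : ℕ) :
    PDSpace n m n₁ n₂ m₁ m₂ ≃L[ℝ] PDSpace n m n₁ n₂ m₁ m₂ :=
  (ContinuousLinearEquiv.refl ℝ _).prodCongr ((ContinuousLinearEquiv.refl ℝ _).prodCongr
    ((ContinuousLinearEquiv.neg ℝ).prodCongr (ContinuousLinearEquiv.refl ℝ _)))

theorem flipG_apply (p : PDSpace n m n₁ n₂ m₁ m₂) :
    flipG n m n₁ n₂ m₁ m₂ p = (p.1, p.2.1, -p.2.2.1, p.2.2.2) := rfl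

theorem MinimaxProblem.kojima_eq (P : MinimaxProblem n m n₁ n₂ m₁ m₂) :
    P.kojima = fun p => flipG n m n₁ n₂ m₁ m₂
      ((kktCoords n m n₁ n₂ m₁ m₂).normalMap P.geMap p) := by
  funext p
  rw [OrthantCoords.normalMap, kktCoords_posProj, kktCoords_negProj, flipG_apply]
  obtain ⟨x, u, w, y, mu, xi⟩ := p
  simp only [MinimaxProblem.kojima, MinimaxProblem.geMap, Prod.mk_add_mk, add_zero, neg_add_rev,
    neg_neg]
  rw [sub_eq_neg_add]

/-- Testing with z + e_i gives the sign of a_i; testing with z - z_i e_i, which stays in the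
orthant, gives a_i z_i ≥ 0 and hence complementarity. -/
theorem sum_mul_nonpos_iff {k : ℕ} {a z : Vec k} (hz : ∀ i, 0 ≤ z i) :
    (∀ z' : Vec k, (∀ i, 0 ≤ z' i) → inner ℝ a (z' - z) ≤ 0) ↔
      ∀ i, a i ≤ 0 ∧ a i * z i = 0 := by
  constructor
  · intro h i
    have h1 := h (z + EuclideanSpace.single i 1) fun j => by
      have : (0 : ℝ) ≤ (EuclideanSpace.single i (1 : ℝ) : Vec k) j := by
        simp only [PiLp.single_apply]; split_ifs <;> norm_num
      simpa using add_nonneg (hz j) this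
    have h2 := h (z - EuclideanSpace.single i (z i)) fun j => by
      simp only [PiLp.sub_apply, PiLp.single_apply]
      split_ifs with hj
      · rw [hj]; simp
      · simpa using hz j
    have h3 : a i ≤ 0 := by simpa [EuclideanSpace.inner_single_right] using h1
    have h4 : 0 ≤ z i * a i := by simpa [EuclideanSpace.inner_single_right] using h2
    exact ⟨h3, le_antisymm (mul_nonpos_of_nonpos_of_nonneg h3 (hz i)) (by rwa [mul_comm])⟩
  · intro h z' hz'
    rw [PiLp.inner_apply]
    refine Finset.sum_nonpos fun i _ => ?_
    have h1 := mul_nonpos_of_nonpos_of_nonneg (h i).1 (hz' i)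
    have h2 := (h i).2
    simp only [PiLp.sub_apply, RCLike.inner_apply, conj_trivial]
    nlinarith

theorem vecPos_eq_iff {k : ℕ} (a z : Vec k) :
    vecPos (z + a) = z ↔ (∀ i, 0 ≤ z i) ∧ ∀ i, a i ≤ 0 ∧ a i * z i = 0 := by
  have : vecPos (z + a) = z ↔ ∀ i, max 0 (z i + a i) = z i :=
    ⟨fun h i => by conv_rhs => rw [← h]
                   simp [vecPos], fun h => by ext i; simpa [vecPos] using h i⟩
  rw [this, ← forall_and]
  refine forall_congr' fun i => ⟨fun h => ?_, fun ⟨h1, h2, h3⟩ => ?_⟩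
  · rcases max_cases 0 (z i + a i) with ⟨h1, h2⟩ | ⟨h1, h2⟩
    · rw [h1] at h
      rw [← h] at h2 ⊢
      simpa using h2
    · have h3 : a i = 0 := by linarith
      rw [h3] at h2 ⊢
      simp only [le_refl, zero_mul, and_self, and_true]
      linarith
  · rcases mul_eq_zero.1 h3 with h4 | h4
    · rw [h4, add_zero, max_eq_right h1]
    · rw [h4, zero_add, max_eq_left h2]

/-- The variational characterization of projection, checked blockwise: normals vanish in the free
blocks and are complementary to the multiplier in the two orthant blocks. -/
theorem mem_normalConeAt_coneK_iff (ν z : PDSpace n m n₁ n₂ m₁ m₂) :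
    ν ∈ normalConeAt (coneK n m n₁ n₂ m₁ m₂) z ↔
      (kktCoords n m n₁ n₂ m₁ m₂).posProj (z + ν) = z := by
  have hpos : (kktCoords n m n₁ n₂ m₁ m₂).posProj (z + ν) = z ↔
      (ν.1 = 0 ∧ ν.2.1 = 0 ∧ ν.2.2.2.1 = 0 ∧ ν.2.2.2.2.1 = 0) ∧
        vecPos (z.2.2.1 + ν.2.2.1) = z.2.2.1 ∧
          vecPos (z.2.2.2.2.2 + ν.2.2.2.2.2) = z.2.2.2.2.2 := by
    rw [kktCoords_posProj]
    obtain ⟨x, u, w, y, mu, xi⟩ := z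
    obtain ⟨x', u', w', y', mu', xi'⟩ := ν
    simp only [Prod.mk_add_mk, Prod.mk.injEq, add_eq_left]
    tauto
  rw [hpos]
  constructor
  · rintro ⟨⟨hz1, hz2⟩, h⟩
    have hblock : ν.1 = 0 ∧ ν.2.1 = 0 ∧ ν.2.2.2.1 = 0 ∧ ν.2.2.2.2.1 = 0 := by
      -- Moving in the free blocks by the normal itself bounds the sum of their squared norms by
      -- zero.
      have h1 := h (z + (ν.1, ν.2.1, 0, ν.2.2.2.1, ν.2.2.2.2.1, 0)) ⟨by simpa using hz1,
        by simpa using hz2⟩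
      rw [add_sub_cancel_left] at h1
      simp only [blockInner, inner_zero_right, add_zero, real_inner_self_eq_norm_sq] at h1
      have a1 := sq_nonneg ‖ν.1‖
      have a2 := sq_nonneg ‖ν.2.1‖
      have a3 := sq_nonneg ‖ν.2.2.2.1‖
      have a4 := sq_nonneg ‖ν.2.2.2.2.1‖
      refine ⟨?_, ?_, ?_, ?_⟩ <;> rw [← norm_eq_zero, ← sq_eq_zero_iff] <;> linarith
    refine ⟨hblock, (vecPos_eq_iff _ _).2 ⟨hz1, (sum_mul_nonpos_iff hz1).1 fun z' hz' => ?_⟩,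
      (vecPos_eq_iff _ _).2 ⟨hz2, (sum_mul_nonpos_iff hz2).1 fun z' hz' => ?_⟩⟩
    · have h1 := h (z.1, z.2.1, z', z.2.2.2) ⟨hz', hz2⟩
      simpa [blockInner] using h1
    · have h1 := h (z.1, z.2.1, z.2.2.1, z.2.2.2.1, z.2.2.2.2.1, z') ⟨hz1, hz'⟩
      simpa [blockInner] using h1
  · rintro ⟨⟨h1, h2, h3, h4⟩, h5, h6⟩
    rw [vecPos_eq_iff] at h5 h6
    refine ⟨⟨h5.1, h6.1⟩, fun z' hz' => ?_⟩
    have e1 := (sum_mul_nonpos_iff h5.1).2 h5.2 _ hz'.1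
    have e2 := (sum_mul_nonpos_iff h6.1).2 h6.2 _ hz'.2
    simp only [blockInner, h1, h2, h3, h4, inner_zero_left, Prod.fst_sub, Prod.snd_sub, zero_add,
      add_zero]
    linarith

theorem solvesGE_iff (T : PDSpace n m n₁ n₂ m₁ m₂ → PDSpace n m n₁ n₂ m₁ m₂)
    (η z : PDSpace n m n₁ n₂ m₁ m₂) :
    SolvesGE T η z ↔ (kktCoords n m n₁ n₂ m₁ m₂).Solves T η z := by
  rw [OrthantCoords.solves_iff, SolvesGE]
  constructor
  · rintro ⟨ν, hν, rfl⟩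
    rw [mem_normalConeAt_coneK_iff] at hν
    rwa [add_sub_assoc, add_sub_cancel_left]
  · intro h
    refine ⟨η - T z, (mem_normalConeAt_coneK_iff _ _).2 (by rwa [← add_sub_assoc]), by abel⟩

variable (P : MinimaxProblem n m n₁ n₂ m₁ m₂) {x : Vec n} {u : Vec n₁} {v : Vec n₂} {y : Vec m}
  {mu : Vec m₁} {lam : Vec m₂}

theorem complementary_iff {k : ℕ} (a b : Vec k) :
    Complementary a b ↔ (∀ i, 0 ≤ a i) ∧ ∀ i, b i ≤ 0 ∧ b i * a i = 0 := by
  have key : (∀ i, 0 ≤ a i) → (∀ i, b i ≤ 0) → (inner ℝ a b = 0 ↔ ∀ i, b i * a i = 0) := by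
    intro ha hb
    rw [PiLp.inner_apply, Finset.sum_eq_zero_iff_of_nonpos fun i _ => by
      simpa using mul_nonpos_of_nonpos_of_nonneg (hb i) (ha i)]
    simp
  constructor
  · rintro ⟨ha, h, hb⟩
    exact ⟨ha, fun i => ⟨hb i, (key ha hb).1 h i⟩⟩
  · rintro ⟨ha, h⟩
    exact ⟨ha, (key ha fun i => (h i).1).2 fun i => (h i).2, fun i => (h i).1⟩

theorem MinimaxProblem.IsKKT.posProj_eq (h : P.IsKKT x u v y mu lam) :
    (kktCoords n m n₁ n₂ m₁ m₂).posProj (x, u, v + P.G x, y, mu, lam + P.g x y) =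
      (x, u, v, y, mu, lam) := by
  have h1 := (vecPos_eq_iff _ _).2 ((complementary_iff _ _).1 h.1.2.2)
  have h2 := (vecPos_eq_iff _ _).2 ((complementary_iff _ _).1 h.2.2.2)
  rw [kktCoords_posProj]
  simp only [h1, h2]

theorem MinimaxProblem.IsKKT.normalMap_eq_zero (h : P.IsKKT x u v y mu lam) :
    (kktCoords n m n₁ n₂ m₁ m₂).normalMap P.geMap (x, u, v + P.G x, y, mu, lam + P.g x y) = 0 := by
  have h1 := (kktCoords n m n₁ n₂ m₁ m₂).posProj_add_negProj (x, u, v + P.G x, y, mu, lam + P.g x y)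
  rw [h.posProj_eq, kktCoords_negProj] at h1
  simp only [Prod.mk_add_mk, add_zero, Prod.mk.injEq, true_and, add_right_inj] at h1
  rw [OrthantCoords.normalMap, h.posProj_eq, kktCoords_negProj]
  simp only [h1.1, h1.2, MinimaxProblem.geMap, h.1.1, h.1.2.1, h.2.1, h.2.2.1]
  simp

theorem MinimaxProblem.locallyLipschitzHomeomorphNear_kojima_iff
    (hT : ContDiffAt ℝ 1 P.geMap (x, u, v, y, mu, lam)) (h : P.IsKKT x u v y mu lam) :
    LocallyLipschitzHomeomorphNear P.kojima (x, u, v + P.G x, y, mu, lam + P.g x y) ↔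
      StronglyRegularSolution P.geMap (x, u, v, y, mu, lam) := by
  set K := kktCoords n m n₁ n₂ m₁ m₂ with hK
  set p : PDSpace n m n₁ n₂ m₁ m₂ := (x, u, v + P.G x, y, mu, lam + P.g x y) with hp
  have hπ : K.posProj p = (x, u, v, y, mu, lam) := h.posProj_eq
  have h0 : K.normalMap P.geMap p = 0 := h.normalMap_eq_zero
  have hS : SolvesGE P.geMap 0 (x, u, v, y, mu, lam) := (solvesGE_iff _ _ _).2 ⟨p, hπ, h0⟩
  set A := fderiv ℝ P.geMap (x, u, v, y, mu, lam) with hA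
  have hstrict : HasStrictFDerivAt P.geMap A (K.posProj p) := by
    rw [hπ]
    exact hT.hasStrictFDerivAt (by simp)
  have hlin : (fun z => P.geMap (K.posProj p) + A (z - K.posProj p)) =
      linearizationAt P.geMap (x, u, v, y, mu, lam) := by
    rw [hπ]
    rfl
  have h0' : K.normalMap (linearizationAt P.geMap (x, u, v, y, mu, lam)) p = 0 := by
    rw [← h0, OrthantCoords.normalMap, OrthantCoords.normalMap, hπ, linearizationAt, sub_self,
      map_zero, add_zero]
  -- The sign change is removed and the map is replaced by its linearization. The latter is globally
  -- Lipschitz, as the localization criterion requires.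
  rw [P.kojima_eq, locallyLipschitzHomeomorphNear_equiv_comp_iff,
    K.locallyLipschitzHomeomorphNear_linearization_iff hstrict, hlin,
    K.locallyLipschitzHomeomorphNear_iff_localization (norm_nonneg A) (fun z z' => ?_) h0', hπ]
  · simp only [StronglyRegularSolution, hS, true_and, solvesGE_iff, hK]
  · rw [linearizationAt, linearizationAt, add_sub_add_left_eq_sub, ← map_sub,
      sub_sub_sub_cancel_right]
    exact A.le_opNorm _

theorem MinimaxProblem.clarkeJacobian_kojima
    (hT : ContDiffAt ℝ 1 P.geMap (x, u, v, y, mu, lam)) (h : P.IsKKT x u v y mu lam) :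
    clarkeJacobian P.kojima (x, u, v + P.G x, y, mu, lam + P.g x y) =
      (fun t => (flipG n m n₁ n₂ m₁ m₂ : PDSpace n m n₁ n₂ m₁ m₂ →L[ℝ] PDSpace n m n₁ n₂ m₁ m₂) ∘L
        (kktCoords n m n₁ n₂ m₁ m₂).normalJac (fderiv ℝ P.geMap (x, u, v, y, mu, lam)) t) ''
          (kktCoords n m n₁ n₂ m₁ m₂).slopeBox (x, u, v + P.G x, y, mu, lam + P.g x y) := by
  rw [← h.posProj_eq] at hT
  rw [P.kojima_eq, clarkeJacobian_equiv_comp, OrthantCoords.clarkeJacobian_normalMap _ hT,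
    Set.image_image, h.posProj_eq]
  rfl

theorem MinimaxProblem.locallyLipschitzHomeomorphNear_kojima
    (hT : ContDiffAt ℝ 1 P.geMap (x, u, v, y, mu, lam)) (h : P.IsKKT x u v y mu lam)
    (hV : ∀ V ∈ clarkeJacobian P.kojima (x, u, v + P.G x, y, mu, lam + P.g x y),
      Function.Bijective V) :
    LocallyLipschitzHomeomorphNear P.kojima (x, u, v + P.G x, y, mu, lam + P.g x y) := by
  rw [P.clarkeJacobian_kojima hT h] at hV
  rw [P.kojima_eq, locallyLipschitzHomeomorphNear_equiv_comp_iff]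
  rw [← h.posProj_eq] at hT
  refine OrthantCoords.locallyLipschitzHomeomorphNear_of_injective _
    (hT.hasStrictFDerivAt (by simp)) fun t ht => ?_
  rw [h.posProj_eq]
  exact fun d d' hd => (hV _ ⟨t, ht, rfl⟩).1 (congrArg (flipG n m n₁ n₂ m₁ m₂) hd)

end KKTCoordinates

/-! ### Derivatives of vector-valued maps, gradients and Hessian forms. -/

section VecCalculus

variable {E : Type*} [NormedAddCommGroup E] [NormedSpace ℝ E] {a b : ℕ}

theorem vec_apply_eq_inner {k : ℕ} (x : Vec k) (i : Fin k) :
    x i = inner ℝ (EuclideanSpace.single i 1) x := by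
  simp [EuclideanSpace.inner_single_left]

theorem vec_ext_inner {k : ℕ} {x y : Vec k} (h : ∀ e, inner ℝ e x = inner ℝ e y) : x = y :=
  ext_inner_left ℝ h

/-- Gradients and adjoints are handled by pairing with a fixed vector, which turns them into scalar
expressions in Fréchet derivatives. -/
theorem contDiffAt_of_inner {k r : ℕ} {φ : E → Vec k} {x : E}
    (h : ∀ e, ContDiffAt ℝ r (fun x' => inner ℝ e (φ x')) x) : ContDiffAt ℝ r φ x := by
  rw [contDiffAt_euclidean]
  intro i
  simpa only [← vec_apply_eq_inner] using h (EuclideanSpace.single i 1)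

theorem inner_fderiv_apply {k : ℕ} {φ : E → Vec k} {x : E} (h : DifferentiableAt ℝ φ x) (e : Vec k)
    (d : E) : inner ℝ e (fderiv ℝ φ x d) = fderiv ℝ (fun x' => inner ℝ e (φ x')) x d := by
  have h1 := ((innerSL ℝ e).hasFDerivAt (x := φ x)).comp x h.hasFDerivAt
  have h2 : HasFDerivAt (fun x' => inner ℝ e (φ x')) ((innerSL ℝ e) ∘L (fderiv ℝ φ x)) x := h1
  rw [h2.fderiv]
  rfl

theorem fderiv_apply_coord {k : ℕ} {φ : E → Vec k} {x : E} (h : DifferentiableAt ℝ φ x) (i : Fin k)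
    (d : E) : fderiv ℝ (fun x' => φ x' i) x d = fderiv ℝ φ x d i := by
  rw [vec_apply_eq_inner, inner_fderiv_apply h]
  simp only [← vec_apply_eq_inner]

theorem fderiv_apply_of_hasFDerivAt {F : Type*} [NormedAddCommGroup F] [NormedSpace ℝ F]
    {φ : E → F} {φ' : E →L[ℝ] F} {x : E} (h : HasFDerivAt φ φ' x) (d : E) :
    fderiv ℝ φ x d = φ' d := by
  rw [h.fderiv]

theorem hasFDerivAt_inner_clm_apply {Z : Type*} [NormedAddCommGroup Z] [NormedSpace ℝ Z] {k : ℕ}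
    (π : E →L[ℝ] Vec k) (ρ : E →L[ℝ] Z) {ψ : Z → Z →L[ℝ] Vec k} {s : E}
    (hψ : DifferentiableAt ℝ ψ (ρ s)) (e : Z) :
    HasFDerivAt (fun s' => (inner ℝ (π s') (ψ (ρ s') e) : ℝ))
      (innerSL ℝ (π s) ∘L (fderiv ℝ ψ (ρ s)).flip e ∘L ρ + innerSL ℝ (ψ (ρ s) e) ∘L π) s := by
  have h1 : HasFDerivAt (fun s' => ψ (ρ s') e) ((fderiv ℝ ψ (ρ s)).flip e ∘L ρ) s := by
    have h2 := (hψ.hasFDerivAt.comp s ρ.hasFDerivAt).clm_apply (hasFDerivAt_const e s)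
    refine h2.congr_fderiv ?_
    ext d
    simp
  refine (π.hasFDerivAt.inner ℝ h1).congr_fderiv ?_
  ext d
  simp [fderivInnerCLM_apply, real_inner_comm]

theorem jacMat_mulVec (φ : Vec a → Vec b) (x : Vec a) (d : Vec a) :
    jacMat φ x *ᵥ d.ofLp = (fderiv ℝ φ x d).ofLp := by
  have hd : d = ∑ j, d j • EuclideanSpace.single j (1 : ℝ) := by
    ext i
    simp [Finset.sum_apply, Pi.single_apply]
  funext i
  conv_rhs => rw [hd]
  rw [map_sum]
  simp [Matrix.mulVec, dotProduct, jacMat, mul_comm]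

theorem dotProduct_eq_inner (c d : Vec a) : c.ofLp ⬝ᵥ d.ofLp = inner ℝ d c := by
  simp [PiLp.inner_apply, dotProduct]

theorem quadForm_jacMat (φ : Vec a → Vec a) (x d : Vec a) :
    quadForm (jacMat φ x) d = inner ℝ d (fderiv ℝ φ x d) := by
  rw [quadForm, jacMat_mulVec, dotProduct_eq_inner]

theorem inner_gradient (φ : Vec a → ℝ) (x e : Vec a) : inner ℝ e (gradient φ x) = fderiv ℝ φ x e := by
  rw [real_inner_comm, gradient, InnerProductSpace.toDual_symm_apply]

theorem quadForm_hessMat {φ : Vec a → ℝ} {x : Vec a} (h : ContDiffAt ℝ 2 φ x) (d : Vec a) :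
    quadForm (hessMat φ x) d = fderiv ℝ (fderiv ℝ φ) x d d := by
  have h1 : ContDiffAt ℝ 1 (fderiv ℝ φ) x := h.fderiv_right (by norm_num)
  have hdf : DifferentiableAt ℝ (fderiv ℝ φ) x := h1.differentiableAt (by simp)
  have h2 : ContDiffAt ℝ (1 : ℕ) (fun x' => gradient φ x') x := contDiffAt_of_inner fun e => by
    simp only [inner_gradient]
    exact h1.clm_apply contDiffAt_const
  have h3 : DifferentiableAt ℝ (fun x' => gradient φ x') x := h2.differentiableAt (by simp)
  rw [hessMat, quadForm_jacMat, inner_fderiv_apply h3]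
  simp only [inner_gradient]
  rw [fderiv_clm_apply hdf (differentiableAt_const d)]
  simp

theorem quadForm_add (M N : Matrix (Fin a) (Fin a) ℝ) (d : Vec a) :
    quadForm (M + N) d = quadForm M d + quadForm N d := by
  simp [quadForm, Matrix.add_mulVec, add_dotProduct]

theorem quadForm_sub (M N : Matrix (Fin a) (Fin a) ℝ) (d : Vec a) :
    quadForm (M - N) d = quadForm M d - quadForm N d := by
  simp [quadForm, Matrix.sub_mulVec, sub_dotProduct]

theorem quadForm_sum_smul {k : ℕ} (c : Fin k → ℝ) (M : Fin k → Matrix (Fin a) (Fin a) ℝ) (d : Vec a) :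
    quadForm (∑ j, c j • M j) d = ∑ j, c j * quadForm (M j) d := by
  simp [quadForm, Matrix.sum_mulVec, sum_dotProduct, Matrix.smul_mulVec]

theorem sum_mul_quadForm_hessMat {Φ : Vec a → Vec b} {x : Vec a} (h : ContDiffAt ℝ 2 Φ x) (c : Vec b)
    (d : Vec a) : quadForm (∑ j, c j • hessMat (fun x' => Φ x' j) x) d =
      inner ℝ c (fderiv ℝ (fderiv ℝ Φ) x d d) := by
  rw [quadForm_sum_smul, PiLp.inner_apply]
  refine Finset.sum_congr rfl fun j _ => ?_
  have h1 : ContDiffAt ℝ 2 (fun x' => Φ x' j) x := (contDiffAt_euclidean.1 h) j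
  have h2 : DifferentiableAt ℝ (fderiv ℝ Φ) x :=
    (h.fderiv_right (m := 1) (by norm_num)).differentiableAt (by simp)
  have h3 : fderiv ℝ (fun x' => Φ x' j) =ᶠ[𝓝 x] fun x' => EuclideanSpace.proj j ∘L fderiv ℝ Φ x' := by
    filter_upwards [h.eventually (by simp)] with x' hx'
    ext e
    rw [fderiv_apply_coord (hx'.differentiableAt (by simp))]
    rfl
  rw [quadForm_hessMat h1, h3.fderiv_eq, fderiv_clm_comp (differentiableAt_const _) h2]
  simp [mul_comm]

end VecCalculus

/-! ### First and second derivatives of the Lagrangian. -/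

namespace MinimaxProblem

variable {n m n₁ n₂ m₁ m₂ : ℕ} (P : MinimaxProblem n m n₁ n₂ m₁ m₂)

/-- The objective function, on pairs. -/
def fPair (q : Vec n × Vec m) : ℝ := P.f q.1 q.2

/-- The equality constraints of the inner problem, on pairs. -/
def hPair (q : Vec n × Vec m) : Vec m₁ := P.h q.1 q.2

/-- The inequality constraints of the inner problem, on pairs. -/
def gPair (q : Vec n × Vec m) : Vec m₂ := P.g q.1 q.2

/-- Smoothness of the functions of the inner problem. -/
structure InnerSmooth (q : Vec n × Vec m) : Prop where
  f : ContDiffAt ℝ 2 P.fPair q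
  h : ContDiffAt ℝ 2 P.hPair q
  g : ContDiffAt ℝ 2 P.gPair q

/-- The derivative of the Lagrangian in `(x, y)`. -/
noncomputable def lagrDeriv (s : (Vec n × Vec m) × Vec m₁ × Vec m₂) : Vec n × Vec m →L[ℝ] ℝ :=
  fderiv ℝ P.fPair s.1 + innerSL ℝ s.2.1 ∘L fderiv ℝ P.hPair s.1 -
    innerSL ℝ s.2.2 ∘L fderiv ℝ P.gPair s.1

/-- The second derivative of the Lagrangian in `(x, y)`. -/
noncomputable def lagrHess (s : (Vec n × Vec m) × Vec m₁ × Vec m₂) (c e : Vec n × Vec m) : ℝ :=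
  fderiv ℝ (fderiv ℝ P.fPair) s.1 c e + inner ℝ s.2.1 (fderiv ℝ (fderiv ℝ P.hPair) s.1 c e) -
    inner ℝ s.2.2 (fderiv ℝ (fderiv ℝ P.gPair) s.1 c e)

theorem lagrHess_add_left (s : (Vec n × Vec m) × Vec m₁ × Vec m₂) (c c' e : Vec n × Vec m) :
    P.lagrHess s (c + c') e = P.lagrHess s c e + P.lagrHess s c' e := by
  simp only [lagrHess, map_add, add_apply, inner_add_right]
  ring

variable {P}

theorem lagrHess_symm {s : (Vec n × Vec m) × Vec m₁ × Vec m₂} (hs : P.InnerSmooth s.1)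
    (c e : Vec n × Vec m) : P.lagrHess s c e = P.lagrHess s e c := by
  simp only [lagrHess]
  rw [(hs.f.isSymmSndFDerivAt (by simp)).eq c e, (hs.h.isSymmSndFDerivAt (by simp)).eq c e,
    (hs.g.isSymmSndFDerivAt (by simp)).eq c e]

theorem InnerSmooth.eventually {q : Vec n × Vec m} (hq : P.InnerSmooth q) :
    ∀ᶠ q' in 𝓝 q, P.InnerSmooth q' := by
  filter_upwards [hq.f.eventually (by simp), hq.h.eventually (by simp), hq.g.eventually (by simp)]
    with q' h1 h2 h3
  exact ⟨h1, h2, h3⟩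

theorem InnerSmooth.hasFDerivAt_lagr {s : (Vec n × Vec m) × Vec m₁ × Vec m₂}
    (hs : P.InnerSmooth s.1) :
    HasFDerivAt (fun q : Vec n × Vec m => P.lagr q.1 q.2 s.2.1 s.2.2) (P.lagrDeriv s) s.1 := by
  have h1 := (hs.f.differentiableAt (by simp)).hasFDerivAt
  have h2 := (hs.h.differentiableAt (by simp)).hasFDerivAt
  have h3 := (hs.g.differentiableAt (by simp)).hasFDerivAt
  exact (h1.add (((innerSL ℝ s.2.1).hasFDerivAt (x := P.hPair s.1)).comp s.1 h2)).sub
    (((innerSL ℝ s.2.2).hasFDerivAt (x := P.gPair s.1)).comp s.1 h3)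

theorem InnerSmooth.inner_gradX {s : (Vec n × Vec m) × Vec m₁ × Vec m₂} (hs : P.InnerSmooth s.1)
    (e : Vec n) : inner ℝ e (P.gradX s.1.1 s.1.2 s.2.1 s.2.2) = P.lagrDeriv s (e, 0) := by
  have h1 : HasFDerivAt (fun x' : Vec n => (x', s.1.2)) (ContinuousLinearMap.inl ℝ _ _) s.1.1 :=
    hasFDerivAt_prodMk_left _ _
  have h2 : HasFDerivAt (fun x' => P.lagr x' s.1.2 s.2.1 s.2.2)
      (P.lagrDeriv s ∘L ContinuousLinearMap.inl ℝ _ _) s.1.1 :=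
    HasFDerivAt.comp (g := fun q : Vec n × Vec m => P.lagr q.1 q.2 s.2.1 s.2.2) s.1.1
      hs.hasFDerivAt_lagr h1
  rw [gradX, inner_gradient, h2.fderiv]
  rfl

theorem InnerSmooth.inner_gradY {s : (Vec n × Vec m) × Vec m₁ × Vec m₂} (hs : P.InnerSmooth s.1)
    (e : Vec m) : inner ℝ e (P.gradY s.1.1 s.1.2 s.2.1 s.2.2) = P.lagrDeriv s (0, e) := by
  have h1 : HasFDerivAt (fun y' : Vec m => (s.1.1, y')) (ContinuousLinearMap.inr ℝ _ _) s.1.2 :=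
    hasFDerivAt_prodMk_right _ _
  have h2 : HasFDerivAt (fun y' => P.lagr s.1.1 y' s.2.1 s.2.2)
      (P.lagrDeriv s ∘L ContinuousLinearMap.inr ℝ _ _) s.1.2 :=
    HasFDerivAt.comp (g := fun q : Vec n × Vec m => P.lagr q.1 q.2 s.2.1 s.2.2) s.1.2
      hs.hasFDerivAt_lagr h1
  rw [gradY, inner_gradient, h2.fderiv]
  rfl

theorem InnerSmooth.contDiffAt_lagrDeriv {s : (Vec n × Vec m) × Vec m₁ × Vec m₂}
    (hs : P.InnerSmooth s.1) : ContDiffAt ℝ 1 P.lagrDeriv s := by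
  have hfst : ContDiffAt ℝ 1 (fun s' : (Vec n × Vec m) × Vec m₁ × Vec m₂ => s'.1) s := contDiffAt_fst
  have h1 : ContDiffAt ℝ 1 (fderiv ℝ P.fPair) s.1 := hs.f.fderiv_right (by norm_num)
  have h2 : ContDiffAt ℝ 1 (fderiv ℝ P.hPair) s.1 := hs.h.fderiv_right (by norm_num)
  have h3 : ContDiffAt ℝ 1 (fderiv ℝ P.gPair) s.1 := hs.g.fderiv_right (by norm_num)
  have i1 : ContDiffAt ℝ 1 (fun s' : (Vec n × Vec m) × Vec m₁ × Vec m₂ => innerSL ℝ s'.2.1) s :=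
    (innerSL ℝ).contDiff.contDiffAt.comp s (by fun_prop)
  have i2 : ContDiffAt ℝ 1 (fun s' : (Vec n × Vec m) × Vec m₁ × Vec m₂ => innerSL ℝ s'.2.2) s :=
    (innerSL ℝ).contDiff.contDiffAt.comp s (by fun_prop)
  exact ((h1.comp s hfst).add (i1.clm_comp (h2.comp s hfst))).sub (i2.clm_comp (h3.comp s hfst))

/-- The Lagrangian is affine in the multipliers, so their directions contribute only first
derivatives of the constraints. -/
theorem InnerSmooth.fderiv_lagrDeriv_apply {s : (Vec n × Vec m) × Vec m₁ × Vec m₂}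
    (hs : P.InnerSmooth s.1) (e : Vec n × Vec m) (d : (Vec n × Vec m) × Vec m₁ × Vec m₂) :
    fderiv ℝ (fun s' => P.lagrDeriv s' e) s d = P.lagrHess s d.1 e +
      inner ℝ d.2.1 (fderiv ℝ P.hPair s.1 e) - inner ℝ d.2.2 (fderiv ℝ P.gPair s.1 e) := by
  have h1 : DifferentiableAt ℝ (fderiv ℝ P.fPair) s.1 :=
    (hs.f.fderiv_right (m := 1) (by norm_num)).differentiableAt (by simp)
  have h2 : DifferentiableAt ℝ (fderiv ℝ P.hPair) s.1 :=
    (hs.h.fderiv_right (m := 1) (by norm_num)).differentiableAt (by simp)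
  have h3 : DifferentiableAt ℝ (fderiv ℝ P.gPair) s.1 :=
    (hs.g.fderiv_right (m := 1) (by norm_num)).differentiableAt (by simp)
  have e1 := (h1.hasFDerivAt.comp s hasFDerivAt_fst).clm_apply (hasFDerivAt_const e s)
  have e2 := hasFDerivAt_inner_clm_apply (ContinuousLinearMap.fst ℝ (Vec m₁) (Vec m₂) ∘L
    ContinuousLinearMap.snd ℝ (Vec n × Vec m) _) (ContinuousLinearMap.fst ℝ _ _) (s := s) h2 e
  have e3 := hasFDerivAt_inner_clm_apply (ContinuousLinearMap.snd ℝ (Vec m₁) (Vec m₂) ∘L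
    ContinuousLinearMap.snd ℝ (Vec n × Vec m) _) (ContinuousLinearMap.fst ℝ _ _) (s := s) h3 e
  have key : HasFDerivAt (fun s' => P.lagrDeriv s' e) _ s := (e1.add e2).sub e3
  rw [fderiv_apply_of_hasFDerivAt key]
  simp only [lagrHess, add_apply, sub_apply, ContinuousLinearMap.comp_apply, innerSL_apply_apply,
    ContinuousLinearMap.flip_apply, ContinuousLinearMap.coe_fst', ContinuousLinearMap.coe_snd',
    real_inner_comm, zero_apply, map_zero, zero_add]
  ring

theorem InnerSmooth.contDiffAt_gradX {s : (Vec n × Vec m) × Vec m₁ × Vec m₂}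
    (hs : P.InnerSmooth s.1) : ContDiffAt ℝ 1
      (fun s' : (Vec n × Vec m) × Vec m₁ × Vec m₂ => P.gradX s'.1.1 s'.1.2 s'.2.1 s'.2.2) s := by
  refine contDiffAt_of_inner (r := 1) fun e =>
    (hs.contDiffAt_lagrDeriv.clm_apply contDiffAt_const).congr_of_eventuallyEq (f := fun s' =>
      P.lagrDeriv s' (e, 0)) ?_
  -- The gradient formula must hold on a whole neighbourhood before smoothness can be transferred;
  -- C² regularity at a point persists nearby.
  filter_upwards [continuous_fst.continuousAt.eventually hs.eventually] with s' hs'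
  exact hs'.inner_gradX e

theorem InnerSmooth.contDiffAt_gradY {s : (Vec n × Vec m) × Vec m₁ × Vec m₂}
    (hs : P.InnerSmooth s.1) : ContDiffAt ℝ 1
      (fun s' : (Vec n × Vec m) × Vec m₁ × Vec m₂ => P.gradY s'.1.1 s'.1.2 s'.2.1 s'.2.2) s := by
  refine contDiffAt_of_inner (r := 1) fun e =>
    (hs.contDiffAt_lagrDeriv.clm_apply contDiffAt_const).congr_of_eventuallyEq (f := fun s' =>
      P.lagrDeriv s' (0, e)) ?_
  filter_upwards [continuous_fst.continuousAt.eventually hs.eventually] with s' hs'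
  exact hs'.inner_gradY e

theorem InnerSmooth.inner_fderiv_gradX {s : (Vec n × Vec m) × Vec m₁ × Vec m₂}
    (hs : P.InnerSmooth s.1) (e : Vec n) (d : (Vec n × Vec m) × Vec m₁ × Vec m₂) :
    inner ℝ e (fderiv ℝ (fun s' : (Vec n × Vec m) × Vec m₁ × Vec m₂ =>
      P.gradX s'.1.1 s'.1.2 s'.2.1 s'.2.2) s d) = P.lagrHess s d.1 (e, 0) +
      inner ℝ d.2.1 (fderiv ℝ P.hPair s.1 (e, 0)) - inner ℝ d.2.2 (fderiv ℝ P.gPair s.1 (e, 0)) := by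
  rw [inner_fderiv_apply (hs.contDiffAt_gradX.differentiableAt (by simp)),
    ← hs.fderiv_lagrDeriv_apply]
  congr 1
  refine Filter.EventuallyEq.fderiv_eq ?_
  filter_upwards [continuous_fst.continuousAt.eventually hs.eventually] with s' hs'
  exact hs'.inner_gradX e

theorem InnerSmooth.inner_fderiv_gradY {s : (Vec n × Vec m) × Vec m₁ × Vec m₂}
    (hs : P.InnerSmooth s.1) (e : Vec m) (d : (Vec n × Vec m) × Vec m₁ × Vec m₂) :
    inner ℝ e (fderiv ℝ (fun s' : (Vec n × Vec m) × Vec m₁ × Vec m₂ =>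
      P.gradY s'.1.1 s'.1.2 s'.2.1 s'.2.2) s d) = P.lagrHess s d.1 (0, e) +
      inner ℝ d.2.1 (fderiv ℝ P.hPair s.1 (0, e)) - inner ℝ d.2.2 (fderiv ℝ P.gPair s.1 (0, e)) := by
  rw [inner_fderiv_apply (hs.contDiffAt_gradY.differentiableAt (by simp)),
    ← hs.fderiv_lagrDeriv_apply]
  congr 1
  refine Filter.EventuallyEq.fderiv_eq ?_
  filter_upwards [continuous_fst.continuousAt.eventually hs.eventually] with s' hs'
  exact hs'.inner_gradY e

end MinimaxProblem

/-! ### Differentiation of six-block tuples. -/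

section SixBlocks

variable {E F₁ F₂ F₃ F₄ F₅ F₆ : Type*} [NormedAddCommGroup E] [NormedSpace ℝ E]
  [NormedAddCommGroup F₁] [NormedSpace ℝ F₁] [NormedAddCommGroup F₂] [NormedSpace ℝ F₂]
  [NormedAddCommGroup F₃] [NormedSpace ℝ F₃] [NormedAddCommGroup F₄] [NormedSpace ℝ F₄]
  [NormedAddCommGroup F₅] [NormedSpace ℝ F₅] [NormedAddCommGroup F₆] [NormedSpace ℝ F₆]

theorem fderiv_prodMk_six {φ₁ : E → F₁} {φ₂ : E → F₂} {φ₃ : E → F₃} {φ₄ : E → F₄} {φ₅ : E → F₅}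
    {φ₆ : E → F₆} {x : E} (h₁ : DifferentiableAt ℝ φ₁ x) (h₂ : DifferentiableAt ℝ φ₂ x)
    (h₃ : DifferentiableAt ℝ φ₃ x) (h₄ : DifferentiableAt ℝ φ₄ x) (h₅ : DifferentiableAt ℝ φ₅ x)
    (h₆ : DifferentiableAt ℝ φ₆ x) (d : E) :
    fderiv ℝ (fun z => (φ₁ z, φ₂ z, φ₃ z, φ₄ z, φ₅ z, φ₆ z)) x d =
      (fderiv ℝ φ₁ x d, fderiv ℝ φ₂ x d, fderiv ℝ φ₃ x d, fderiv ℝ φ₄ x d, fderiv ℝ φ₅ x d,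
        fderiv ℝ φ₆ x d) := by
  rw [(h₁.hasFDerivAt.prodMk (h₂.hasFDerivAt.prodMk (h₃.hasFDerivAt.prodMk (h₄.hasFDerivAt.prodMk
    (h₅.hasFDerivAt.prodMk h₆.hasFDerivAt))))).fderiv]
  rfl

theorem contDiffAt_prodMk_six {r : WithTop ℕ∞} {φ₁ : E → F₁} {φ₂ : E → F₂} {φ₃ : E → F₃}
    {φ₄ : E → F₄} {φ₅ : E → F₅} {φ₆ : E → F₆} {x : E} (h₁ : ContDiffAt ℝ r φ₁ x)
    (h₂ : ContDiffAt ℝ r φ₂ x) (h₃ : ContDiffAt ℝ r φ₃ x) (h₄ : ContDiffAt ℝ r φ₄ x)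
    (h₅ : ContDiffAt ℝ r φ₅ x) (h₆ : ContDiffAt ℝ r φ₆ x) :
    ContDiffAt ℝ r (fun z => (φ₁ z, φ₂ z, φ₃ z, φ₄ z, φ₅ z, φ₆ z)) x :=
  h₁.prodMk (h₂.prodMk (h₃.prodMk (h₄.prodMk (h₅.prodMk h₆))))

end SixBlocks

/-! ### The derivative of the generalized-equation mapping. -/

namespace MinimaxProblem

variable {n m n₁ n₂ m₁ m₂ : ℕ} {P : MinimaxProblem n m n₁ n₂ m₁ m₂}
  {E : Type*} [NormedAddCommGroup E] [NormedSpace ℝ E]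
  (πx : E →L[ℝ] Vec n) (πu : E →L[ℝ] Vec n₁) (πv : E →L[ℝ] Vec n₂) (πy : E →L[ℝ] Vec m)
  (πmu : E →L[ℝ] Vec m₁) (πlam : E →L[ℝ] Vec m₂) {s : E}

theorem inner_stationX (x : Vec n) (u : Vec n₁) (v : Vec n₂) (y : Vec m) (mu : Vec m₁)
    (lam : Vec m₂) (e : Vec n) :
    inner ℝ e (P.stationX x u v y mu lam) = inner ℝ e (P.gradX x y mu lam) +
      inner ℝ u (fderiv ℝ P.H x e) + inner ℝ v (fderiv ℝ P.G x e) := by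
  rw [stationX, inner_add_right, inner_add_right, ContinuousLinearMap.adjoint_inner_right,
    ContinuousLinearMap.adjoint_inner_right, real_inner_comm u, real_inner_comm v]

/-- The variables enter through continuous linear maps on an arbitrary space, so the chain rules
never unfold the nested product; the actual projections are substituted at the end. -/
theorem contDiffAt_gradX_comp (hs : P.InnerSmooth (πx s, πy s)) :
    ContDiffAt ℝ 1 (fun z => P.gradX (πx z) (πy z) (πmu z) (πlam z)) s :=
  ContDiffAt.comp (g := fun s' : (Vec n × Vec m) × Vec m₁ × Vec m₂ =>
    P.gradX s'.1.1 s'.1.2 s'.2.1 s'.2.2) s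
    (InnerSmooth.contDiffAt_gradX (s := ((πx s, πy s), (πmu s, πlam s))) hs)
    ((πx.prod πy).prod (πmu.prod πlam)).contDiff.contDiffAt

theorem contDiffAt_gradY_comp (hs : P.InnerSmooth (πx s, πy s)) :
    ContDiffAt ℝ 1 (fun z => P.gradY (πx z) (πy z) (πmu z) (πlam z)) s :=
  ContDiffAt.comp (g := fun s' : (Vec n × Vec m) × Vec m₁ × Vec m₂ =>
    P.gradY s'.1.1 s'.1.2 s'.2.1 s'.2.2) s
    (InnerSmooth.contDiffAt_gradY (s := ((πx s, πy s), (πmu s, πlam s))) hs)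
    ((πx.prod πy).prod (πmu.prod πlam)).contDiff.contDiffAt

theorem fderiv_gradX_comp (hs : P.InnerSmooth (πx s, πy s)) (d : E) :
    fderiv ℝ (fun z => P.gradX (πx z) (πy z) (πmu z) (πlam z)) s d =
      fderiv ℝ (fun s' : (Vec n × Vec m) × Vec m₁ × Vec m₂ =>
        P.gradX s'.1.1 s'.1.2 s'.2.1 s'.2.2) ((πx s, πy s), (πmu s, πlam s))
          ((πx d, πy d), (πmu d, πlam d)) := by
  have h1 := (InnerSmooth.contDiffAt_gradX (s := ((πx s, πy s), (πmu s, πlam s)))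
    hs).differentiableAt (by simp)
  exact fderiv_apply_of_hasFDerivAt (HasFDerivAt.comp (g := fun s' : (Vec n × Vec m) × Vec m₁ × Vec m₂ =>
    P.gradX s'.1.1 s'.1.2 s'.2.1 s'.2.2) (f := fun z => ((πx z, πy z), (πmu z, πlam z))) s
    h1.hasFDerivAt ((πx.prod πy).prod (πmu.prod πlam)).hasFDerivAt) d

theorem fderiv_gradY_comp (hs : P.InnerSmooth (πx s, πy s)) (d : E) :
    fderiv ℝ (fun z => P.gradY (πx z) (πy z) (πmu z) (πlam z)) s d =
      fderiv ℝ (fun s' : (Vec n × Vec m) × Vec m₁ × Vec m₂ =>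
        P.gradY s'.1.1 s'.1.2 s'.2.1 s'.2.2) ((πx s, πy s), (πmu s, πlam s))
          ((πx d, πy d), (πmu d, πlam d)) := by
  have h1 := (InnerSmooth.contDiffAt_gradY (s := ((πx s, πy s), (πmu s, πlam s)))
    hs).differentiableAt (by simp)
  exact fderiv_apply_of_hasFDerivAt (HasFDerivAt.comp (g := fun s' : (Vec n × Vec m) × Vec m₁ × Vec m₂ =>
    P.gradY s'.1.1 s'.1.2 s'.2.1 s'.2.2) (f := fun z => ((πx z, πy z), (πmu z, πlam z))) s
    h1.hasFDerivAt ((πx.prod πy).prod (πmu.prod πlam)).hasFDerivAt) d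

theorem contDiffAt_stationX_comp (hs : P.InnerSmooth (πx s, πy s))
    (hH : ContDiffAt ℝ 2 P.H (πx s)) (hG : ContDiffAt ℝ 2 P.G (πx s)) :
    ContDiffAt ℝ 1
      (fun z => P.stationX (πx z) (πu z) (πv z) (πy z) (πmu z) (πlam z)) s := by
  refine contDiffAt_of_inner (r := 1) fun e => ?_
  simp only [inner_stationX]
  have h1 : ContDiffAt ℝ 1 (fderiv ℝ P.H) (πx s) := hH.fderiv_right (by norm_num)
  have h2 : ContDiffAt ℝ 1 (fderiv ℝ P.G) (πx s) := hG.fderiv_right (by norm_num)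
  have h3 := (h1.comp s πx.contDiff.contDiffAt).clm_apply (contDiffAt_const (c := e))
  have h4 := (h2.comp s πx.contDiff.contDiffAt).clm_apply (contDiffAt_const (c := e))
  exact ((contDiffAt_const.inner ℝ (contDiffAt_gradX_comp πx πy πmu πlam hs)).add
    (πu.contDiff.contDiffAt.inner ℝ h3)).add (πv.contDiff.contDiffAt.inner ℝ h4)

theorem inner_fderiv_stationX_comp (hs : P.InnerSmooth (πx s, πy s))
    (hH : ContDiffAt ℝ 2 P.H (πx s)) (hG : ContDiffAt ℝ 2 P.G (πx s)) (e : Vec n) (d : E) :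
    inner ℝ e (fderiv ℝ
      (fun z => P.stationX (πx z) (πu z) (πv z) (πy z) (πmu z) (πlam z)) s d) =
    P.lagrHess ((πx s, πy s), (πmu s, πlam s)) (πx d, πy d) (e, 0) +
      inner ℝ (πmu d) (fderiv ℝ P.hPair (πx s, πy s) (e, 0)) -
      inner ℝ (πlam d) (fderiv ℝ P.gPair (πx s, πy s) (e, 0)) +
      (inner ℝ (πu s) (fderiv ℝ (fderiv ℝ P.H) (πx s) (πx d) e) +
        inner ℝ (πu d) (fderiv ℝ P.H (πx s) e)) +
      (inner ℝ (πv s) (fderiv ℝ (fderiv ℝ P.G) (πx s) (πx d) e) +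
        inner ℝ (πv d) (fderiv ℝ P.G (πx s) e)) := by
  rw [inner_fderiv_apply
    ((contDiffAt_stationX_comp πx πu πv πy πmu πlam hs hH hG).differentiableAt (by simp))]
  simp only [inner_stationX]
  have h1 : DifferentiableAt ℝ (fderiv ℝ P.H) (πx s) :=
    (hH.fderiv_right (m := 1) (by norm_num)).differentiableAt (by simp)
  have h2 : DifferentiableAt ℝ (fderiv ℝ P.G) (πx s) :=
    (hG.fderiv_right (m := 1) (by norm_num)).differentiableAt (by simp)
  have h3 : DifferentiableAt ℝ (fun z => P.gradX (πx z) (πy z) (πmu z) (πlam z)) s :=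
    (contDiffAt_gradX_comp πx πy πmu πlam hs).differentiableAt (by simp)
  have h4 : DifferentiableAt ℝ (fun z => (inner ℝ e (P.gradX (πx z) (πy z) (πmu z) (πlam z)) : ℝ)) s :=
    (differentiableAt_const e).inner ℝ h3
  refine (fderiv_apply_of_hasFDerivAt ((h4.hasFDerivAt.add
    (hasFDerivAt_inner_clm_apply πu πx h1 e)).add (hasFDerivAt_inner_clm_apply πv πx h2 e)) d).trans ?_
  simp only [add_apply, ContinuousLinearMap.comp_apply, innerSL_apply_apply,
    ContinuousLinearMap.flip_apply]
  rw [← inner_fderiv_apply h3, fderiv_gradX_comp πx πy πmu πlam hs,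
    InnerSmooth.inner_fderiv_gradX (s := ((πx s, πy s), (πmu s, πlam s))) hs,
    real_inner_comm (πu d), real_inner_comm (πv d)]

section GeMap

variable {x : Vec n} {u : Vec n₁} {v : Vec n₂} {y : Vec m} {mu : Vec m₁} {lam : Vec m₂}

/-- The first block of a tuple, as a continuous linear map. -/
noncomputable def projX (n m n₁ n₂ m₁ m₂ : ℕ) : PDSpace n m n₁ n₂ m₁ m₂ →L[ℝ] Vec n :=
  ContinuousLinearMap.fst ℝ _ _

/-- The second block. -/
noncomputable def projU (n m n₁ n₂ m₁ m₂ : ℕ) : PDSpace n m n₁ n₂ m₁ m₂ →L[ℝ] Vec n₁ :=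
  ContinuousLinearMap.fst ℝ _ _ ∘L ContinuousLinearMap.snd ℝ _ _

/-- The third block. -/
noncomputable def projV (n m n₁ n₂ m₁ m₂ : ℕ) : PDSpace n m n₁ n₂ m₁ m₂ →L[ℝ] Vec n₂ :=
  ContinuousLinearMap.fst ℝ _ _ ∘L ContinuousLinearMap.snd ℝ _ _ ∘L ContinuousLinearMap.snd ℝ _ _

/-- The fourth block. -/
noncomputable def projY (n m n₁ n₂ m₁ m₂ : ℕ) : PDSpace n m n₁ n₂ m₁ m₂ →L[ℝ] Vec m :=
  ContinuousLinearMap.fst ℝ _ _ ∘L ContinuousLinearMap.snd ℝ _ _ ∘L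
    ContinuousLinearMap.snd ℝ _ _ ∘L ContinuousLinearMap.snd ℝ _ _

/-- The fifth block. -/
noncomputable def projMu (n m n₁ n₂ m₁ m₂ : ℕ) : PDSpace n m n₁ n₂ m₁ m₂ →L[ℝ] Vec m₁ :=
  ContinuousLinearMap.fst ℝ _ _ ∘L ContinuousLinearMap.snd ℝ _ _ ∘L
    ContinuousLinearMap.snd ℝ _ _ ∘L ContinuousLinearMap.snd ℝ _ _ ∘L ContinuousLinearMap.snd ℝ _ _

/-- The sixth block. -/
noncomputable def projLam (n m n₁ n₂ m₁ m₂ : ℕ) : PDSpace n m n₁ n₂ m₁ m₂ →L[ℝ] Vec m₂ :=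
  ContinuousLinearMap.snd ℝ _ _ ∘L ContinuousLinearMap.snd ℝ _ _ ∘L
    ContinuousLinearMap.snd ℝ _ _ ∘L ContinuousLinearMap.snd ℝ _ _ ∘L ContinuousLinearMap.snd ℝ _ _

/-- The generalized-equation mapping, with the blocks given by continuous linear maps. -/
noncomputable def geMapOf (P : MinimaxProblem n m n₁ n₂ m₁ m₂) (πx : E →L[ℝ] Vec n)
    (πu : E →L[ℝ] Vec n₁) (πv : E →L[ℝ] Vec n₂) (πy : E →L[ℝ] Vec m)
    (πmu : E →L[ℝ] Vec m₁) (πlam : E →L[ℝ] Vec m₂) (z : E) : PDSpace n m n₁ n₂ m₁ m₂ :=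
  (P.stationX (πx z) (πu z) (πv z) (πy z) (πmu z) (πlam z), P.H (πx z), -P.G (πx z),
    P.gradY (πx z) (πy z) (πmu z) (πlam z), P.hPair (πx z, πy z), -P.gPair (πx z, πy z))

theorem geMap_eq_geMapOf (P : MinimaxProblem n m n₁ n₂ m₁ m₂) :
    P.geMap = P.geMapOf (projX n m n₁ n₂ m₁ m₂) (projU n m n₁ n₂ m₁ m₂) (projV n m n₁ n₂ m₁ m₂)
      (projY n m n₁ n₂ m₁ m₂) (projMu n m n₁ n₂ m₁ m₂) (projLam n m n₁ n₂ m₁ m₂) := rfl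

theorem contDiffAt_geMapOf (hs : P.InnerSmooth (πx s, πy s))
    (hH : ContDiffAt ℝ 2 P.H (πx s)) (hG : ContDiffAt ℝ 2 P.G (πx s)) :
    ContDiffAt ℝ 1 (P.geMapOf πx πu πv πy πmu πlam) s := by
  have hxy : ContDiffAt ℝ 1 (fun z => (πx z, πy z)) s := (πx.prod πy).contDiff.contDiffAt
  have h12 : (1 : WithTop ℕ∞) ≤ 2 := by norm_num
  exact contDiffAt_prodMk_six (contDiffAt_stationX_comp πx πu πv πy πmu πlam hs hH hG)
    ((hH.of_le h12).comp s πx.contDiff.contDiffAt) ((hG.of_le h12).comp s πx.contDiff.contDiffAt).neg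
    (contDiffAt_gradY_comp πx πy πmu πlam hs)
    (ContDiffAt.comp (g := P.hPair) s (hs.h.of_le h12) hxy)
    (ContDiffAt.comp (g := P.gPair) s (hs.g.of_le h12) hxy).neg

theorem fderiv_geMapOf (hs : P.InnerSmooth (πx s, πy s))
    (hH : ContDiffAt ℝ 2 P.H (πx s)) (hG : ContDiffAt ℝ 2 P.G (πx s)) (d : E) :
    fderiv ℝ (P.geMapOf πx πu πv πy πmu πlam) s d =
      (fderiv ℝ (fun z => P.stationX (πx z) (πu z) (πv z) (πy z) (πmu z) (πlam z)) s d,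
        fderiv ℝ P.H (πx s) (πx d), -fderiv ℝ P.G (πx s) (πx d),
        fderiv ℝ (fun z => P.gradY (πx z) (πy z) (πmu z) (πlam z)) s d,
        fderiv ℝ P.hPair (πx s, πy s) (πx d, πy d),
        -fderiv ℝ P.gPair (πx s, πy s) (πx d, πy d)) := by
  have hxy : HasFDerivAt (fun z => (πx z, πy z)) (πx.prod πy) s := (πx.prod πy).hasFDerivAt
  have hH' := (hH.differentiableAt (by simp)).hasFDerivAt.comp s πx.hasFDerivAt
  have hG' := ((hG.differentiableAt (by simp)).hasFDerivAt.comp s πx.hasFDerivAt).neg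
  have hh' := (hs.h.differentiableAt (by simp)).hasFDerivAt.comp s hxy
  have hg' := ((hs.g.differentiableAt (by simp)).hasFDerivAt.comp s hxy).neg
  refine (fderiv_prodMk_six ((contDiffAt_stationX_comp πx πu πv πy πmu πlam hs hH hG).differentiableAt
    (by simp)) hH'.differentiableAt hG'.differentiableAt
    ((contDiffAt_gradY_comp πx πy πmu πlam hs).differentiableAt (by simp)) hh'.differentiableAt
    hg'.differentiableAt d).trans ?_
  rw [hH'.fderiv, hG'.fderiv, hh'.fderiv, hg'.fderiv]
  rfl

theorem contDiffAt_geMap (hs : P.InnerSmooth (x, y)) (hH : ContDiffAt ℝ 2 P.H x)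
    (hG : ContDiffAt ℝ 2 P.G x) : ContDiffAt ℝ 1 P.geMap (x, u, v, y, mu, lam) := by
  rw [geMap_eq_geMapOf]
  exact contDiffAt_geMapOf _ _ _ _ _ _ hs hH hG

/-- The blocks of the derivative of the generalized-equation mapping. -/
theorem fderiv_geMap (hs : P.InnerSmooth (x, y)) (hH : ContDiffAt ℝ 2 P.H x)
    (hG : ContDiffAt ℝ 2 P.G x) (d r : PDSpace n m n₁ n₂ m₁ m₂)
    (hr : fderiv ℝ P.geMap (x, u, v, y, mu, lam) d = r) :
    (∀ e : Vec n, P.lagrHess ((x, y), (mu, lam)) (d.1, d.2.2.2.1) (e, 0) +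
      inner ℝ d.2.2.2.2.1 (fderiv ℝ P.hPair (x, y) (e, 0)) -
      inner ℝ d.2.2.2.2.2 (fderiv ℝ P.gPair (x, y) (e, 0)) +
      (inner ℝ u (fderiv ℝ (fderiv ℝ P.H) x d.1 e) + inner ℝ d.2.1 (fderiv ℝ P.H x e)) +
      (inner ℝ v (fderiv ℝ (fderiv ℝ P.G) x d.1 e) + inner ℝ d.2.2.1 (fderiv ℝ P.G x e)) =
        inner ℝ e r.1) ∧
    fderiv ℝ P.H x d.1 = r.2.1 ∧ -fderiv ℝ P.G x d.1 = r.2.2.1 ∧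
    (∀ e : Vec m, P.lagrHess ((x, y), (mu, lam)) (d.1, d.2.2.2.1) (0, e) +
      inner ℝ d.2.2.2.2.1 (fderiv ℝ P.hPair (x, y) (0, e)) -
      inner ℝ d.2.2.2.2.2 (fderiv ℝ P.gPair (x, y) (0, e)) = inner ℝ e r.2.2.2.1) ∧
    fderiv ℝ P.hPair (x, y) (d.1, d.2.2.2.1) = r.2.2.2.2.1 ∧
    -fderiv ℝ P.gPair (x, y) (d.1, d.2.2.2.1) = r.2.2.2.2.2 := by
  rw [geMap_eq_geMapOf] at hr
  have h1 := (fderiv_geMapOf (projX n m n₁ n₂ m₁ m₂) (projU n m n₁ n₂ m₁ m₂)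
    (projV n m n₁ n₂ m₁ m₂) (projY n m n₁ n₂ m₁ m₂) (projMu n m n₁ n₂ m₁ m₂)
    (projLam n m n₁ n₂ m₁ m₂) (s := (x, u, v, y, mu, lam)) hs hH hG d).symm.trans hr
  subst h1
  refine ⟨fun e => ?_, rfl, rfl, fun e => ?_, rfl, rfl⟩
  · exact (inner_fderiv_stationX_comp (projX n m n₁ n₂ m₁ m₂) (projU n m n₁ n₂ m₁ m₂)
      (projV n m n₁ n₂ m₁ m₂) (projY n m n₁ n₂ m₁ m₂) (projMu n m n₁ n₂ m₁ m₂)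
      (projLam n m n₁ n₂ m₁ m₂) (s := (x, u, v, y, mu, lam)) hs hH hG e d).symm
  · have h2 := fderiv_gradY_comp (projX n m n₁ n₂ m₁ m₂) (projY n m n₁ n₂ m₁ m₂)
      (projMu n m n₁ n₂ m₁ m₂) (projLam n m n₁ n₂ m₁ m₂) (s := (x, u, v, y, mu, lam)) hs d
    have h3 := InnerSmooth.inner_fderiv_gradY (s := ((x, y), (mu, lam))) hs e
      ((d.1, d.2.2.2.1), (d.2.2.2.2.1, d.2.2.2.2.2))
    refine h3.symm.trans (congrArg (inner ℝ e) ?_)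
    exact h2.symm

end GeMap

end MinimaxProblem

/-! ### Linear independence of constraint gradients. -/

section LinearIndependence

/-- If d ↦ (⟨w_i, d⟩)_i were not onto, a nonzero functional would vanish on its range; its
coefficients would give a nontrivial vanishing combination of the w_i. -/
theorem exists_inner_eq_of_linearIndependent {ι : Type*} [Fintype ι] {k : ℕ} {w : ι → Vec k}
    (hw : LinearIndependent ℝ w) (τ : ι → ℝ) : ∃ d, ∀ i, inner ℝ (w i) d = τ i := by
  classical
  set L : Vec k →ₗ[ℝ] (ι → ℝ) := LinearMap.pi fun i => (innerSL ℝ (w i)).toLinearMap with hL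
  have hLa : ∀ d i, L d i = inner ℝ (w i) d := fun d i => rfl
  suffices h : LinearMap.range L = ⊤ by
    obtain ⟨d, hd⟩ := LinearMap.range_eq_top.1 h τ
    exact ⟨d, fun i => by rw [← hLa, hd]⟩
  by_contra h
  obtain ⟨f, hf0, hf⟩ := Submodule.exists_le_ker_of_lt_top _ (lt_top_iff_ne_top.2 h)
  have hrep : ∀ c : ι → ℝ, f c = ∑ i, f (Pi.single i 1) * c i := by
    intro c
    conv_lhs => rw [pi_eq_sum_univ' c]
    rw [map_sum]
    refine Finset.sum_congr rfl fun i _ => ?_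
    rw [map_smul, smul_eq_mul, mul_comm]
  have h1 : ∑ i, f (Pi.single i 1) • w i = 0 := by
    refine ext_inner_right ℝ fun d => ?_
    have h2 : f (L d) = 0 := hf ⟨d, rfl⟩
    rw [hrep] at h2
    simpa [sum_inner, inner_smul_left, hLa] using h2
  have h3 := Fintype.linearIndependent_iff.1 hw _ h1
  refine hf0 (LinearMap.ext fun c => ?_)
  rw [hrep]
  simp [h3]

variable {a k l : ℕ} {Φ : Vec a → Vec k} {Γ : Vec a → Vec l} {x : Vec a} {p : Fin l → Prop}
  [Fintype {i // p i}]

theorem inner_gradient_coord {Φ : Vec a → Vec k} {x : Vec a} (hΦ : DifferentiableAt ℝ Φ x) (j : Fin k)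
    (d : Vec a) : inner ℝ (gradient (fun x' => Φ x' j) x) d = fderiv ℝ Φ x d j := by
  rw [real_inner_comm, inner_gradient, fderiv_apply_coord hΦ]

theorem eq_zero_of_linearIndependent_gradient (hΦ : DifferentiableAt ℝ Φ x)
    (hΓ : DifferentiableAt ℝ Γ x)
    (hli : LinearIndependent ℝ (Sum.elim (fun j : Fin k => gradient (fun x' => Φ x' j) x)
      (fun i : {i // p i} => gradient (fun x' => Γ x' i) x)))
    {b : Vec k} {c : {i // p i} → ℝ}
    (h : ∀ e, inner ℝ b (fderiv ℝ Φ x e) + ∑ i, c i * fderiv ℝ Γ x e i = 0) :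
    b = 0 ∧ ∀ i, c i = 0 := by
  have h1 := Fintype.linearIndependent_iff.1 hli (Sum.elim b.ofLp c) (by
    refine ext_inner_right ℝ fun e => ?_
    rw [inner_zero_left, ← h e, Fintype.sum_sum_type, inner_add_left, sum_inner, sum_inner]
    simp only [Sum.elim_inl, Sum.elim_inr, inner_smul_left, inner_gradient_coord hΦ,
      inner_gradient_coord hΓ, PiLp.inner_apply]
    simp [mul_comm])
  exact ⟨by ext j; exact h1 (Sum.inl j), fun i => h1 (Sum.inr i)⟩

theorem exists_fderiv_eq_of_linearIndependent_gradient (hΦ : DifferentiableAt ℝ Φ x)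
    (hΓ : DifferentiableAt ℝ Γ x)
    (hli : LinearIndependent ℝ (Sum.elim (fun j : Fin k => gradient (fun x' => Φ x' j) x)
      (fun i : {i // p i} => gradient (fun x' => Γ x' i) x))) (τ : {i // p i} → ℝ) :
    ∃ d, fderiv ℝ Φ x d = 0 ∧ ∀ i : {i // p i}, fderiv ℝ Γ x d i = τ i := by
  obtain ⟨d, hd⟩ := exists_inner_eq_of_linearIndependent hli (Sum.elim 0 τ)
  refine ⟨d, ?_, fun i => ?_⟩
  · ext j
    rw [← inner_gradient_coord hΦ]
    exact hd (Sum.inl j)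
  · rw [← inner_gradient_coord hΓ]
    exact hd (Sum.inr i)

theorem inner_eq_sum_subtype {c z : Vec l} (h : ∀ i, ¬ p i → c i = 0) :
    inner ℝ c z = ∑ i : {i // p i}, c i * z i := by
  classical
  rw [PiLp.inner_apply, ← Fintype.sum_subtype_add_sum_subtype p]
  have : ∑ i : {i // ¬ p i}, inner ℝ (c i) (z i) = 0 :=
    Finset.sum_eq_zero fun i _ => by simp [h i i.2]
  rw [this, add_zero]
  refine Finset.sum_congr (by ext; simp) fun i _ => ?_
  simp [mul_comm]

end LinearIndependence

/-! ### The linearized inner system and the matrix K_α. -/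

namespace MinimaxProblem

variable {n m n₁ n₂ m₁ m₂ : ℕ} {P : MinimaxProblem n m n₁ n₂ m₁ m₂}
  {x : Vec n} {u : Vec n₁} {v : Vec n₂} {y : Vec m} {mu : Vec m₁} {lam : Vec m₂}

theorem InnerSmooth.fderiv_h_y (hs : P.InnerSmooth (x, y)) (e : Vec m) :
    fderiv ℝ (fun y' => P.h x y') y e = fderiv ℝ P.hPair (x, y) (0, e) :=
  fderiv_apply_of_hasFDerivAt (HasFDerivAt.comp (g := P.hPair) y
    (hs.h.differentiableAt (by simp)).hasFDerivAt (hasFDerivAt_prodMk_right x y)) e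

theorem InnerSmooth.fderiv_g_y (hs : P.InnerSmooth (x, y)) (e : Vec m) :
    fderiv ℝ (fun y' => P.g x y') y e = fderiv ℝ P.gPair (x, y) (0, e) :=
  fderiv_apply_of_hasFDerivAt (HasFDerivAt.comp (g := P.gPair) y
    (hs.g.differentiableAt (by simp)).hasFDerivAt (hasFDerivAt_prodMk_right x y)) e

theorem InnerSmooth.fderiv_f_y (hs : P.InnerSmooth (x, y)) (e : Vec m) :
    fderiv ℝ (fun y' => P.f x y') y e = fderiv ℝ P.fPair (x, y) (0, e) :=
  fderiv_apply_of_hasFDerivAt (HasFDerivAt.comp (g := P.fPair) y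
    (hs.f.differentiableAt (by simp)).hasFDerivAt (hasFDerivAt_prodMk_right x y)) e

theorem InnerSmooth.fderiv_h_x (hs : P.InnerSmooth (x, y)) (e : Vec n) :
    fderiv ℝ (fun x' => P.h x' y) x e = fderiv ℝ P.hPair (x, y) (e, 0) :=
  fderiv_apply_of_hasFDerivAt (HasFDerivAt.comp (g := P.hPair) x
    (hs.h.differentiableAt (by simp)).hasFDerivAt (hasFDerivAt_prodMk_left x y)) e

theorem InnerSmooth.fderiv_g_x (hs : P.InnerSmooth (x, y)) (e : Vec n) :
    fderiv ℝ (fun x' => P.g x' y) x e = fderiv ℝ P.gPair (x, y) (e, 0) :=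
  fderiv_apply_of_hasFDerivAt (HasFDerivAt.comp (g := P.gPair) x
    (hs.g.differentiableAt (by simp)).hasFDerivAt (hasFDerivAt_prodMk_left x y)) e

theorem InnerSmooth.differentiableAt_h_y (hs : P.InnerSmooth (x, y)) :
    DifferentiableAt ℝ (fun y' => P.h x y') y :=
  (HasFDerivAt.comp (g := P.hPair) y
    (hs.h.differentiableAt (by simp)).hasFDerivAt (hasFDerivAt_prodMk_right x y)).differentiableAt

theorem InnerSmooth.differentiableAt_g_y (hs : P.InnerSmooth (x, y)) :
    DifferentiableAt ℝ (fun y' => P.g x y') y :=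
  (HasFDerivAt.comp (g := P.gPair) y
    (hs.g.differentiableAt (by simp)).hasFDerivAt (hasFDerivAt_prodMk_right x y)).differentiableAt

theorem InnerSmooth.inner_fderiv_gradY_y (hs : P.InnerSmooth (x, y)) (b e : Vec m) :
    inner ℝ e (fderiv ℝ (fun y' => P.gradY x y' mu lam) y b) =
      P.lagrHess ((x, y), (mu, lam)) (0, b) (0, e) := by
  have h1 : HasFDerivAt (fun y' : Vec m => ((x, y'), (mu, lam)))
      ((ContinuousLinearMap.inr ℝ (Vec n) (Vec m)).prod 0) y :=
    (hasFDerivAt_prodMk_right (𝕜 := ℝ) x y).prodMk (hasFDerivAt_const (mu, lam) y)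
  have h2 := (InnerSmooth.contDiffAt_gradY (s := ((x, y), (mu, lam))) hs).differentiableAt (by simp)
  have h3 := fderiv_apply_of_hasFDerivAt (HasFDerivAt.comp
    (g := fun s' : (Vec n × Vec m) × Vec m₁ × Vec m₂ => P.gradY s'.1.1 s'.1.2 s'.2.1 s'.2.2) y
    h2.hasFDerivAt h1) b
  have h4 := InnerSmooth.inner_fderiv_gradY (s := ((x, y), (mu, lam))) hs e ((0, b), (0, 0))
  simp only [inner_zero_left, add_zero, sub_zero] at h4
  rw [← h4]
  exact congrArg (inner ℝ e) h3

theorem InnerSmooth.inner_fderiv_gradY_x (hs : P.InnerSmooth (x, y)) (b : Vec n) (e : Vec m) :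
    inner ℝ e (fderiv ℝ (fun x' => P.gradY x' y mu lam) x b) =
      P.lagrHess ((x, y), (mu, lam)) (b, 0) (0, e) := by
  have h1 : HasFDerivAt (fun x' : Vec n => ((x', y), (mu, lam)))
      ((ContinuousLinearMap.inl ℝ (Vec n) (Vec m)).prod 0) x :=
    (hasFDerivAt_prodMk_left (𝕜 := ℝ) x y).prodMk (hasFDerivAt_const (mu, lam) x)
  have h2 := (InnerSmooth.contDiffAt_gradY (s := ((x, y), (mu, lam))) hs).differentiableAt (by simp)
  have h3 := fderiv_apply_of_hasFDerivAt (HasFDerivAt.comp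
    (g := fun s' : (Vec n × Vec m) × Vec m₁ × Vec m₂ => P.gradY s'.1.1 s'.1.2 s'.2.1 s'.2.2) x
    h2.hasFDerivAt h1) b
  have h4 := InnerSmooth.inner_fderiv_gradY (s := ((x, y), (mu, lam))) hs e ((b, 0), (0, 0))
  simp only [inner_zero_left, add_zero, sub_zero] at h4
  rw [← h4]
  exact congrArg (inner ℝ e) h3

theorem InnerSmooth.inner_fderiv_gradX_x (hs : P.InnerSmooth (x, y)) (b e : Vec n) :
    inner ℝ e (fderiv ℝ (fun x' => P.gradX x' y mu lam) x b) =
      P.lagrHess ((x, y), (mu, lam)) (b, 0) (e, 0) := by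
  have h1 : HasFDerivAt (fun x' : Vec n => ((x', y), (mu, lam)))
      ((ContinuousLinearMap.inl ℝ (Vec n) (Vec m)).prod 0) x :=
    (hasFDerivAt_prodMk_left (𝕜 := ℝ) x y).prodMk (hasFDerivAt_const (mu, lam) x)
  have h2 := (InnerSmooth.contDiffAt_gradX (s := ((x, y), (mu, lam))) hs).differentiableAt (by simp)
  have h3 := fderiv_apply_of_hasFDerivAt (HasFDerivAt.comp
    (g := fun s' : (Vec n × Vec m) × Vec m₁ × Vec m₂ => P.gradX s'.1.1 s'.1.2 s'.2.1 s'.2.2) x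
    h2.hasFDerivAt h1) b
  have h4 := InnerSmooth.inner_fderiv_gradX (s := ((x, y), (mu, lam))) hs e ((b, 0), (0, 0))
  simp only [inner_zero_left, add_zero, sub_zero] at h4
  rw [← h4]
  exact congrArg (inner ℝ e) h3

theorem InnerSmooth.quadForm_hessMat_lagr_y (hs : P.InnerSmooth (x, y)) (d : Vec m) :
    quadForm (hessMat (fun y' => P.lagr x y' mu lam) y) d =
      P.lagrHess ((x, y), (mu, lam)) (0, d) (0, d) :=
  (quadForm_jacMat _ _ _).trans (hs.inner_fderiv_gradY_y d d)

theorem InnerSmooth.quadForm_hessMat_lagr_x (hs : P.InnerSmooth (x, y)) (d : Vec n) :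
    quadForm (hessMat (fun x' => P.lagr x' y mu lam) x) d =
      P.lagrHess ((x, y), (mu, lam)) (d, 0) (d, 0) :=
  (quadForm_jacMat _ _ _).trans (hs.inner_fderiv_gradX_x d d)

/-- The bilinear form of the matrix `K_α`. -/
theorem InnerSmooth.matK_mulVec_dotProduct (hs : P.InnerSmooth (x, y)) (a a' : Vec m)
    (b b' : Vec m₁) (c c' : P.ActiveY x y → ℝ) :
    (P.matK x y mu lam *ᵥ Sum.elim a.ofLp (Sum.elim b.ofLp c)) ⬝ᵥ
        Sum.elim a'.ofLp (Sum.elim b'.ofLp c') =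
      P.lagrHess ((x, y), (mu, lam)) (0, a) (0, a') +
        inner ℝ b (fderiv ℝ P.hPair (x, y) (0, a')) -
        ∑ i, c i * fderiv ℝ P.gPair (x, y) (0, a') i.1 +
        inner ℝ b' (fderiv ℝ P.hPair (x, y) (0, a)) -
        ∑ i, c' i * fderiv ℝ P.gPair (x, y) (0, a) i.1 := by
  have hY : (hessMat (fun y' => P.lagr x y' mu lam) y *ᵥ a.ofLp) ⬝ᵥ a'.ofLp =
      P.lagrHess ((x, y), (mu, lam)) (0, a) (0, a') := by
    rw [← hs.inner_fderiv_gradY_y (mu := mu) (lam := lam) a a', ← dotProduct_eq_inner,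
      ← jacMat_mulVec]
    rfl
  have hg : ∀ e : Vec m, P.jacYgAct x y *ᵥ e.ofLp =
      fun i => fderiv ℝ P.gPair (x, y) (0, e) i.1 := by
    intro e
    funext i
    rw [← hs.fderiv_g_y, ← jacMat_mulVec]
    rfl
  have hh : ∀ e : Vec m, jacMat (fun y' => P.h x y') y *ᵥ e.ofLp =
      (fderiv ℝ P.hPair (x, y) (0, e)).ofLp := by
    intro e
    rw [jacMat_mulVec, hs.fderiv_h_y]
  rw [matK, Matrix.fromBlocks_mulVec, sumElim_dotProduct_sumElim]
  simp only [Sum.elim_comp_inl, Sum.elim_comp_inr, Matrix.fromCols_mulVec_sumElim,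
    Matrix.fromRows_mulVec, Matrix.zero_mulVec, add_zero, sumElim_dotProduct_sumElim,
    add_dotProduct, hY, Matrix.neg_mulVec, neg_dotProduct, hg, hh, dotProduct_eq_inner]
  rw [Matrix.mulVec_transpose, Matrix.mulVec_transpose, ← Matrix.dotProduct_mulVec,
    ← Matrix.dotProduct_mulVec, hg, hh, dotProduct_eq_inner, real_inner_comm b]
  simp only [dotProduct, mul_comm]
  ring

/-- The bilinear form of the matrix `N_α`. -/
theorem InnerSmooth.matN_mulVec_dotProduct (hs : P.InnerSmooth (x, y)) (d : Vec n) (a' : Vec m)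
    (b' : Vec m₁) (c' : P.ActiveY x y → ℝ) :
    (P.matN x y mu lam *ᵥ d.ofLp) ⬝ᵥ Sum.elim a'.ofLp (Sum.elim b'.ofLp c') =
      P.lagrHess ((x, y), (mu, lam)) (d, 0) (0, a') +
        inner ℝ b' (fderiv ℝ P.hPair (x, y) (d, 0)) -
        ∑ i, c' i * fderiv ℝ P.gPair (x, y) (d, 0) i.1 := by
  have hg : P.jacXgAct x y *ᵥ d.ofLp = fun i => fderiv ℝ P.gPair (x, y) (d, 0) i.1 := by
    funext i
    rw [← hs.fderiv_g_x, ← jacMat_mulVec]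
    rfl
  rw [matN, Matrix.fromRows_mulVec, Matrix.fromRows_mulVec, sumElim_dotProduct_sumElim,
    sumElim_dotProduct_sumElim, jacMat_mulVec, jacMat_mulVec, Matrix.neg_mulVec, hg,
    dotProduct_eq_inner, dotProduct_eq_inner, hs.inner_fderiv_gradY_x, hs.fderiv_h_x, neg_dotProduct]
  simp only [dotProduct, mul_comm]
  ring

theorem lagrDeriv_eq (s : (Vec n × Vec m) × Vec m₁ × Vec m₂) (e : Vec n × Vec m) :
    P.lagrDeriv s e = fderiv ℝ P.fPair s.1 e + inner ℝ s.2.1 (fderiv ℝ P.hPair s.1 e) -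
      inner ℝ s.2.2 (fderiv ℝ P.gPair s.1 e) := rfl

/-- The critical cone of the inner problem contains the tangent space of the active constraints. -/
theorem mem_innerCriticalCone (hs : P.InnerSmooth (x, y)) (hK : P.InnerKKT x y mu lam) {d : Vec m}
    (hd : fderiv ℝ P.hPair (x, y) (0, d) = 0)
    (hd' : ∀ i, P.g x y i = 0 → fderiv ℝ P.gPair (x, y) (0, d) i = 0) :
    d ∈ P.innerCriticalCone x y := by
  refine ⟨by rw [hs.fderiv_h_y, hd], fun i hi => ?_, ?_⟩
  · rw [inner_gradient_coord hs.differentiableAt_g_y, hs.fderiv_g_y, hd' i hi]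
  -- By stationarity, ∇_y f · d = λᵀ J_y g d - μᵀ J_y h d. Both terms vanish, because λ is supported
  -- on the active set.
  · have h1 := InnerSmooth.inner_gradY (s := ((x, y), (mu, lam))) hs d
    simp only [hK.1, inner_zero_right, lagrDeriv_eq, hd] at h1
    have h2 : inner ℝ lam (fderiv ℝ P.gPair (x, y) (0, d)) = 0 := by
      rw [inner_eq_sum_subtype (p := fun i => P.g x y i = 0) (c := lam) fun i hi => ?_]
      · exact Finset.sum_eq_zero fun i _ => by rw [hd' i i.2, mul_zero]
      · have := (((complementary_iff _ _).1 hK.2.2).2 i).2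
        exact (mul_eq_zero.1 this).resolve_left hi
    rw [real_inner_comm, inner_gradient, hs.fderiv_f_y]
    linarith

/-- The lower blocks of a kernel equation make `a` tangent to the active constraints, hence
critical. Pairing the first block with `a` gives a zero Hessian form, so `a = 0` by the second-order
condition; linear independence then removes `b` and `c`. -/
theorem JacobianUniqueness.isUnit_matK (hs : P.InnerSmooth (x, y))
    (hJ : P.JacobianUniqueness x y mu lam) : IsUnit (P.matK x y mu lam) := by
  rw [← Matrix.mulVec_injective_iff_isUnit]
  refine (injective_iff_map_eq_zero (P.matK x y mu lam).mulVecLin).2 fun q hq => ?_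
  rw [Matrix.mulVecLin_apply] at hq
  obtain ⟨a, b, c, rfl⟩ : ∃ (a : Vec m) (b : Vec m₁) (c : P.ActiveY x y → ℝ),
      q = Sum.elim a.ofLp (Sum.elim b.ofLp c) := by
    refine ⟨WithLp.toLp 2 fun i => q (Sum.inl i), WithLp.toLp 2 fun i => q (Sum.inr (Sum.inl i)),
      fun i => q (Sum.inr (Sum.inr i)), ?_⟩
    funext i
    rcases i with i | i | i <;> rfl
  have key : ∀ (a' : Vec m) (b' : Vec m₁) (c' : P.ActiveY x y → ℝ), _ := fun a' b' c' =>
    (hs.matK_mulVec_dotProduct (mu := mu) (lam := lam) a a' b b' c c').symm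
  simp only [hq, zero_dotProduct] at key
  have hL0 : ∀ e, P.lagrHess ((x, y), (mu, lam)) e 0 = 0 := fun e => by
    simp [lagrHess]
  have h1 : fderiv ℝ P.hPair (x, y) (0, a) = 0 := vec_ext_inner fun b' => by
    simpa [hL0, Prod.mk_zero_zero] using key 0 b' 0
  have h2 : ∀ i, P.g x y i = 0 → fderiv ℝ P.gPair (x, y) (0, a) i = 0 := fun i hi => by
    simpa [hL0, Prod.mk_zero_zero, h1, Pi.single_apply] using key 0 0 (Pi.single ⟨i, hi⟩ 1)
  have ha : a = 0 := by
    by_contra ha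
    have h3 := hJ.sosc a (mem_innerCriticalCone hs hJ.kkt h1 h2) ha
    rw [hs.quadForm_hessMat_lagr_y] at h3
    have h4 := key a 0 0
    simp only [h1, inner_zero_right, Pi.zero_apply, zero_mul,
      Finset.sum_const_zero, add_zero, sub_zero] at h4
    have h5 : ∑ i : P.ActiveY x y, c i * fderiv ℝ P.gPair (x, y) (0, a) i.1 = 0 :=
      Finset.sum_eq_zero fun i _ => by rw [h2 i i.2, mul_zero]
    linarith
  subst ha
  have hL0' : ∀ e, P.lagrHess ((x, y), (mu, lam)) (0, 0) e = 0 := fun e => by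
    simp [lagrHess, Prod.mk_zero_zero]
  obtain ⟨hb, hc⟩ := eq_zero_of_linearIndependent_gradient (b := b) (c := fun i => -c i)
    hs.differentiableAt_h_y hs.differentiableAt_g_y hJ.licq fun e => by
      have h3 := key e 0 0
      simp only [hs.fderiv_h_y, hs.fderiv_g_y, neg_mul, Finset.sum_neg_distrib]
      simp only [hL0', inner_zero_left, Pi.zero_apply, zero_mul, Finset.sum_const_zero, add_zero,
        sub_zero, zero_add] at h3
      rw [← sub_eq_add_neg]
      exact h3
  subst hb
  funext i
  rcases i with i | i | i
  · rfl
  · rfl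
  · simpa using hc i

/-- The quadratic form of the reduced Hessian, given a solution of the linearized inner system. -/
theorem JacobianUniqueness.quadForm_matReduced (hs : P.InnerSmooth (x, y))
    (hJ : P.JacobianUniqueness x y mu lam) {dx : Vec n} {dy : Vec m} {dmu : Vec m₁} {dlam : Vec m₂}
    (hdlam : ∀ i, P.g x y i ≠ 0 → dlam i = 0)
    (h1 : ∀ e : Vec m, P.lagrHess ((x, y), (mu, lam)) (dx, dy) (0, e) +
      inner ℝ dmu (fderiv ℝ P.hPair (x, y) (0, e)) -
      inner ℝ dlam (fderiv ℝ P.gPair (x, y) (0, e)) = 0)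
    (h2 : fderiv ℝ P.hPair (x, y) (dx, dy) = 0)
    (h3 : ∀ i, P.g x y i = 0 → fderiv ℝ P.gPair (x, y) (dx, dy) i = 0) :
    P.matK x y mu lam *ᵥ Sum.elim dy.ofLp (Sum.elim dmu.ofLp fun i => dlam i.1) =
        -(P.matN x y mu lam *ᵥ dx.ofLp) ∧
    quadForm (P.matReduced x y mu lam) dx =
      P.lagrHess ((x, y), (mu, lam)) (dx, dy) (dx, 0) +
        inner ℝ dmu (fderiv ℝ P.hPair (x, y) (dx, 0)) -
        inner ℝ dlam (fderiv ℝ P.gPair (x, y) (dx, 0)) := by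
  set q := Sum.elim dy.ofLp (Sum.elim dmu.ofLp fun i : P.ActiveY x y => dlam i.1) with hq
  have hsplit : ((dx, dy) : Vec n × Vec m) = (dx, 0) + (0, dy) := by simp
  rw [hsplit] at h1 h2 h3
  rw [hsplit]
  simp only [lagrHess_add_left, map_add, PiLp.add_apply] at h1 h2 h3 ⊢
  have hin : ∀ z, inner ℝ dlam z = ∑ i : P.ActiveY x y, dlam i.1 * z i.1 := fun z =>
    inner_eq_sum_subtype (p := fun i => P.g x y i = 0) hdlam
  have hKq : P.matK x y mu lam *ᵥ q = -(P.matN x y mu lam *ᵥ dx.ofLp) := by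
    rw [eq_neg_iff_add_eq_zero]
    refine dotProduct_eq_zero_iff.1 fun r => ?_
    obtain ⟨a', b', c', rfl⟩ : ∃ (a : Vec m) (b : Vec m₁) (c : P.ActiveY x y → ℝ),
        r = Sum.elim a.ofLp (Sum.elim b.ofLp c) := by
      refine ⟨WithLp.toLp 2 fun i => r (Sum.inl i), WithLp.toLp 2 fun i => r (Sum.inr (Sum.inl i)),
        fun i => r (Sum.inr (Sum.inr i)), ?_⟩
      funext i
      rcases i with i | i | i <;> rfl
    rw [add_dotProduct, hq, hs.matK_mulVec_dotProduct, hs.matN_mulVec_dotProduct]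
    have e1 := h1 a'
    have e2 : inner ℝ b' (fderiv ℝ P.hPair (x, y) (dx, 0)) +
        inner ℝ b' (fderiv ℝ P.hPair (x, y) (0, dy)) = 0 := by
      rw [← inner_add_right, h2, inner_zero_right]
    have e3 : ∑ i : P.ActiveY x y, c' i * fderiv ℝ P.gPair (x, y) (dx, 0) i.1 +
        ∑ i : P.ActiveY x y, c' i * fderiv ℝ P.gPair (x, y) (0, dy) i.1 = 0 := by
      rw [← Finset.sum_add_distrib]
      exact Finset.sum_eq_zero fun i _ => by rw [← mul_add, h3 i.1 i.2, mul_zero]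
    rw [hin] at e1
    linarith
  refine ⟨hKq, ?_⟩
  have hdet : IsUnit (P.matK x y mu lam).det :=
    (Matrix.isUnit_iff_isUnit_det _).1 (hJ.isUnit_matK hs)
  -- The inner unknowns are q = -K_α⁻¹ N_α dx, so the correction -⟨K_α⁻¹ N_α dx, N_α dx⟩ equals ⟨N_α
  -- dx, q⟩.
  have hinv : (P.matK x y mu lam)⁻¹ *ᵥ (P.matN x y mu lam *ᵥ dx.ofLp) = -q := by
    rw [← neg_eq_iff_eq_neg.2 hKq, Matrix.mulVec_neg, Matrix.mulVec_mulVec,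
      Matrix.nonsing_inv_mul _ hdet, Matrix.one_mulVec]
  have hquad : quadForm ((P.matN x y mu lam)ᵀ * (P.matK x y mu lam)⁻¹ * P.matN x y mu lam) dx =
      -((P.matN x y mu lam *ᵥ dx.ofLp) ⬝ᵥ q) := by
    rw [quadForm, ← Matrix.mulVec_mulVec, ← Matrix.mulVec_mulVec, hinv, Matrix.mulVec_transpose,
      ← Matrix.dotProduct_mulVec, neg_dotProduct, dotProduct_comm]
  -- The mixed second-derivative term arises with its arguments in the opposite order, whence the
  -- appeal to symmetry.
  rw [matReduced, quadForm_sub, hquad, hq, hs.matN_mulVec_dotProduct, hs.quadForm_hessMat_lagr_x,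
    hin, lagrHess_symm (s := ((x, y), (mu, lam))) hs (0, dy)]
  ring

end MinimaxProblem

/-! ### Property A and nonsingularity of the linearized system. -/

namespace MinimaxProblem

variable {n m n₁ n₂ m₁ m₂ : ℕ} {P : MinimaxProblem n m n₁ n₂ m₁ m₂}
  {x : Vec n} {u : Vec n₁} {v : Vec n₂} {y : Vec m} {mu : Vec m₁} {lam : Vec m₂}

theorem mem_outerCriticalCone (hG : DifferentiableAt ℝ P.G x)
    (hK : P.OuterKKT x u v y mu lam) {d : Vec n} (h1 : fderiv ℝ P.H x d = 0)
    (h2 : ∀ i, P.G x i = 0 → fderiv ℝ P.G x d i ≤ 0) (h3 : ∀ i, 0 < v i → fderiv ℝ P.G x d i = 0) :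
    d ∈ P.outerCriticalCone x y mu lam := by
  refine ⟨h1, fun i hi => by rw [inner_gradient_coord hG]; exact h2 i hi, ?_⟩
  have h4 := inner_stationX (P := P) x u v y mu lam d
  have h5 : inner ℝ v (fderiv ℝ P.G x d) = 0 := by
    rw [PiLp.inner_apply]
    refine Finset.sum_eq_zero fun i _ => ?_
    rcases (hK.2.2.1 i).eq_or_lt with h | h
    · simp [← h]
    · simp [h3 i h]
  rw [hK.1, h1, h5, inner_zero_right, inner_zero_right, add_zero, add_zero] at h4
  rw [real_inner_comm, ← h4]

/-- Linear independence supplies a critical direction `d₀` that is strictly inward at the active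
constraints with zero multiplier. Adding a large multiple of it to `d` gives a critical direction,
and `d` is the affine combination (d + R d₀) - R d₀ + 0 of points of the cone. -/
theorem mem_affineSpan_outerCriticalCone (hH : DifferentiableAt ℝ P.H x)
    (hG : DifferentiableAt ℝ P.G x) (hK : P.OuterKKT x u v y mu lam)
    (hli : LinearIndependent ℝ
      (Sum.elim (fun j : Fin n₁ => gradient (fun x' => P.H x' j) x)
        (fun i : {i : Fin n₂ // P.G x i = 0} => gradient (fun x' => P.G x' i) x)))
    {d : Vec n} (h1 : fderiv ℝ P.H x d = 0) (h2 : ∀ i, 0 < v i → fderiv ℝ P.G x d i = 0) :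
    d ∈ affineSpan ℝ (P.outerCriticalCone x y mu lam) := by
  have hcompl := (complementary_iff _ _).1 hK.2.2
  have hact : ∀ i, 0 < v i → P.G x i = 0 := fun i hi =>
    (mul_eq_zero.1 (hcompl.2 i).2).resolve_right hi.ne'
  obtain ⟨d₀, hd₀, hτ⟩ := exists_fderiv_eq_of_linearIndependent_gradient hH hG hli
    (fun i => if 0 < v i.1 then 0 else -1)
  -- Any bound for all components would do; the sum of absolute values is one that is also valid
  -- without constraints.
  set R : ℝ := ∑ i, |fderiv ℝ P.G x d i| with hR
  have hR0 : 0 ≤ R := Finset.sum_nonneg fun i _ => abs_nonneg _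
  have hle : ∀ i, fderiv ℝ P.G x d i ≤ R := fun i => (le_abs_self _).trans
    (Finset.single_le_sum (f := fun i => |fderiv ℝ P.G x d i|) (fun i _ => abs_nonneg _)
      (Finset.mem_univ i))
  have hcoord : ∀ i, P.G x i = 0 → fderiv ℝ P.G x d₀ i = if 0 < v i then 0 else -1 :=
    fun i hi => hτ ⟨i, hi⟩
  have m0 : (0 : Vec n) ∈ P.outerCriticalCone x y mu lam :=
    mem_outerCriticalCone hG hK (by simp) (by simp) (by simp)
  have m1 : R • d₀ ∈ P.outerCriticalCone x y mu lam := by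
    refine mem_outerCriticalCone hG hK (by simp [hd₀]) (fun i hi => ?_) fun i hi => ?_
    · rw [map_smul, PiLp.smul_apply, hcoord i hi, smul_eq_mul]
      split_ifs <;> linarith
    · rw [map_smul, PiLp.smul_apply, hcoord i (hact i hi), if_pos hi, smul_zero]
  have m2 : d + R • d₀ ∈ P.outerCriticalCone x y mu lam := by
    refine mem_outerCriticalCone hG hK (by simp [hd₀, h1]) (fun i hi => ?_) fun i hi => ?_
    · rw [map_add, map_smul, PiLp.add_apply, PiLp.smul_apply, hcoord i hi, smul_eq_mul]
      split_ifs with h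
      · rw [h2 i h]; linarith
      · linarith [hle i]
    · rw [map_add, map_smul, PiLp.add_apply, PiLp.smul_apply, hcoord i (hact i hi), if_pos hi,
        h2 i hi, smul_zero, add_zero]
  have := AffineSubspace.smul_vsub_vadd_mem (affineSpan ℝ (P.outerCriticalCone x y mu lam)) (1 : ℝ)
    (subset_affineSpan ℝ _ m2) (subset_affineSpan ℝ _ m1) (subset_affineSpan ℝ _ m0)
  simpa using this

theorem eq_zero_of_adjoint_eq_zero (hH : DifferentiableAt ℝ P.H x) (hG : DifferentiableAt ℝ P.G x)
    (hli : LinearIndependent ℝ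
      (Sum.elim (fun j : Fin n₁ => gradient (fun x' => P.H x' j) x)
        (fun i : {i : Fin n₂ // P.G x i = 0} => gradient (fun x' => P.G x' i) x)))
    {du : Vec n₁} {dv : Vec n₂} (hdv : ∀ i, P.G x i ≠ 0 → dv i = 0)
    (h : ∀ e, inner ℝ du (fderiv ℝ P.H x e) + inner ℝ dv (fderiv ℝ P.G x e) = 0) :
    du = 0 ∧ dv = 0 := by
  obtain ⟨h1, h2⟩ := eq_zero_of_linearIndependent_gradient (c := fun i => dv i.1) hH hG hli fun e => by
    rw [← h e, ← inner_eq_sum_subtype (p := fun i => P.G x i = 0) hdv]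
  refine ⟨h1, ?_⟩
  ext i
  by_cases hi : P.G x i = 0
  · exact h2 ⟨i, hi⟩
  · exact hdv i hi

theorem OuterKKT.multiplier_eq_zero (hK : P.OuterKKT x u v y mu lam) (i : Fin n₂)
    (hi : P.G x i ≠ 0) : v i = 0 :=
  (mul_eq_zero.1 (((complementary_iff _ _).1 hK.2.2).2 i).2).resolve_left hi

/-- The difference of two multipliers is supported on active constraints and is annihilated by the
transposed Jacobian, so it vanishes by linear independence. The supremum in the second-order
condition thus concerns a single multiplier. -/
theorem PropertyA.eq_of_mem_outerMultipliers (hA : P.PropertyA x u v y mu lam)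
    (hH : DifferentiableAt ℝ P.H x) (hG : DifferentiableAt ℝ P.G x) {p : Vec n₁ × Vec n₂}
    (hp : p ∈ P.outerMultipliers x y mu lam) : p = (u, v) := by
  have hp' : P.OuterKKT x p.1 p.2 y mu lam := hp
  obtain ⟨h1, h2⟩ := eq_zero_of_adjoint_eq_zero hH hG hA.licq (du := p.1 - u) (dv := p.2 - v)
    (fun i hi => by
      rw [PiLp.sub_apply, hp'.multiplier_eq_zero i hi, hA.outerKKT.multiplier_eq_zero i hi, sub_zero])
    fun e => by
      have e1 := inner_stationX (P := P) x u v y mu lam e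
      have e2 := inner_stationX (P := P) x p.1 p.2 y mu lam e
      rw [hA.outerKKT.1, inner_zero_right] at e1
      rw [hp'.1, inner_zero_right] at e2
      rw [inner_sub_left, inner_sub_left]
      linarith
  exact Prod.ext (sub_eq_zero.1 h1) (sub_eq_zero.1 h2)

theorem PropertyA.quadForm_pos (hA : P.PropertyA x u v y mu lam)
    (hH : DifferentiableAt ℝ P.H x) (hG : DifferentiableAt ℝ P.G x) {d : Vec n}
    (hd : d ∈ affineSpan ℝ (P.outerCriticalCone x y mu lam)) (hd0 : d ≠ 0) :
    0 < quadForm (P.matConstr x u v) d + quadForm (P.matReduced x y mu lam) d := by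
  have h1 := hA.strongSOSC d hd hd0
  have h2 : (⨆ p ∈ P.outerMultipliers x y mu lam,
      ((quadForm (P.matConstr x p.1 p.2) d : ℝ) : EReal)) ≤
        ((quadForm (P.matConstr x u v) d : ℝ) : EReal) :=
    iSup₂_le fun p hp => by rw [hA.eq_of_mem_outerMultipliers hH hG hp]
  have h3 := h1.trans_le (add_le_add_left h2 _)
  rw [← EReal.coe_add] at h3
  exact_mod_cast h3

/-- The nonsingularity of the linearized KKT system under Property A. -/
theorem PropertyA.eq_zero (hA : P.PropertyA x u v y mu lam) (hs : P.InnerSmooth (x, y))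
    (hH : ContDiffAt ℝ 2 P.H x) (hG : ContDiffAt ℝ 2 P.G x)
    {dx : Vec n} {du : Vec n₁} {dv : Vec n₂} {dy : Vec m} {dmu : Vec m₁} {dlam : Vec m₂}
    (h1 : ∀ e : Vec n, P.lagrHess ((x, y), (mu, lam)) (dx, dy) (e, 0) +
      inner ℝ dmu (fderiv ℝ P.hPair (x, y) (e, 0)) - inner ℝ dlam (fderiv ℝ P.gPair (x, y) (e, 0)) +
      (inner ℝ u (fderiv ℝ (fderiv ℝ P.H) x dx e) + inner ℝ du (fderiv ℝ P.H x e)) +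
      (inner ℝ v (fderiv ℝ (fderiv ℝ P.G) x dx e) + inner ℝ dv (fderiv ℝ P.G x e)) = 0)
    (h2 : fderiv ℝ P.H x dx = 0) (h3 : ∀ i, 0 ≤ dv i * fderiv ℝ P.G x dx i)
    (h3v : ∀ i, 0 < v i → fderiv ℝ P.G x dx i = 0) (hdv : ∀ i, P.G x i ≠ 0 → dv i = 0)
    (h4 : ∀ e : Vec m, P.lagrHess ((x, y), (mu, lam)) (dx, dy) (0, e) +
      inner ℝ dmu (fderiv ℝ P.hPair (x, y) (0, e)) -
      inner ℝ dlam (fderiv ℝ P.gPair (x, y) (0, e)) = 0)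
    (h5 : fderiv ℝ P.hPair (x, y) (dx, dy) = 0)
    (h6 : ∀ i, P.g x y i = 0 → fderiv ℝ P.gPair (x, y) (dx, dy) i = 0)
    (hdlam : ∀ i, P.g x y i ≠ 0 → dlam i = 0) :
    dx = 0 ∧ du = 0 ∧ dv = 0 ∧ dy = 0 ∧ dmu = 0 ∧ dlam = 0 := by
  have hHd : DifferentiableAt ℝ P.H x := hH.differentiableAt (by simp)
  have hGd : DifferentiableAt ℝ P.G x := hG.differentiableAt (by simp)
  obtain ⟨hKN, hquad⟩ := hA.innerJU.quadForm_matReduced hs hdlam h4 h5 h6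
  -- Pairing the outer equation with dx gives the form of the second-order condition plus ⟨dv, JG
  -- dx⟩, with total zero. The latter term is nonnegative, so a nonzero dx in Aff 𝒞 would contradict
  -- positivity.
  have hdx : dx = 0 := by
    by_contra hdx
    have hpos := hA.quadForm_pos hHd hGd
      (mem_affineSpan_outerCriticalCone hHd hGd hA.outerKKT hA.licq h2 h3v) hdx
    rw [matConstr, quadForm_add, sum_mul_quadForm_hessMat hH, sum_mul_quadForm_hessMat hG,
      hquad] at hpos
    have e1 := h1 dx
    rw [h2, inner_zero_right] at e1
    have e2 : 0 ≤ inner ℝ dv (fderiv ℝ P.G x dx) := by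
      rw [PiLp.inner_apply]
      refine Finset.sum_nonneg fun i _ => ?_
      simpa [mul_comm] using h3 i
    linarith
  subst hdx
  have hq : Sum.elim dy.ofLp (Sum.elim dmu.ofLp fun i : P.ActiveY x y => dlam i.1) = 0 := by
    have hinj := Matrix.mulVec_injective_iff_isUnit.2 (hA.innerJU.isUnit_matK hs)
    refine hinj ?_
    rw [hKN, WithLp.ofLp_zero, Matrix.mulVec_zero, neg_zero, Matrix.mulVec_zero]
  have hdy : dy = 0 := by
    ext i
    exact congrFun hq (Sum.inl i)
  have hdmu : dmu = 0 := by
    ext i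
    exact congrFun hq (Sum.inr (Sum.inl i))
  have hdlam0 : dlam = 0 := by
    ext i
    by_cases hi : P.g x y i = 0
    · exact congrFun hq (Sum.inr (Sum.inr ⟨i, hi⟩))
    · exact hdlam i hi
  subst hdy hdmu hdlam0
  obtain ⟨hdu, hdv0⟩ := eq_zero_of_adjoint_eq_zero hHd hGd hA.licq hdv (du := du) fun e => by
    simpa [lagrHess, Prod.mk_zero_zero] using h1 e
  exact ⟨rfl, hdu, hdv0, rfl, rfl, rfl⟩

theorem slopeSet_of_pos {a t : ℝ} (ha : 0 < a) (ht : t ∈ slopeSet a) : t = 0 := by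
  rwa [slopeSet, if_neg ha.not_gt, if_pos ha] at ht

theorem slopeSet_of_neg {a t : ℝ} (ha : a < 0) (ht : t ∈ slopeSet a) : t = 1 := by
  rwa [slopeSet, if_pos ha] at ht

/-- A kernel vector solves the linearized KKT system with dv = (1 - t) dw and JG dx = t dw
componentwise. Outer slopes are 0 where v > 0 and 1 at inactive constraints; inner slopes are fully
determined by strict complementarity. -/
theorem PropertyA.normalJac_injective (hA : P.PropertyA x u v y mu lam) (hs : P.InnerSmooth (x, y))
    (hH : ContDiffAt ℝ 2 P.H x) (hG : ContDiffAt ℝ 2 P.G x) {t : Fin n₂ ⊕ Fin m₂ → ℝ}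
    (ht : t ∈ (kktCoords n m n₁ n₂ m₁ m₂).slopeBox
      (x, u, v + P.G x, y, mu, lam + P.g x y)) :
    Function.Injective ((kktCoords n m n₁ n₂ m₁ m₂).normalJac
      (fderiv ℝ P.geMap (x, u, v, y, mu, lam)) t) := by
  refine (injective_iff_map_eq_zero _).2 fun d hd => ?_
  have htG : ∀ i, t (Sum.inl i) ∈ slopeSet (v i + P.G x i) := fun i => ht (Sum.inl i) trivial
  have htg : ∀ i, t (Sum.inr i) ∈ slopeSet (lam i + P.g x y i) := fun i => ht (Sum.inr i) trivial
  have hcG := (complementary_iff _ _).1 hA.outerKKT.2.2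
  have hcg := (complementary_iff _ _).1 hA.innerJU.kkt.2.2
  have hG1 : ∀ i, P.G x i ≠ 0 → t (Sum.inl i) = 1 := fun i hi => by
    refine slopeSet_of_neg ?_ (htG i)
    rw [hA.outerKKT.multiplier_eq_zero i hi, zero_add]
    exact lt_of_le_of_ne (hcG.2 i).1 hi
  have hG0 : ∀ i, 0 < v i → t (Sum.inl i) = 0 := fun i hi => by
    refine slopeSet_of_pos ?_ (htG i)
    rwa [(mul_eq_zero.1 (hcG.2 i).2).resolve_right hi.ne', add_zero]
  have hg1 : ∀ i, P.g x y i ≠ 0 → t (Sum.inr i) = 1 := fun i hi => by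
    refine slopeSet_of_neg ?_ (htg i)
    rw [(mul_eq_zero.1 (hcg.2 i).2).resolve_left hi, zero_add]
    exact lt_of_le_of_ne (hcg.2 i).1 hi
  have hg0 : ∀ i, P.g x y i = 0 → t (Sum.inr i) = 0 := fun i hi => by
    refine slopeSet_of_pos ?_ (htg i)
    have := hA.innerJU.strictCompl i
    rw [hi, sub_zero] at this
    rwa [hi, add_zero]
  obtain ⟨dx, du, dw, dy, dmu, dxi⟩ := d
  rw [OrthantCoords.normalJac_apply, add_eq_zero_iff_eq_neg, kktCoords_diagOp_apply] at hd
  simp only [Prod.mk_sub_mk, sub_zero, Prod.neg_mk, neg_zero] at hd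
  obtain ⟨e1, e2, e3, e4, e5, e6⟩ := fderiv_geMap hs hH hG _ _ hd
  simp only [inner_zero_right] at e1 e2 e3 e4 e5 e6
  have e3' : ∀ i, fderiv ℝ P.G x dx i = t (Sum.inl i) * dw i := fun i => by
    rw [neg_inj] at e3; rw [e3]
  have e6' : ∀ i, fderiv ℝ P.gPair (x, y) (dx, dy) i = t (Sum.inr i) * dxi i := fun i => by
    rw [neg_inj] at e6; rw [e6]
  obtain ⟨hdx, hdu, hdv, hdy, hdmu, hdlam⟩ := hA.eq_zero hs hH hG e1 e2 (fun i => by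
      have h1 := slopeSet_subset _ (htG i)
      rw [e3', PiLp.sub_apply]
      have : (dw i - t (Sum.inl i) * dw i) * (t (Sum.inl i) * dw i) =
        t (Sum.inl i) * (1 - t (Sum.inl i)) * (dw i) ^ 2 := by ring
      simp only
      rw [this]
      exact mul_nonneg (mul_nonneg h1.1 (sub_nonneg.2 h1.2)) (sq_nonneg _))
    (fun i hi => by rw [e3', hG0 i hi, zero_mul])
    (fun i hi => by simp [hG1 i hi]) e4 e5
    (fun i hi => by rw [e6', hg0 i hi, zero_mul]) (fun i hi => by simp [hg1 i hi])
  subst hdx hdu hdy hdmu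
  have hdw : dw = 0 := by
    ext i
    have h1 := congrArg (fun z : Vec n₂ => z i) hdv
    have h2 := e3' i
    simp only [map_zero, PiLp.zero_apply, PiLp.sub_apply] at h1 h2
    rw [← h2, sub_zero] at h1
    exact h1
  have hdxi : dxi = 0 := by
    ext i
    have h1 := congrArg (fun z : Vec m₂ => z i) hdlam
    have h2 := e6' i
    simp only [Prod.mk_zero_zero, map_zero, PiLp.zero_apply, PiLp.sub_apply] at h1 h2
    rw [← h2, sub_zero] at h1
    exact h1
  subst hdw hdxi
  rfl

end MinimaxProblem

theorem mainTheorem2 {n m n₁ n₂ m₁ m₂ : ℕ} (P : MinimaxProblem n m n₁ n₂ m₁ m₂)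
    (x : Vec n) (u : Vec n₁) (v : Vec n₂) (y : Vec m) (mu : Vec m₁) (lam : Vec m₂)
    (hf : ContDiffAt ℝ 2 (fun p : Vec n × Vec m => P.f p.1 p.2) (x, y))
    (hh : ContDiffAt ℝ 2 (fun p : Vec n × Vec m => P.h p.1 p.2) (x, y))
    (hg : ContDiffAt ℝ 2 (fun p : Vec n × Vec m => P.g p.1 p.2) (x, y))
    (hH : ContDiffAt ℝ 2 P.H x)
    (hG : ContDiffAt ℝ 2 P.G x)
    (hKKT : P.IsKKT x u v y mu lam) :
    (P.PropertyA x u v y mu lam →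
      ∀ V ∈ clarkeJacobian P.kojima (x, u, v + P.G x, y, mu, lam + P.g x y),
        Function.Bijective V) ∧
    ((∀ V ∈ clarkeJacobian P.kojima (x, u, v + P.G x, y, mu, lam + P.g x y),
        Function.Bijective V) →
      LocallyLipschitzHomeomorphNear P.kojima (x, u, v + P.G x, y, mu, lam + P.g x y)) ∧
    (LocallyLipschitzHomeomorphNear P.kojima (x, u, v + P.G x, y, mu, lam + P.g x y) ↔
      StronglyRegularSolution P.geMap (x, u, v, y, mu, lam)) := by
  have hs : P.InnerSmooth (x, y) := ⟨hf, hh, hg⟩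
  have hT : ContDiffAt ℝ 1 P.geMap (x, u, v, y, mu, lam) :=
    MinimaxProblem.contDiffAt_geMap hs hH hG
  refine ⟨fun hA V hV => ?_, P.locallyLipschitzHomeomorphNear_kojima hT hKKT,
    P.locallyLipschitzHomeomorphNear_kojima_iff hT hKKT⟩
  rw [P.clarkeJacobian_kojima hT hKKT] at hV
  obtain ⟨t, ht, rfl⟩ := hV
  have hinj := hA.normalJac_injective hs hH hG ht
  have hsurj := (LinearMap.injective_iff_surjective
    (f := ((kktCoords n m n₁ n₂ m₁ m₂).normalJac
      (fderiv ℝ P.geMap (x, u, v, y, mu, lam)) t).toLinearMap)).1 hinj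
  exact (flipG n m n₁ n₂ m₁ m₂).bijective.comp ⟨hinj, hsurj⟩
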